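/- **Conventions.** Let $P$ be a smooth manifold (Hausdorff, second countable), $R=C^\infty(P)$ the algebra of real smooth functions, and $A\to P$ a Lie algebroid of finite rank with anchor $\rho:A\to TP$. Its universal enveloping algebra $UA$ is the unital real algebra generated by $R$ and $\Gamma(A)$ with $f\cdot X=fX$, $X\cdot f-f\cdot X=\rho(X)f$, $X\cdot Y-Y\cdot X=[X,Y]$. It is a cocommutative Hopf algebroid over $R$: source and target maps are the inclusion $R\subset UA$, the coproduct $\Delta:UA\to UA\otimes_R UA$ is the multiplicative extension of $\Delta f=f\otimes 1$, $\Delta X=X\otimes 1+1\otimes X$, and the counit is the projection $UA\to R$. A Hopf algebroid $(H,R,\alpha,\beta,m,\Delta,\epsilon)$ consists of algebras $H$, $R$, an algebra map $\alpha:R\to H$ and an algebra anti-homomorphism $\beta:R\to H$ with commuting images (so that $H$ is an $(R,R)$-bimodule by $a\cdot h=\alpha(a)h$, $h\cdot a=\beta(a)h$), a coassociative bimodule map $\Delta:H\to H\otimes_RH$ with $\Delta(1)=1\otimes1$, $\Delta(h)(\beta(a)\otimes1-1\otimes\alpha(a))=0$, $\Delta(h_1h_2)=\Delta(h_1)\Delta(h_2)$,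 and a bimodule map $\epsilon:H\to R$ with $\epsilon(1)=1$ and $(\epsilon\otimes\mathrm{id})\Delta=(\mathrm{id}\otimes\epsilon)\Delta=\mathrm{id}$. No antipode is required. In a topological Hopf algebroid over $\mathbb R[[\hbar]]$, tensor products are completed in the $\hbar$-adic topology. A quantum groupoid is a deformation of $UA$: a topological Hopf algebroid $(U_\hbar A,R_\hbar,\alpha_\hbar,\beta_\hbar,m_\hbar,\Delta_\hbar,\epsilon_\hbar)$ over $\mathbb R[[\hbar]]$ with isomorphisms of $\mathbb R[[\hbar]]$-modules $U_\hbar A\cong UA[[\hbar]]$ and $R_\hbar\cong C^\infty(P)[[\hbar]]$ preserving the units, whose structure maps are those of $UA$ modulo $\hbar$; for $\Delta_\hbar$ this uses the reduction $U_\hbar A\otimes_{R_\hbar}U_\hbar A\to UA\otimes_RUA$, $\hbar\mapsto0$. Write $*_\hbar$ for the product of $R_\hbar$. For a Lie algebroid structure on $A^*$ with anchor $\rho_*$, its differential $d_*$ is the derivation of degree one of $\Gamma(\wedge^\bullet A)$ with $\langle\xi,d_*f\rangle=\rho_*(\xi)f$ and $(d_*X)(\xi,\eta)=\rho_*(\xi)\langle\eta,X\rangle-\rho_*(\eta)\langle\xi,X\rangle-\langle[\xi,\eta],X\rangle$.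 The pair $(A,A^*)$ is a Lie bialgebroid if $d_*[X,Y]=[d_*X,Y]+[X,d_*Y]$ for all $X,Y\in\Gamma(A)$ (Schouten bracket); the induced Poisson structure on $P$ is the one given by the bundle map $\rho\circ\rho_*^*:T^*P\to TP$, that is $\{f,g\}=\rho(d_*f)g$. **Theorem B.** Let $U_\hbar A$ be a quantum groupoid. For $f\in C^\infty(P)$ and $X\in\Gamma(A)$ the limits $$\delta f=\lim_{\hbar\to0}\tfrac1\hbar(\alpha_\hbar f-\beta_\hbar f)\in UA,\qquad \Delta^1X=\lim_{\hbar\to0}\tfrac1\hbar\bigl(\Delta_\hbar X-(1\otimes X+X\otimes1)\bigr)\in UA\otimes_RUA$$ are well defined. With $\delta X=\Delta^1X-\Delta^1_{op}X$, where $op$ exchanges the two factors, one has $\delta f\in\Gamma(A)\subset UA$ and $\delta X\in\Gamma(\wedge^2A)\subset UA\otimes_RUA$ (via $Y\wedge Z=Y\otimes Z-Z\otimes Y$), and $\delta$ extends uniquely to a derivation $\delta:\Gamma(\wedge^\bullet A)\to\Gamma(\wedge^{\bullet+1}A)$ of degree one, with $\delta^2=0$. There is a unique Lie algebroid structure on $A^*$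 whose differential $d_*$ is $\delta$, and with it $(A,A^*)$ is a Lie bialgebroid. The Poisson structure on $P$ induced by this Lie bialgebroid coincides with the one given by the $*$-algebra $R_\hbar$, $$\{f,g\}=\lim_{\hbar\to0}\tfrac1\hbar(f*_\hbar g-g*_\hbar f).$$ -/

import Mathlib

open scoped TensorProduct PowerSeries Manifold ContDiff
open Bundle

noncomputable section

namespace QuantumGroupoids

/-! ## Lie algebras over a commutative algebra, and their universal enveloping algebras

The algebraic structure carried by the sections of a Lie algebroid: `R` is the algebra of smooth
functions, `L` is the `R`-module of smooth sections. -/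

/-- A real Lie bracket on the `R`-module `L` together with an anchor acting by derivations of `R`
(a Lie-Rinehart structure). -/
@[ext]
structure LieRinehart (R L : Type*) [CommRing R] [Algebra ℝ R] [AddCommGroup L] [Module R L] where
  bracket : L → L → L
  anchor : L →ₗ[R] Derivation ℝ R R
  add_bracket : ∀ X Y Z, bracket (X + Y) Z = bracket X Z + bracket Y Z
  bracket_add : ∀ X Y Z, bracket X (Y + Z) = bracket X Y + bracket X Z
  bracket_self : ∀ X, bracket X X = 0
  jacobi : ∀ X Y Z, bracket X (bracket Y Z) = bracket (bracket X Y) Z + bracket Y (bracket X Z)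
  leibniz : ∀ X (f : R) Y, bracket X (f • Y) = f • bracket X Y + anchor X f • Y
  anchor_bracket : ∀ X Y f,
    anchor (bracket X Y) f = anchor X (anchor Y f) - anchor Y (anchor X f)

section Envelope

variable {R L : Type*} [CommRing R] [Algebra ℝ R] [AddCommGroup L] [Module R L]

/-- The defining relations of the universal enveloping algebra on generators `f ∈ R`
(`Sum.inl f`) and `X ∈ L` (`Sum.inr X`). -/
inductive EnvelopeRel (A : LieRinehart R L) :
    FreeAlgebra ℝ (R ⊕ L) → FreeAlgebra ℝ (R ⊕ L) → Prop
  | fun_add (f g : R) : EnvelopeRel A (FreeAlgebra.ι ℝ (Sum.inl (f + g)))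
      (FreeAlgebra.ι ℝ (Sum.inl f) + FreeAlgebra.ι ℝ (Sum.inl g))
  | fun_mul (f g : R) : EnvelopeRel A (FreeAlgebra.ι ℝ (Sum.inl (f * g)))
      (FreeAlgebra.ι ℝ (Sum.inl f) * FreeAlgebra.ι ℝ (Sum.inl g))
  | fun_const (c : ℝ) : EnvelopeRel A (FreeAlgebra.ι ℝ (Sum.inl (algebraMap ℝ R c)))
      (algebraMap ℝ (FreeAlgebra ℝ (R ⊕ L)) c)
  | sec_add (X Y : L) : EnvelopeRel A (FreeAlgebra.ι ℝ (Sum.inr (X + Y)))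
      (FreeAlgebra.ι ℝ (Sum.inr X) + FreeAlgebra.ι ℝ (Sum.inr Y))
  | sec_smul (f : R) (X : L) : EnvelopeRel A (FreeAlgebra.ι ℝ (Sum.inr (f • X)))
      (FreeAlgebra.ι ℝ (Sum.inl f) * FreeAlgebra.ι ℝ (Sum.inr X))
  | sec_fun (X : L) (f : R) :
      EnvelopeRel A (FreeAlgebra.ι ℝ (Sum.inr X) * FreeAlgebra.ι ℝ (Sum.inl f))
      (FreeAlgebra.ι ℝ (Sum.inl f) * FreeAlgebra.ι ℝ (Sum.inr X)
        + FreeAlgebra.ι ℝ (Sum.inl (A.anchor X f)))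
  | sec_sec (X Y : L) :
      EnvelopeRel A (FreeAlgebra.ι ℝ (Sum.inr X) * FreeAlgebra.ι ℝ (Sum.inr Y))
      (FreeAlgebra.ι ℝ (Sum.inr Y) * FreeAlgebra.ι ℝ (Sum.inr X)
        + FreeAlgebra.ι ℝ (Sum.inr (A.bracket X Y)))

/-- The universal enveloping algebra `UA`: the unital real algebra generated by `R` (as a
subalgebra) and `L` with `f · X = fX`, `X · f - f · X = ρ(X) f` and `X · Y - Y · X = [X, Y]`. -/
def Envelope (A : LieRinehart R L) : Type _ := RingQuot (EnvelopeRel A)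

namespace Envelope

variable (A : LieRinehart R L)

instance : Ring (Envelope A) := inferInstanceAs (Ring (RingQuot (EnvelopeRel A)))

instance : Algebra ℝ (Envelope A) := inferInstanceAs (Algebra ℝ (RingQuot (EnvelopeRel A)))

/-- The quotient map from the free algebra. -/
def mk : FreeAlgebra ℝ (R ⊕ L) →ₐ[ℝ] Envelope A := RingQuot.mkAlgHom ℝ (EnvelopeRel A)

variable {A} in
lemma mk_rel {x y : FreeAlgebra ℝ (R ⊕ L)} (h : EnvelopeRel A x y) : mk A x = mk A y :=
  RingQuot.mkAlgHom_rel ℝ h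

/-- The inclusion `R → UA`; it is both the source map and the target map of `UA`. -/
def ofFun : R →ₐ[ℝ] Envelope A where
  toFun f := mk A (FreeAlgebra.ι ℝ (Sum.inl f))
  map_one' := by
    have := mk_rel (EnvelopeRel.fun_const (A := A) 1)
    simpa using this
  map_mul' f g := by rw [mk_rel (EnvelopeRel.fun_mul f g), map_mul]
  map_zero' := by
    have := mk_rel (EnvelopeRel.fun_const (A := A) 0)
    simpa using this
  map_add' f g := by rw [mk_rel (EnvelopeRel.fun_add f g), map_add]
  commutes' c := by rw [mk_rel (EnvelopeRel.fun_const c), AlgHom.commutes]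

/-- `UA` as a left `R`-module, through the inclusion `R → UA`. -/
instance : Module R (Envelope A) := Module.compHom (Envelope A) (ofFun A).toRingHom

instance : IsScalarTower ℝ R (Envelope A) where
  smul_assoc c f u := by
    change ofFun A (c • f) * u = c • (ofFun A f * u)
    rw [map_smul, smul_mul_assoc]

instance : SMulCommClass R ℝ (Envelope A) where
  smul_comm f c u := mul_smul_comm c (ofFun A f) u

lemma fun_smul_def (f : R) (u : Envelope A) : f • u = ofFun A f * u := rfl

/-- The canonical map `L → UA`. -/
def ofSec : L →ₗ[R] Envelope A where
  toFun X := mk A (FreeAlgebra.ι ℝ (Sum.inr X))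
  map_add' X Y := by rw [mk_rel (EnvelopeRel.sec_add X Y), map_add]
  map_smul' f X := by
    rw [mk_rel (EnvelopeRel.sec_smul f X), map_mul]; rfl

lemma ofSec_mul_ofFun (X : L) (f : R) :
    ofSec A X * ofFun A f = ofFun A f * ofSec A X + ofFun A (A.anchor X f) := by
  have := mk_rel (EnvelopeRel.sec_fun (A := A) X f)
  rw [map_mul, map_add, map_mul] at this
  exact this

lemma ofSec_mul_ofSec (X Y : L) :
    ofSec A X * ofSec A Y = ofSec A Y * ofSec A X + ofSec A (A.bracket X Y) := by
  have := mk_rel (EnvelopeRel.sec_sec (A := A) X Y)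
  rw [map_mul, map_add, map_mul] at this
  exact this

/-- The universal property: an algebra map out of `UA` is given on functions and sections. -/
def lift {B : Type*} [Semiring B] [Algebra ℝ B] (p : R →ₐ[ℝ] B) (q : L →+ B)
    (smul : ∀ f X, q (f • X) = p f * q X)
    (secFun : ∀ X f, q X * p f = p f * q X + p (A.anchor X f))
    (secSec : ∀ X Y, q X * q Y = q Y * q X + q (A.bracket X Y)) : Envelope A →ₐ[ℝ] B :=
  RingQuot.liftAlgHom ℝ ⟨FreeAlgebra.lift ℝ (Sum.elim p q), by
    intro x y h
    induction h with
    | fun_add f g => simp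
    | fun_mul f g => simp
    | fun_const c => simp only [FreeAlgebra.lift_ι_apply, Sum.elim_inl, AlgHom.commutes]
    | sec_add X Y => simp
    | sec_smul f X => simp [smul]
    | sec_fun X f => simpa using secFun X f
    | sec_sec X Y => simpa using secSec X Y⟩

/-- Multiplication by the section `X` extended to `UA ⊗_R UA` by
`X · (u ⊗ v) = X u ⊗ v + u ⊗ X v`. -/
def secAct (X : L) : Envelope A ⊗[R] Envelope A →+ Envelope A ⊗[R] Envelope A :=
  TensorProduct.liftAddHom
    (AddMonoidHom.mk' (fun u => AddMonoidHom.mk'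
        (fun v => (ofSec A X * u) ⊗ₜ[R] v + u ⊗ₜ[R] (ofSec A X * v))
        (fun v w => by simp only [mul_add, TensorProduct.tmul_add]; abel))
      (fun u w => by
        ext v; simp only [mul_add, TensorProduct.add_tmul, AddMonoidHom.mk'_apply,
          AddMonoidHom.add_apply]; abel))
    (fun f u v => by
      have h (w : Envelope A) : ofSec A X * f • w = f • (ofSec A X * w) + A.anchor X f • w := by
        simp only [fun_smul_def, ← mul_assoc, ofSec_mul_ofFun, add_mul]
      simp only [AddMonoidHom.mk'_apply, h, TensorProduct.add_tmul, TensorProduct.tmul_add,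
        TensorProduct.smul_tmul]
      abel)

@[simp] lemma secAct_tmul (X : L) (u v : Envelope A) :
    secAct A X (u ⊗ₜ v) = (ofSec A X * u) ⊗ₜ[R] v + u ⊗ₜ[R] (ofSec A X * v) := rfl

/-- `secAct` as a map from `L` to real-linear endomorphisms. -/
def secEnd : L →+ Module.End ℝ (Envelope A ⊗[R] Envelope A) where
  toFun X :=
    { toFun := secAct A X
      map_add' := map_add _
      map_smul' := fun c t => by
        induction t using TensorProduct.induction_on with
        | zero => simp
        | tmul u v => simp [TensorProduct.smul_tmul']
        | add s t hs ht => simp_all }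
  map_zero' := by
    ext t
    induction t using TensorProduct.induction_on with
    | zero => simp
    | tmul u v => simp
    | add s t hs ht => rw [map_add, hs, ht, map_add]
  map_add' X Y := by
    ext t
    induction t using TensorProduct.induction_on with
    | zero => simp
    | tmul u v =>
      simp [add_mul, TensorProduct.add_tmul, TensorProduct.tmul_add]; abel
    | add s t hs ht => rw [map_add, hs, ht, map_add]

@[simp] lemma secEnd_tmul (X : L) (u v : Envelope A) :
    secEnd A X (u ⊗ₜ v) = (ofSec A X * u) ⊗ₜ[R] v + u ⊗ₜ[R] (ofSec A X * v) := rfl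

/-- The left `UA`-module structure of `UA ⊗_R UA`:
`f · (u ⊗ v) = f u ⊗ v` and `X · (u ⊗ v) = X u ⊗ v + u ⊗ X v`. -/
def tensorAct : Envelope A →ₐ[ℝ] Module.End ℝ (Envelope A ⊗[R] Envelope A) :=
  lift A (Algebra.lsmul ℝ ℝ (Envelope A ⊗[R] Envelope A)) (secEnd A)
    (fun f X => by
      ext t
      induction t using TensorProduct.induction_on with
      | zero => simp
      | tmul u v =>
        simp only [secEnd_tmul, Module.End.mul_apply, Algebra.lsmul_coe, map_smul, smul_add,
          TensorProduct.smul_tmul', mul_assoc, fun_smul_def]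
        rw [← fun_smul_def A f (ofSec A X * v), ← fun_smul_def A f u,
          TensorProduct.smul_tmul]
      | add s t hs ht => simp only [map_add, hs, ht])
    (fun X f => by
      ext t
      induction t using TensorProduct.induction_on with
      | zero => simp
      | tmul u v =>
        simp only [secEnd_tmul, Module.End.mul_apply, LinearMap.add_apply, Algebra.lsmul_coe,
          smul_add, TensorProduct.smul_tmul', fun_smul_def, ← mul_assoc, ofSec_mul_ofFun,
          add_mul, TensorProduct.add_tmul]
        abel
      | add s t hs ht => simp only [map_add, hs, ht])
    (fun X Y => by
      ext t
      induction t using TensorProduct.induction_on with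
      | zero => simp
      | tmul u v =>
        simp only [secEnd_tmul, Module.End.mul_apply, LinearMap.add_apply, map_add,
          ← mul_assoc, ofSec_mul_ofSec A X Y, add_mul, TensorProduct.add_tmul,
          TensorProduct.tmul_add]
        abel
      | add s t hs ht => simp only [map_add, hs, ht])

/-- The coproduct `UA → UA ⊗_R UA`: the multiplicative extension of `f ↦ f ⊗ 1` and
`X ↦ X ⊗ 1 + 1 ⊗ X`. -/
def comul (u : Envelope A) : Envelope A ⊗[R] Envelope A := tensorAct A u (1 ⊗ₜ 1)

/-- The action of `UA` on `R`, functions acting by multiplication and sections by the anchor. -/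
def funAct : Envelope A →ₐ[ℝ] Module.End ℝ R :=
  lift A (Algebra.lmul ℝ R)
    { toFun := fun X => ((A.anchor X : Derivation ℝ R R) : R →ₗ[ℝ] R)
      map_zero' := by ext f; simp
      map_add' := fun X Y => by ext f; simp }
    (fun f X => by ext g; simp)
    (fun X f => by ext g; simp; ring)
    (fun X Y => by ext g; simp [A.anchor_bracket])

/-- The counit `UA → R`, the projection onto functions. -/
def counit (u : Envelope A) : R := funAct A u 1

@[simp] lemma lift_ofFun {B : Type*} [Semiring B] [Algebra ℝ B] (p : R →ₐ[ℝ] B) (q : L →+ B)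
    (h₁ h₂ h₃) (f : R) : lift A p q h₁ h₂ h₃ (ofFun A f) = p f := by
  refine (RingQuot.liftAlgHom_mkAlgHom_apply ℝ _ _ _).trans ?_
  simp

@[simp] lemma lift_ofSec {B : Type*} [Semiring B] [Algebra ℝ B] (p : R →ₐ[ℝ] B) (q : L →+ B)
    (h₁ h₂ h₃) (X : L) : lift A p q h₁ h₂ h₃ (ofSec A X) = q X := by
  refine (RingQuot.liftAlgHom_mkAlgHom_apply ℝ _ _ _).trans ?_
  simp

lemma comul_ofFun (f : R) : comul A (ofFun A f) = ofFun A f ⊗ₜ[R] 1 := by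
  simp [comul, tensorAct, TensorProduct.smul_tmul', fun_smul_def]

lemma comul_ofSec (X : L) :
    comul A (ofSec A X) = ofSec A X ⊗ₜ[R] 1 + 1 ⊗ₜ[R] ofSec A X := by
  simp [comul, tensorAct]

end Envelope

end Envelope

/-! ## Topological Hopf algebroids

Everything is over a commutative ring `K` with an ideal `I`; all tensor products over the base
algebra are completed in the `I`-adic topology. -/

section Topological

/-- The extension of a linear map `M → N^` to the completion `M^ → N^`. -/
def completionExtend {K M N : Type*} [CommRing K] (I : Ideal K) [AddCommGroup M] [Module K M]
    [AddCommGroup N] [Module K N] (f : M →ₗ[K] AdicCompletion I N) :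
    AdicCompletion I M →ₗ[K] AdicCompletion I N :=
  AdicCompletion.lift I
    (fun n => (Submodule.liftQ (I ^ n • ⊤ : Submodule K M) (AdicCompletion.eval I N n ∘ₗ f)
      (by
        rw [Submodule.smul_le]
        intro r hr m _
        rw [LinearMap.mem_ker, map_smul]
        obtain ⟨y, hy⟩ := Submodule.Quotient.mk_surjective _
          ((AdicCompletion.eval I N n ∘ₗ f) m)
        rw [← hy, ← Submodule.Quotient.mk_smul, Submodule.Quotient.mk_eq_zero]
        exact Submodule.smul_mem_smul hr trivial)) ∘ₗ AdicCompletion.eval I M n)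
    (by
      intro m n hmn
      refine LinearMap.ext fun x => ?_
      obtain ⟨y, hy⟩ := Submodule.Quotient.mk_surjective _ (AdicCompletion.eval I M n x)
      have hy' : AdicCompletion.eval I M m x = Submodule.Quotient.mk y := by
        rw [AdicCompletion.eval_apply, ← AdicCompletion.transitionMap_comp_eval_apply I M hmn,
          ← AdicCompletion.eval_apply, ← hy]; rfl
      simp only [LinearMap.comp_apply, hy', ← hy, Submodule.liftQ_apply]
      exact AdicCompletion.transitionMap_comp_eval_apply I N hmn _)

lemma completionExtend_of {K M N : Type*} [CommRing K] (I : Ideal K) [AddCommGroup M]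
    [Module K M] [AddCommGroup N] [Module K N] (f : M →ₗ[K] AdicCompletion I N) (x : M) :
    completionExtend I f (AdicCompletion.of I M x) = f x := by
  apply AdicCompletion.ext
  intro n
  rfl

lemma completion_map_val {K M N : Type*} [CommRing K] (I : Ideal K) [AddCommGroup M] [Module K M]
    [AddCommGroup N] [Module K N] (f : M →ₗ[K] N) (x : AdicCompletion I M) (n : ℕ) (y : M)
    (hy : x.val n = Submodule.Quotient.mk y) :
    (AdicCompletion.map I f x).val n = Submodule.Quotient.mk (f y) := by
  rw [AdicCompletion.map_val_apply, hy]; rfl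

lemma completion_map_congr {K M N : Type*} [CommRing K] (I : Ideal K) [AddCommGroup M]
    [Module K M] [AddCommGroup N] [Module K N] {f g : M →ₗ[K] N} (h : f = g)
    (x : AdicCompletion I M) : AdicCompletion.map I f x = AdicCompletion.map I g x := by rw [h]

lemma completion_map_add {K M N : Type*} [CommRing K] (I : Ideal K) [AddCommGroup M]
    [Module K M] [AddCommGroup N] [Module K N] (f g : M →ₗ[K] N) (x : AdicCompletion I M) :
    AdicCompletion.map I (f + g) x = AdicCompletion.map I f x + AdicCompletion.map I g x := by
  refine AdicCompletion.ext fun n => ?_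
  obtain ⟨y, hy⟩ := Submodule.Quotient.mk_surjective _ (x.val n)
  rw [AdicCompletion.val_add_apply, completion_map_val I _ x n y hy.symm,
    completion_map_val I _ x n y hy.symm, completion_map_val I _ x n y hy.symm]
  rfl

lemma completion_map_smul {K M N : Type*} [CommRing K] (I : Ideal K) [AddCommGroup M]
    [Module K M] [AddCommGroup N] [Module K N] (c : K) (f : M →ₗ[K] N)
    (x : AdicCompletion I M) :
    AdicCompletion.map I (c • f) x = c • AdicCompletion.map I f x := by
  refine AdicCompletion.ext fun n => ?_
  obtain ⟨y, hy⟩ := Submodule.Quotient.mk_surjective _ (x.val n)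
  rw [AdicCompletion.val_smul_apply, completion_map_val I _ x n y hy.symm,
    completion_map_val I _ x n y hy.symm]
  rfl

lemma completion_map_comp {K M N P : Type*} [CommRing K] (I : Ideal K) [AddCommGroup M]
    [Module K M] [AddCommGroup N] [Module K N] [AddCommGroup P] [Module K P] (g : N →ₗ[K] P)
    (f : M →ₗ[K] N) (x : AdicCompletion I M) :
    AdicCompletion.map I g (AdicCompletion.map I f x) = AdicCompletion.map I (g ∘ₗ f) x :=
  AdicCompletion.map_comp_apply I f g x

/-- Source and target maps of a total algebra `H` over a base algebra `R`: an algebra map `α`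
and an algebra anti-homomorphism `β` with commuting images. -/
structure SourceTarget (K R H : Type*) [CommRing K] [Ring R] [Algebra K R] [Ring H]
    [Algebra K H] where
  source : R →ₐ[K] H
  target : R →ₐ[K] Hᵐᵒᵖ
  commute : ∀ a b, source a * (target b).unop = (target b).unop * source a

namespace SourceTarget

variable {K R H : Type*} [CommRing K] [Ring R] [Algebra K R] [Ring H] [Algebra K H]
  (S : SourceTarget K R H)

/-- The source map, `a · h = α(a) h`. -/
def α (a : R) : H := S.source a

/-- The target map, `h · a = β(a) h`. -/
def β (a : R) : H := (S.target a).unop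

lemma α_comm_β (a b : R) : S.α a * S.β b = S.β b * S.α a := S.commute a b

/-- The relations `h · a ⊗ h' = h ⊗ a · h'` that define `H ⊗_R H` as a quotient of `H ⊗_K H`. -/
def rel₂ : Submodule K (H ⊗[K] H) :=
  Submodule.span K {t | ∃ (a : R) (h h' : H), t = (S.β a * h) ⊗ₜ h' - h ⊗ₜ (S.α a * h')}

/-- The relations that define `H ⊗_R H ⊗_R H` as a quotient of `H ⊗_K (H ⊗_K H)`. -/
def rel₃ : Submodule K (H ⊗[K] (H ⊗[K] H)) :=
  Submodule.span K
    ({t | ∃ (a : R) (h h' h'' : H),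
        t = (S.β a * h) ⊗ₜ (h' ⊗ₜ h'') - h ⊗ₜ ((S.α a * h') ⊗ₜ h'')} ∪
      {t | ∃ (a : R) (h h' h'' : H),
        t = h ⊗ₜ ((S.β a * h') ⊗ₜ h'') - h ⊗ₜ (h' ⊗ₜ (S.α a * h''))})

variable (I : Ideal K)

/-- The completed tensor product `H ⊗_R H`. -/
abbrev Tensor₂ : Type _ := AdicCompletion I ((H ⊗[K] H) ⧸ S.rel₂)

/-- The completed tensor product `H ⊗_R H ⊗_R H`. -/
abbrev Tensor₃ : Type _ := AdicCompletion I ((H ⊗[K] (H ⊗[K] H)) ⧸ S.rel₃)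

/-- The class in `H ⊗_R H` of an element of `H ⊗_K H`. -/
def mk₂ : H ⊗[K] H →ₗ[K] S.Tensor₂ I := AdicCompletion.of I _ ∘ₗ S.rel₂.mkQ

/-- The class in `H ⊗_R H ⊗_R H` of an element of `H ⊗_K H ⊗_K H`. -/
def mk₃ : H ⊗[K] (H ⊗[K] H) →ₗ[K] S.Tensor₃ I := AdicCompletion.of I _ ∘ₗ S.rel₃.mkQ

lemma rel₂_le {N : Type*} [AddCommGroup N] [Module K N] (f : H ⊗[K] H →ₗ[K] N)
    (q : Submodule K N)
    (hf : ∀ a h h', f ((S.β a * h) ⊗ₜ h') - f (h ⊗ₜ (S.α a * h')) ∈ q) :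
    S.rel₂ ≤ q.comap f := by
  rw [rel₂, Submodule.span_le]
  rintro _ ⟨a, h, h', rfl⟩
  simpa using hf a h h'

/-- The left action `a · (h ⊗ h') = α(a) h ⊗ h'` on `H ⊗_R H`. -/
def leftAct (a : R) : S.Tensor₂ I →ₗ[K] S.Tensor₂ I :=
  AdicCompletion.map I (Submodule.mapQ S.rel₂ S.rel₂
    (TensorProduct.map (LinearMap.mulLeft K (S.α a)) LinearMap.id)
    (S.rel₂_le _ _ fun b h h' => Submodule.subset_span ⟨b, S.α a * h, h', by
      simp only [TensorProduct.map_tmul, LinearMap.mulLeft_apply, LinearMap.id_apply,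
        ← mul_assoc, S.α_comm_β]⟩))

/-- The right action `(h ⊗ h') · a = h ⊗ β(a) h'` on `H ⊗_R H`. -/
def rightAct (a : R) : S.Tensor₂ I →ₗ[K] S.Tensor₂ I :=
  AdicCompletion.map I (Submodule.mapQ S.rel₂ S.rel₂
    (TensorProduct.map LinearMap.id (LinearMap.mulLeft K (S.β a)))
    (S.rel₂_le _ _ fun b h h' => Submodule.subset_span ⟨b, h, S.β a * h', by
      simp only [TensorProduct.map_tmul, LinearMap.mulLeft_apply, LinearMap.id_apply,
        ← mul_assoc, S.α_comm_β]⟩))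

/-- Right multiplication of `H ⊗_R H` by an element of `H ⊗_K H`. -/
def rightMul : H ⊗[K] H →ₗ[K] S.Tensor₂ I →ₗ[K] S.Tensor₂ I where
  toFun x := AdicCompletion.map I (Submodule.mapQ S.rel₂ S.rel₂ (LinearMap.mulRight K x) (by
    refine S.rel₂_le _ _ fun b h h' => ?_
    induction x using TensorProduct.induction_on with
    | zero => simp
    | tmul u v =>
      exact Submodule.subset_span ⟨b, h * u, h' * v, by simp [mul_assoc]⟩
    | add x y hx hy =>
      simp only [LinearMap.mulRight_apply, mul_add] at hx hy ⊢
      convert Submodule.add_mem _ hx hy using 1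
      abel))
  map_add' x y := LinearMap.ext fun t => by
    refine (completion_map_congr I ?_ t).trans (completion_map_add I _ _ t)
    refine Submodule.linearMap_qext _ (LinearMap.ext fun u => ?_)
    simp [mul_add]
  map_smul' c x := LinearMap.ext fun t => by
    refine (completion_map_congr I ?_ t).trans (completion_map_smul I c _ t)
    refine Submodule.linearMap_qext _ (LinearMap.ext fun u => ?_)
    simp

/-- The map `(h ⊗ h') ↦ h ⊗ h' ⊗ k` from `H ⊗_R H` to `H ⊗_R H ⊗_R H`. -/
def tensorRight : H →ₗ[K] S.Tensor₂ I →ₗ[K] S.Tensor₃ I where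
  toFun k := AdicCompletion.map I (Submodule.mapQ S.rel₂ S.rel₃
    ((TensorProduct.assoc K H H H).toLinearMap ∘ₗ (TensorProduct.mk K (H ⊗[K] H) H).flip k)
    (S.rel₂_le _ _ fun b h h' => Submodule.subset_span (Or.inl ⟨b, h, h', k, by simp⟩)))
  map_add' x y := LinearMap.ext fun t => by
    refine (completion_map_congr I ?_ t).trans (completion_map_add I _ _ t)
    refine Submodule.linearMap_qext _ (LinearMap.ext fun u => ?_)
    simp
  map_smul' c x := LinearMap.ext fun t => by
    refine (completion_map_congr I ?_ t).trans (completion_map_smul I c _ t)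
    refine Submodule.linearMap_qext _ (LinearMap.ext fun u => ?_)
    simp

/-- The map `(h ⊗ h') ↦ k ⊗ h ⊗ h'` from `H ⊗_R H` to `H ⊗_R H ⊗_R H`. -/
def tensorLeft : H →ₗ[K] S.Tensor₂ I →ₗ[K] S.Tensor₃ I where
  toFun k := AdicCompletion.map I (Submodule.mapQ S.rel₂ S.rel₃
    (TensorProduct.mk K H (H ⊗[K] H) k)
    (S.rel₂_le _ _ fun b h h' => Submodule.subset_span (Or.inr ⟨b, k, h, h', by simp⟩)))
  map_add' x y := LinearMap.ext fun t => by
    refine (completion_map_congr I ?_ t).trans (completion_map_add I _ _ t)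
    refine Submodule.linearMap_qext _ (LinearMap.ext fun u => ?_)
    simp
  map_smul' c x := LinearMap.ext fun t => by
    refine (completion_map_congr I ?_ t).trans (completion_map_smul I c _ t)
    refine Submodule.linearMap_qext _ (LinearMap.ext fun u => ?_)
    simp

lemma tensorRight_rightAct (a : R) (k : H) (t : S.Tensor₂ I) :
    S.tensorRight I k (S.rightAct I a t) = S.tensorRight I (S.α a * k) t := by
  refine (completion_map_comp I _ _ t).trans (completion_map_congr I ?_ t)
  refine Submodule.linearMap_qext _ (TensorProduct.ext' fun u v => ?_)
  refine (Submodule.Quotient.eq _).2 ?_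
  exact Submodule.subset_span (Or.inr ⟨a, u, v, k, by simp⟩)

lemma tensorLeft_leftAct (a : R) (k : H) (t : S.Tensor₂ I) :
    S.tensorLeft I k (S.leftAct I a t) = S.tensorLeft I (S.β a * k) t := by
  refine (completion_map_comp I _ _ t).trans (completion_map_congr I ?_ t)
  refine Submodule.linearMap_qext _ (TensorProduct.ext' fun u v => ?_)
  refine (Submodule.Quotient.eq _).2 (Submodule.neg_mem_iff _ |>.1 ?_)
  exact Submodule.subset_span (Or.inl ⟨a, k, u, v, by simp⟩)

lemma rightMul_rightMul (x y : H ⊗[K] H) (t : S.Tensor₂ I) :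
    S.rightMul I y (S.rightMul I x t) = S.rightMul I (x * y) t := by
  refine (completion_map_comp I _ _ t).trans (completion_map_congr I ?_ t)
  refine Submodule.linearMap_qext _ (LinearMap.ext fun u => ?_)
  simp [mul_assoc]

end SourceTarget

/-- A coproduct: a bimodule map `Δ : H → H ⊗_R H` with `Δ(1) = 1 ⊗ 1` such that
`Δ(h) (β(a) ⊗ 1 - 1 ⊗ α(a)) = 0`. -/
structure Coproduct {K R H : Type*} [CommRing K] [Ring R] [Algebra K R] [Ring H] [Algebra K H]
    (S : SourceTarget K R H) (I : Ideal K) where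
  Δ : H →ₗ[K] S.Tensor₂ I
  Δ_left : ∀ a h, Δ (S.α a * h) = S.leftAct I a (Δ h)
  Δ_right : ∀ a h, Δ (S.β a * h) = S.rightAct I a (Δ h)
  Δ_one : Δ 1 = S.mk₂ I (1 ⊗ₜ 1)
  Δ_mul_eq_zero : ∀ h a, S.rightMul I (S.β a ⊗ₜ 1 - 1 ⊗ₜ S.α a) (Δ h) = 0

namespace Coproduct

variable {K R H : Type*} [CommRing K] [Ring R] [Algebra K R] [Ring H] [Algebra K H]
  {S : SourceTarget K R H} {I : Ideal K} (C : Coproduct S I)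

/-- The action of `h ∈ H` on `H ⊗_R H`, `h · (m ⊗ m') = Δ(h) (m ⊗ m')`. -/
def act (h : H) : S.Tensor₂ I →ₗ[K] S.Tensor₂ I :=
  completionExtend I (Submodule.liftQ S.rel₂ ((S.rightMul I).flip (C.Δ h)) (by
    refine S.rel₂_le _ ⊥ fun a m m' => ?_
    rw [Submodule.mem_bot, ← map_sub, LinearMap.flip_apply]
    have := S.rightMul_rightMul I (S.β a ⊗ₜ 1 - 1 ⊗ₜ S.α a) (m ⊗ₜ m') (C.Δ h)
    rw [C.Δ_mul_eq_zero, map_zero] at this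
    simpa [sub_mul] using this.symm))

/-- The map `Δ ⊗ id : H ⊗_R H → H ⊗_R H ⊗_R H`. -/
def comulLeft : S.Tensor₂ I →ₗ[K] S.Tensor₃ I :=
  completionExtend I (Submodule.liftQ S.rel₂
    (TensorProduct.lift ((S.tensorRight I).flip ∘ₗ C.Δ)) (by
    refine S.rel₂_le _ ⊥ fun a h h' => ?_
    simp [C.Δ_right, S.tensorRight_rightAct]))

/-- The map `id ⊗ Δ : H ⊗_R H → H ⊗_R H ⊗_R H`. -/
def comulRight : S.Tensor₂ I →ₗ[K] S.Tensor₃ I :=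
  completionExtend I (Submodule.liftQ S.rel₂
    (TensorProduct.lift ((S.tensorLeft I).compl₂ C.Δ)) (by
    refine S.rel₂_le _ ⊥ fun a h h' => ?_
    simp [C.Δ_left, S.tensorLeft_leftAct]))

end Coproduct

/-- A counit: a bimodule map `ε : H → R` with `ε(1) = 1`. -/
structure Counit {K R H : Type*} [CommRing K] [Ring R] [Algebra K R] [Ring H] [Algebra K H]
    (S : SourceTarget K R H) where
  ε : H →ₗ[K] R
  ε_left : ∀ a h, ε (S.α a * h) = a * ε h
  ε_right : ∀ a h, ε (S.β a * h) = ε h * a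
  ε_one : ε 1 = 1

namespace Counit

variable {K R H : Type*} [CommRing K] [Ring R] [Algebra K R] [Ring H] [Algebra K H]
  {S : SourceTarget K R H} (E : Counit S) (I : Ideal K)

/-- The map `ε ⊗ id : H ⊗_R H → R ⊗_R H = H`, `h ⊗ h' ↦ α(ε(h)) h'`, into the completion of
`H`. -/
def counitLeft : S.Tensor₂ I →ₗ[K] AdicCompletion I H :=
  AdicCompletion.map I (Submodule.liftQ S.rel₂
    (TensorProduct.lift (LinearMap.mul K H ∘ₗ S.source.toLinearMap ∘ₗ E.ε)) (by
    refine S.rel₂_le _ ⊥ fun a h h' => ?_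
    simp [E.ε_right, SourceTarget.α, mul_assoc]))

/-- The map `id ⊗ ε : H ⊗_R H → H ⊗_R R = H`, `h ⊗ h' ↦ β(ε(h')) h`, into the completion of
`H`. -/
def counitRight : S.Tensor₂ I →ₗ[K] AdicCompletion I H :=
  AdicCompletion.map I (Submodule.liftQ S.rel₂
    (TensorProduct.lift ((LinearMap.mul K H).flip.compl₂
      ((MulOpposite.opLinearEquiv K).symm.toLinearMap ∘ₗ S.target.toLinearMap ∘ₗ E.ε))) (by
    refine S.rel₂_le _ ⊥ fun a h h' => ?_
    simp [E.ε_left, SourceTarget.β, mul_assoc]))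

end Counit

/-- A (topological) Hopf algebroid `(H, R, α, β, m, Δ, ε)`, without antipode. -/
structure HopfAlgebroid (K R H : Type*) [CommRing K] [Ring R] [Algebra K R] [Ring H]
    [Algebra K H] (I : Ideal K) where
  maps : SourceTarget K R H
  comul : Coproduct maps I
  counit : Counit maps
  coassoc : ∀ h, comul.comulLeft (comul.Δ h) = comul.comulRight (comul.Δ h)
  comul_mul : ∀ h₁ h₂, comul.Δ (h₁ * h₂) = comul.act h₁ (comul.Δ h₂)
  counit_comul : ∀ h, counit.counitLeft I (comul.Δ h) = AdicCompletion.of I H h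
  comul_counit : ∀ h, counit.counitRight I (comul.Δ h) = AdicCompletion.of I H h

end Topological


/-! ## Multivector fields, Lie bialgebroids and Poisson brackets -/

section Multivectors

variable {R L M : Type*} [CommRing R] [Algebra ℝ R] [AddCommGroup L] [Module R L]
  [AddCommGroup M] [Module R M]

/-- A real-linear derivation of degree one of the exterior algebra `Λ L = Γ(∧ A)`. -/
@[ext]
structure DegreeOneDerivation (R L : Type*) [CommRing R] [Algebra ℝ R] [AddCommGroup L]
    [Module R L] where
  d : ExteriorAlgebra R L →+ ExteriorAlgebra R L
  smul : ∀ (c : ℝ) (a : ExteriorAlgebra R L),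
    d (algebraMap ℝ R c • a) = algebraMap ℝ R c • d a
  degree : ∀ k, ∀ a ∈ ⋀[R]^k L, d a ∈ ⋀[R]^(k + 1) L
  derivation : ∀ k, ∀ a ∈ ⋀[R]^k L, ∀ b, d (a * b) = d a * b + (-1) ^ k * (a * d b)

namespace DegreeOneDerivation

variable (D : DegreeOneDerivation R L)

/-- The restriction `R → L` to degree zero. -/
def onFun (f : R) : L :=
  exteriorPower.oneEquiv R L ⟨D.d (algebraMap R _ f), D.degree 0 _ (by
    rw [ExteriorAlgebra.exteriorPower, pow_zero]; exact Submodule.algebraMap_mem f)⟩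

/-- The restriction `L → ∧² L` to degree one. -/
def onSec (X : L) : ⋀[R]^2 L :=
  ⟨D.d (ExteriorAlgebra.ι R X), D.degree 1 _ (by
    rw [ExteriorAlgebra.exteriorPower, pow_one]; exact LinearMap.mem_range_self _ X)⟩

end DegreeOneDerivation

/-- The embedding `∧² L → L ⊗_R L`, `X ∧ Y ↦ X ⊗ Y - Y ⊗ X`. -/
def wedgeToTensor : ⋀[R]^2 L →ₗ[R] L ⊗[R] L :=
  exteriorPower.alternatingMapLinearEquiv
    { toFun := fun v => v 0 ⊗ₜ[R] v 1 - v 1 ⊗ₜ[R] v 0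
      map_update_add' := by
        intro _ v i x y
        fin_cases i <;> simp [TensorProduct.tmul_add, TensorProduct.add_tmul] <;> abel
      map_update_smul' := by
        intro _ v i c x
        fin_cases i <;> simp [smul_sub, TensorProduct.smul_tmul']
      map_eq_zero_of_eq' := by
        intro v i j h hij
        fin_cases i <;> fin_cases j <;> simp_all }

lemma wedgeToTensor_ιMulti {R L : Type*} [CommRing R] [AddCommGroup L] [Module R L] (X Y : L) :
    wedgeToTensor (exteriorPower.ιMulti R 2 ![X, Y]) = X ⊗ₜ[R] Y - Y ⊗ₜ[R] X := by
  simp [wedgeToTensor]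

/-- The Lie derivative `[X, ·]` on `L ⊗_R L`:
`[X, Y ⊗ Z] = [X, Y] ⊗ Z + Y ⊗ [X, Z]`. On `∧² L` it is the Schouten bracket with `X`. -/
def LieRinehart.lieDeriv (A : LieRinehart R L) (X : L) : L ⊗[R] L →+ L ⊗[R] L :=
  TensorProduct.liftAddHom
    (AddMonoidHom.mk' (fun Y => AddMonoidHom.mk'
        (fun Z => A.bracket X Y ⊗ₜ[R] Z + Y ⊗ₜ[R] A.bracket X Z)
        (fun v w => by simp only [A.bracket_add, TensorProduct.tmul_add]; abel))
      (fun u w => by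
        ext v; simp only [A.bracket_add, TensorProduct.add_tmul, AddMonoidHom.mk'_apply,
          AddMonoidHom.add_apply]; abel))
    (fun f u v => by
      simp only [AddMonoidHom.mk'_apply, A.leibniz, TensorProduct.add_tmul,
        TensorProduct.tmul_add, TensorProduct.smul_tmul]
      abel)

/-- `D` is the differential on `Γ(∧ A)` induced by a Lie algebroid structure `B` on `A^*`, where
`p` is the pairing of sections of `A^*` with sections of `A`: the derivation of degree one with
`⟨ξ, D f⟩ = ρ_*(ξ) f` and
`(D X)(ξ, η) = ρ_*(ξ) ⟨η, X⟩ - ρ_*(η) ⟨ξ, X⟩ - ⟨[ξ, η], X⟩`. -/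
structure IsInducedDifferential (B : LieRinehart R M) (p : M →ₗ[R] L →ₗ[R] R)
    (D : DegreeOneDerivation R L) : Prop where
  onFun : ∀ f ξ, p ξ (D.onFun f) = B.anchor ξ f
  onSec : ∀ X ξ η,
    TensorProduct.lid R R (TensorProduct.map (p ξ) (p η) (wedgeToTensor (D.onSec X)))
      = B.anchor ξ (p η X) - B.anchor η (p ξ X) - p (B.bracket ξ η) X

/-- The compatibility condition of a Lie bialgebroid `(A, A^*)`: the differential `d_*` on
`Γ(∧ A)` induced by the Lie algebroid `A^*` satisfies `d_*[X, Y] = [d_* X, Y] + [X, d_* Y]`. -/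
def IsLieBialgebroid (A : LieRinehart R L) (B : LieRinehart R M) (p : M →ₗ[R] L →ₗ[R] R) : Prop :=
  ∃ D : DegreeOneDerivation R L, IsInducedDifferential B p D ∧
    ∀ X Y, wedgeToTensor (D.onSec (A.bracket X Y))
      = -A.lieDeriv Y (wedgeToTensor (D.onSec X)) + A.lieDeriv X (wedgeToTensor (D.onSec Y))

/-- Poisson brackets on the commutative algebra `R`. -/
structure IsPoissonBracket (br : R → R → R) : Prop where
  smul : ∀ (c : ℝ) f g, br (algebraMap ℝ R c * f) g = algebraMap ℝ R c * br f g
  add : ∀ f g h, br (f + g) h = br f h + br g h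
  skew : ∀ f g, br f g = -br g f
  leibniz : ∀ f g h, br f (g * h) = br f g * h + g * br f h
  jacobi : ∀ f g h, br f (br g h) = br (br f g) h + br g (br f h)

/-- `br` is the bracket on functions given by the bundle map `ρ ∘ ρ_*^* : T^*P → TP`, that is
`br f g = ρ(Z) g` for the section `Z = ρ_*^*(df)` of `A`, characterized by
`⟨ξ, Z⟩ = ρ_*(ξ) f` for all sections `ξ` of `A^*`. -/
def IsBaseBracket (A : LieRinehart R L) (B : LieRinehart R M) (p : M →ₗ[R] L →ₗ[R] R)
    (br : R → R → R) : Prop :=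
  ∀ f, ∃ Z : L, (∀ ξ, p ξ Z = B.anchor ξ f) ∧ ∀ g, br f g = A.anchor Z g

end Multivectors

/-! ## Quantum groupoids: deformations of `UA` -/

section Deformation

variable {R L : Type*} [CommRing R] [Algebra ℝ R] [AddCommGroup L] [Module R L]

/-- The ideal of `ℝ[[ħ]]` generated by `ħ`. -/
abbrev hbarIdeal : Ideal ℝ⟦X⟧ := Ideal.span {PowerSeries.X}

/-- The ring map `ℝ[[ħ]] → R`, `ħ ↦ 0`. -/
def evalZero (R : Type*) [CommRing R] [Algebra ℝ R] : ℝ⟦X⟧ →+* R :=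
  (algebraMap ℝ R).comp PowerSeries.constantCoeff

/-- `lim_{ħ → 0} x / ħ = t`: the element `x` of the `ℝ[[ħ]]`-module `M` is divisible by `ħ`, and
every quotient of `x` by `ħ` reduces to `t` under the reduction map `ev`. -/
def HbarLimit {M T : Type*} [AddCommGroup M] [Module ℝ⟦X⟧ M] (ev : M → T) (x : M) (t : T) :
    Prop :=
  (∃ y : M, (PowerSeries.X : ℝ⟦X⟧) • y = x) ∧ ∀ y : M, (PowerSeries.X : ℝ⟦X⟧) • y = x → ev y = t

/-- A deformation of the algebras `UA` and `R` and of the maps between them: `H_ħ ≅ UA[[ħ]]` and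
`R_ħ ≅ R[[ħ]]` as `ℝ[[ħ]]`-modules, with the same units, such that products, source map and target
map are those of `UA` modulo `ħ`. -/
structure MapsDeformation (A : LieRinehart R L) {Rh Hh : Type*} [Ring Rh] [Algebra ℝ⟦X⟧ Rh]
    [Ring Hh] [Algebra ℝ⟦X⟧ Hh] (S : SourceTarget ℝ⟦X⟧ Rh Hh) where
  baseEquiv : Rh ≃+ R⟦X⟧
  baseEquiv_smul : ∀ c a, baseEquiv (c • a) = PowerSeries.map (algebraMap ℝ R) c * baseEquiv a
  baseEquiv_one : baseEquiv 1 = 1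
  totalEquiv : Hh ≃+ (Envelope A)⟦X⟧
  totalEquiv_smul : ∀ c h,
    totalEquiv (c • h) = PowerSeries.map (algebraMap ℝ (Envelope A)) c * totalEquiv h
  totalEquiv_one : totalEquiv 1 = 1
  base_mul : ∀ a b, (baseEquiv (a * b)).constantCoeff
    = (baseEquiv a).constantCoeff * (baseEquiv b).constantCoeff
  total_mul : ∀ h k, (totalEquiv (h * k)).constantCoeff
    = (totalEquiv h).constantCoeff * (totalEquiv k).constantCoeff
  source_mod : ∀ a, (totalEquiv (S.α a)).constantCoeff
    = Envelope.ofFun A (baseEquiv a).constantCoeff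
  target_mod : ∀ a, (totalEquiv (S.β a)).constantCoeff
    = Envelope.ofFun A (baseEquiv a).constantCoeff

namespace MapsDeformation

variable {A : LieRinehart R L} {Rh Hh : Type*} [Ring Rh] [Algebra ℝ⟦X⟧ Rh]
    [Ring Hh] [Algebra ℝ⟦X⟧ Hh] {S : SourceTarget ℝ⟦X⟧ Rh Hh} (Q : MapsDeformation A S)

/-- The element of `R_ħ` corresponding to `f ∈ R ⊂ R[[ħ]]`. -/
def liftFun (f : R) : Rh := Q.baseEquiv.symm (PowerSeries.C f)

/-- The element of `H_ħ` corresponding to `u ∈ UA ⊂ UA[[ħ]]`. -/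
def liftTotal (u : Envelope A) : Hh := Q.totalEquiv.symm (PowerSeries.C u)

/-- The reduction `R_ħ → R`, `ħ ↦ 0`. -/
def baseRed (a : Rh) : R := (Q.baseEquiv a).constantCoeff

/-- The reduction `H_ħ → UA`, `ħ ↦ 0`. -/
def totalRed : Hh →ₛₗ[evalZero R] Envelope A where
  toFun h := (Q.totalEquiv h).constantCoeff
  map_add' h k := by simp
  map_smul' c h := by
    rw [Q.totalEquiv_smul, map_mul, ← PowerSeries.coeff_zero_eq_constantCoeff_apply,
      PowerSeries.coeff_map, PowerSeries.coeff_zero_eq_constantCoeff_apply, evalZero,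
      RingHom.comp_apply, Envelope.fun_smul_def, AlgHom.commutes]

/-- The reduction `τ : H_ħ ⊗_{R_ħ} H_ħ → UA ⊗_R UA`, `h ⊗ h' ↦ (h mod ħ) ⊗ (h' mod ħ)`. -/
def tensorRed : S.Tensor₂ hbarIdeal →ₛₗ[evalZero R] Envelope A ⊗[R] Envelope A :=
  (Submodule.liftQ _ (Submodule.liftQ S.rel₂
    (TensorProduct.lift (LinearMap.mk₂'ₛₗ (evalZero R) (evalZero R)
      (fun h k => Q.totalRed h ⊗ₜ[R] Q.totalRed k)
      (fun h h' k => by simp [TensorProduct.add_tmul])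
      (fun c h k => by simp [TensorProduct.smul_tmul'])
      (fun h k k' => by simp [TensorProduct.tmul_add])
      (fun c h k => by simp))) (by
    rw [SourceTarget.rel₂, Submodule.span_le]
    rintro _ ⟨a, h, k, rfl⟩
    have h₁ : Q.totalRed (S.β a * h) = Q.baseRed a • Q.totalRed h :=
      (Q.total_mul _ _).trans (by rw [Q.target_mod]; rfl)
    have h₂ : Q.totalRed (S.α a * k) = Q.baseRed a • Q.totalRed k :=
      (Q.total_mul _ _).trans (by rw [Q.source_mod]; rfl)
    rw [SetLike.mem_coe, LinearMap.mem_ker, map_sub, TensorProduct.lift.tmul,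
      TensorProduct.lift.tmul]
    change (Q.totalRed (S.β a * h) ⊗ₜ[R] Q.totalRed k : Envelope A ⊗[R] Envelope A)
      - Q.totalRed h ⊗ₜ[R] Q.totalRed (S.α a * k) = 0
    rw [h₁, h₂, TensorProduct.smul_tmul, sub_self]))
    (by
      rw [pow_one, Submodule.smul_le]
      intro r hr x _
      have : evalZero R r = 0 := by
        obtain ⟨s, rfl⟩ := Ideal.mem_span_singleton'.1 hr
        simp [evalZero]
      rw [LinearMap.mem_ker, LinearMap.map_smulₛₗ, this, zero_smul])).comp (AdicCompletion.eval hbarIdeal _ 1)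

end MapsDeformation

/-- A quantum groupoid: a topological Hopf algebroid `(H_ħ, R_ħ, α_ħ, β_ħ, m_ħ, Δ_ħ, ε_ħ)` over
`ℝ[[ħ]]` that is a deformation of the Hopf algebroid `UA`. -/
structure QuantumGroupoid (A : LieRinehart R L) (Rh Hh : Type*) [Ring Rh] [Algebra ℝ⟦X⟧ Rh]
    [Ring Hh] [Algebra ℝ⟦X⟧ Hh] extends HopfAlgebroid ℝ⟦X⟧ Rh Hh hbarIdeal where
  deform : MapsDeformation A maps
  counit_mod : ∀ h, deform.baseRed (counit.ε h) = Envelope.counit A (deform.totalRed h)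
  comul_mod : ∀ h, deform.tensorRed (comul.Δ h) = Envelope.comul A (deform.totalRed h)

namespace QuantumGroupoid

variable {A : LieRinehart R L} {Rh Hh : Type*} [Ring Rh] [Algebra ℝ⟦X⟧ Rh]
    [Ring Hh] [Algebra ℝ⟦X⟧ Hh] (Q : QuantumGroupoid A Rh Hh)

/-- `{f, g} = lim (f * g - g * f) / ħ`, where `*` is the product of `R_ħ`. -/
def IsStarBracket (br : R → R → R) : Prop :=
  ∀ f g, HbarLimit Q.deform.baseRed
    (Q.deform.liftFun f * Q.deform.liftFun g - Q.deform.liftFun g * Q.deform.liftFun f) (br f g)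

/-- `δf = lim (α_ħ f - β_ħ f) / ħ` in `UA`. -/
def IsDeltaFun (f : R) (u : Envelope A) : Prop :=
  HbarLimit Q.deform.totalRed
    (Q.maps.α (Q.deform.liftFun f) - Q.maps.β (Q.deform.liftFun f)) u

/-- `Δ¹X = lim (Δ_ħ X - (1 ⊗ X + X ⊗ 1)) / ħ` in `UA ⊗_R UA`. -/
def IsDeltaOne (X : L) (t : Envelope A ⊗[R] Envelope A) : Prop :=
  HbarLimit Q.deform.tensorRed
    (Q.comul.Δ (Q.deform.liftTotal (Envelope.ofSec A X))
      - Q.maps.mk₂ hbarIdeal (1 ⊗ₜ Q.deform.liftTotal (Envelope.ofSec A X)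
        + Q.deform.liftTotal (Envelope.ofSec A X) ⊗ₜ 1)) t

/-- The derivation `D` of `Γ(∧ A)` is the operator `δ` of the quantum groupoid: `D f = δf` in `UA`,
and `D X = δX = Δ¹X - Δ¹_op X` in `UA ⊗_R UA`. -/
structure IsDelta (D : DegreeOneDerivation R L) : Prop where
  onFun : ∀ f, Q.IsDeltaFun f (Envelope.ofSec A (D.onFun f))
  onSec : ∀ X, ∃ t, Q.IsDeltaOne X t ∧
    TensorProduct.map (Envelope.ofSec A) (Envelope.ofSec A) (wedgeToTensor (D.onSec X))
      = t - TensorProduct.comm R _ _ t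

end QuantumGroupoid

end Deformation

/-! ## Lie algebroids -/

section Geometry

variable {n : ℕ} {P : Type*} [TopologicalSpace P] [ChartedSpace (EuclideanSpace ℝ (Fin n)) P]
  {F : Type*} [NormedAddCommGroup F] [NormedSpace ℝ F]
  {E : P → Type*} [TopologicalSpace (TotalSpace F E)] [∀ x, AddCommGroup (E x)]
  [∀ x, Module ℝ (E x)] [∀ x, TopologicalSpace (E x)] [FiberBundle F E] [VectorBundle ℝ F E]

/-- The algebra `C^∞(P)` of real smooth functions. -/
abbrev SmoothFun (n : ℕ) (P : Type*) [TopologicalSpace P]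
    [ChartedSpace (EuclideanSpace ℝ (Fin n)) P] : Type _ := C^∞⟮𝓡 n, P; ℝ⟯

/-- The space `Γ(E)` of smooth sections of `E`. -/
abbrev SmoothSec (n : ℕ) {P : Type*} [TopologicalSpace P]
    [ChartedSpace (EuclideanSpace ℝ (Fin n)) P] (F : Type*) [NormedAddCommGroup F]
    [NormedSpace ℝ F] (E : P → Type*) [TopologicalSpace (TotalSpace F E)]
    [∀ x, TopologicalSpace (E x)] [FiberBundle F E] : Type _ :=
  ContMDiffSection (𝓡 n) F ∞ E

/-- The pointwise product of a smooth function and a smooth section. -/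
instance : SMul (SmoothFun n P) (SmoothSec n F E) :=
  ⟨fun f s => ⟨fun x => f x • s x, f.contMDiff.smul_section s.contMDiff⟩⟩

@[simp] lemma smul_sec_apply (f : SmoothFun n P) (s : SmoothSec n F E) (x : P) :
    (f • s) x = f x • s x := rfl

/-- `Γ(E)` as a module over `C^∞(P)`. -/
instance : Module (SmoothFun n P) (SmoothSec n F E) where
  one_smul s := by ext x; simp
  mul_smul f g s := by ext x; simp [mul_smul]
  smul_zero f := by ext x; simp
  smul_add f s t := by ext x; simp
  add_smul f g s := by ext x; simp [add_smul]
  zero_smul s := by ext x; simp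

variable [IsManifold (𝓡 n) ∞ P]

/-- A smooth bundle map `E → TP`. -/
@[ext]
structure BundleMapToTangent (n : ℕ) {P : Type*} [TopologicalSpace P]
    [ChartedSpace (EuclideanSpace ℝ (Fin n)) P] [IsManifold (𝓡 n) ∞ P]
    (F : Type*) [NormedAddCommGroup F] [NormedSpace ℝ F] (E : P → Type*)
    [TopologicalSpace (TotalSpace F E)] [∀ x, AddCommGroup (E x)] [∀ x, Module ℝ (E x)]
    [∀ x, TopologicalSpace (E x)] [FiberBundle F E] where
  toFun : ∀ x, E x →ₗ[ℝ] TangentSpace (𝓡 n) x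
  smooth : ContMDiff ((𝓡 n).prod 𝓘(ℝ, F)) (𝓡 n).tangent ∞
    (fun v : TotalSpace F E => (⟨v.1, toFun v.1 v.2⟩ : TangentBundle (𝓡 n) P))

/-- The derivative `ρ(X) f` of a function along the vector field `ρ ∘ X`. -/
def BundleMapToTangent.deriv (ρ : BundleMapToTangent n F E) (X : SmoothSec n F E)
    (f : SmoothFun n P) : SmoothFun n P :=
  ⟨fun x => mfderiv (𝓡 n) 𝓘(ℝ, ℝ) f x (ρ.toFun x (X x)), by
    have h₁ : ContMDiff (𝓡 n) (𝓡 n).tangent ∞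
        (fun x => (⟨x, ρ.toFun x (X x)⟩ : TangentBundle (𝓡 n) P)) :=
      ρ.smooth.comp X.contMDiff
    have h₂ := (f.contMDiff.contMDiff_tangentMap (m := ∞) (by simp)).comp h₁
    exact (contMDiff_snd_tangentBundle_modelSpace ℝ 𝓘(ℝ, ℝ)).comp h₂⟩

/-- The derivation of `C^∞(P)` along `ρ ∘ X`, as a `C^∞(P)`-linear function of `X`. -/
def BundleMapToTangent.derivation (ρ : BundleMapToTangent n F E) :
    SmoothSec n F E →ₗ[SmoothFun n P] Derivation ℝ (SmoothFun n P) (SmoothFun n P) where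
  toFun X := Derivation.mk'
    { toFun := ρ.deriv X
      map_add' := fun f g => by
        ext x
        have := mfderiv_add (f.contMDiff.mdifferentiableAt (x := x) (by simp))
          (g.contMDiff.mdifferentiableAt (x := x) (by simp))
        exact congrArg (fun T => T (ρ.toFun x (X x))) this
      map_smul' := fun c f => by
        ext x
        have := const_smul_mfderiv (f.contMDiff.mdifferentiableAt (x := x) (by simp)) c
        exact congrArg (fun T => T (ρ.toFun x (X x))) this }
    (fun f g => by
      ext x
      have := ((f.contMDiff.mdifferentiableAt (x := x) (by simp)).hasMFDerivAt.mul
        (g.contMDiff.mdifferentiableAt (x := x) (by simp)).hasMFDerivAt).mfderiv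
      exact congrArg (fun T => T (ρ.toFun x (X x))) this)
  map_add' X Y := by
    ext f x
    simp [BundleMapToTangent.deriv]; rfl
  map_smul' f X := by
    ext g x
    simp [BundleMapToTangent.deriv]; rfl

/-- A Lie algebroid structure on the vector bundle `E → P`: a smooth bundle map `ρ : E → TP`
(the anchor) and a real Lie bracket on `Γ(E)` with `[X, fY] = f [X, Y] + (ρ(X) f) Y` and
`ρ [X, Y] = [ρ X, ρ Y]`. -/
@[ext]
structure LieAlgebroid (n : ℕ) {P : Type*} [TopologicalSpace P]
    [ChartedSpace (EuclideanSpace ℝ (Fin n)) P] [IsManifold (𝓡 n) ∞ P]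
    (F : Type*) [NormedAddCommGroup F] [NormedSpace ℝ F] (E : P → Type*)
    [TopologicalSpace (TotalSpace F E)] [∀ x, AddCommGroup (E x)] [∀ x, Module ℝ (E x)]
    [∀ x, TopologicalSpace (E x)] [FiberBundle F E] [VectorBundle ℝ F E] where
  anchor : BundleMapToTangent n F E
  bracket : SmoothSec n F E → SmoothSec n F E → SmoothSec n F E
  add_bracket : ∀ X Y Z, bracket (X + Y) Z = bracket X Z + bracket Y Z
  bracket_add : ∀ X Y Z, bracket X (Y + Z) = bracket X Y + bracket X Z
  bracket_self : ∀ X, bracket X X = 0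
  jacobi : ∀ X Y Z, bracket X (bracket Y Z) = bracket (bracket X Y) Z + bracket Y (bracket X Z)
  leibniz : ∀ X (f : SmoothFun n P) Y,
    bracket X (f • Y) = f • bracket X Y + anchor.deriv X f • Y
  anchor_bracket : ∀ X Y f,
    anchor.deriv (bracket X Y) f
      = anchor.deriv X (anchor.deriv Y f) - anchor.deriv Y (anchor.deriv X f)

/-- The algebraic structure on the sections of a Lie algebroid. -/
def LieAlgebroid.sections (A : LieAlgebroid n F E) :
    LieRinehart (SmoothFun n P) (SmoothSec n F E) where
  bracket := A.bracket
  anchor := A.anchor.derivation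
  add_bracket := A.add_bracket
  bracket_add := A.bracket_add
  bracket_self := A.bracket_self
  jacobi := A.jacobi
  leibniz := A.leibniz
  anchor_bracket := A.anchor_bracket

/-- The fibres of the dual bundle `E^*`. -/
abbrev DualBundle {P : Type*} (E : P → Type*) [∀ x, AddCommGroup (E x)] [∀ x, Module ℝ (E x)]
    [∀ x, TopologicalSpace (E x)] : P → Type _ :=
  fun x => E x →L[ℝ] Bundle.Trivial P ℝ x

/-- The pairing of sections of `E^*` and `E`. -/
def sectionPairing : SmoothSec n (F →L[ℝ] ℝ) (DualBundle E) →ₗ[SmoothFun n P]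
    SmoothSec n F E →ₗ[SmoothFun n P] SmoothFun n P :=
  LinearMap.mk₂ _ (fun ξ X => ⟨fun x => ξ x (X x), by
      have h := ξ.contMDiff.clm_bundle_apply X.contMDiff
      exact fun x => (contMDiffAt_section x).1 (h x)⟩)
    (fun ξ η X => by ext x; rfl) (fun f ξ X => by ext x; rfl)
    (fun ξ X Y => by ext x; exact map_add (ξ x) (X x) (Y x))
    (fun f ξ X => by ext x; exact map_smul (ξ x) (f x) (X x))

end Geometry
end QuantumGroupoids
end

/-!
Write `R = C^∞(P)` and `L = Γ(A)`. The argument needs only two facts about the pair `(R, L)`: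
`L` has a finite dual system (finitely many sections `e i` and functionals `φ i` with
`X = ∑ φ i X • e i`), and the inclusion `L → UA` has an `R`-linear retraction `π`. The second is a
form of the Poincaré–Birkhoff–Witt theorem: over a localisation where `L` is free it comes from an action on
polynomials, and the local retractions are glued because the functions supporting frames of `L`
generate the unit ideal.

Cohomology of `UA` as a coalgebra. The operator `u ↦ ∑ i, φ i (π u₍₁₎) u₍₂₎ e i` acts on symbols of
order `k` as multiplication by `k`, like the Euler operator of a symmetric algebra. Induction on the
order then shows that primitive elements of `UA` are sections, that the skew part of a `2`-cocycle of the cobar complex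
is a bivector, and that a symmetric `2`-cocycle is a coboundary. It also gives, for each finite subset of `UA`,
a finite-rank operator fixing it. On the quantum side, therefore, the completed tensor powers of
`U_ħ A` over `R_ħ` have no `ħ`-torsion, and an element reducing to zero is uniquely divisible by
`ħ`. This is what makes the two limits well defined.

The derivation. Dividing the Hopf algebroid identities by `ħ` and reducing, `δ f` is primitive,
and `Δ¹ X` is a `2`-cocycle, so `δ f ∈ L` and `δ X ∈ Λ² L`. Multiplicativity of `Δ_ħ` and its
compatibility with the source and target maps give the Leibniz rules of `δ` and
`δ [X, Y] = [δ X, Y] + [X, δ Y]`. For `δ² = 0` the lift of `X` is changed so that its first-order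
coproduct is skew; the next order of coassociativity then has vanishing full antisymmetrisation,
which is `δ² X`. Since the value of `δ` on functions enters the Leibniz rule on sections, the
extension to the exterior algebra is not an extension of a linear map `L → Λ L`; it is constructed
through an algebra of matrices over `Λ L` twisted by `δ`, in which the rule becomes linear.

The dual Lie algebroid. Its bracket and anchor on functionals `L → R` are defined by the Cartan
formula, and `δ² = 0` is equivalent to the Jacobi identity. The identification of functionals with
sections of `A^*`, and of derivations of `R` with vector fields (by Hadamard's lemma), turns this
into a Lie algebroid structure on `A^*`; it is unique because its differential is prescribed on
functions and sections. Comparing `α a - β a` in the commutators `[α a - β a, α b] = α (a * b - b * a)`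
identifies the induced Poisson bracket `ρ (δ f) g` with the first-order commutator of `R_ħ`.

Finite generation. On a compact set finitely many sections span a vector bundle. A generic linear
projection, which exists by a Hausdorff dimension count, brings their number down to a bound that
depends only on the ranks and on `dim P`; the annuli of a compact exhaustion with indices of one
parity are disjoint, so finitely many global sections span everywhere. Smooth dual functionals are
obtained from them by a partition of unity.
-/

noncomputable section

namespace QuantumGroupoids

/-! ### The filtration of the enveloping algebra and its coalgebra structure -/

namespace Envelope

variable {R L : Type*} [CommRing R] [Algebra ℝ R] [AddCommGroup L] [Module R L]
  (A : LieRinehart R L)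

variable {A} in
/-- Induction on elements of `UA`, multiplying by functions and sections from the left. -/
theorem induction_left {p : Envelope A → Prop} (one : p 1)
    (add : ∀ u v, p u → p v → p (u + v)) (smul : ∀ (f : R) u, p u → p (f • u))
    (sec : ∀ X u, p u → p (ofSec A X * u)) (u : Envelope A) : p u := by
  obtain ⟨a, rfl⟩ := RingQuot.mkAlgHom_surjective ℝ (EnvelopeRel A) u
  suffices h : ∀ v : Envelope A, p v → p (mk A a * v) by
    have := h 1 one
    rwa [mul_one] at this
  induction a using FreeAlgebra.induction with
  | grade0 c =>
    intro v hv
    have := smul (algebraMap ℝ R c) v hv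
    rwa [fun_smul_def, AlgHom.commutes, ← (mk A).commutes] at this
  | grade1 x =>
    intro v hv
    rcases x with f | X
    · exact smul f v hv
    · exact sec X v hv
  | mul a b ha hb =>
    intro v hv
    rw [map_mul, mul_assoc]
    exact ha _ (hb _ hv)
  | add a b ha hb =>
    intro v hv
    rw [map_add, add_mul]
    exact add _ _ (ha _ hv) (hb _ hv)

@[simp] lemma fun_smul_mul (f : R) (u v : Envelope A) : (f • u) * v = f • (u * v) := by
  simp only [fun_smul_def, mul_assoc]

lemma ofSec_mul_smul (X : L) (f : R) (u : Envelope A) :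
    ofSec A X * f • u = f • (ofSec A X * u) + A.anchor X f • u := by
  simp only [fun_smul_def, ← mul_assoc, ofSec_mul_ofFun, add_mul]

/-- Right multiplication by `v`, which is linear over functions acting from the left. -/
def mulRight (v : Envelope A) : Envelope A →ₗ[R] Envelope A where
  toFun u := u * v
  map_add' u w := add_mul u w v
  map_smul' f u := fun_smul_mul A f u v

@[simp] lemma mulRight_apply (u v : Envelope A) : mulRight A v u = u * v := rfl

lemma comul_add (u v : Envelope A) : comul A (u + v) = comul A u + comul A v := by
  simp [comul]

lemma comul_smul (f : R) (u : Envelope A) : comul A (f • u) = f • comul A u := by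
  simp [comul, fun_smul_def, tensorAct]

lemma comul_one : comul A 1 = 1 ⊗ₜ 1 := by simp [comul]

lemma comul_sec_mul (X : L) (u : Envelope A) :
    comul A (ofSec A X * u) = secAct A X (comul A u) := by
  simp only [comul, map_mul, Module.End.mul_apply, tensorAct, lift_ofSec]
  rfl

/-- The coproduct as a map that is linear over functions. -/
def comulₗ : Envelope A →ₗ[R] Envelope A ⊗[R] Envelope A where
  toFun := comul A
  map_add' := comul_add A
  map_smul' := comul_smul A

@[simp] lemma comulₗ_apply (u : Envelope A) : comulₗ A u = comul A u := rfl

lemma counit_add (u v : Envelope A) : counit A (u + v) = counit A u + counit A v := by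
  simp [counit]

lemma counit_smul (f : R) (u : Envelope A) : counit A (f • u) = f * counit A u := by
  simp [counit, fun_smul_def, funAct]

lemma counit_one : counit A 1 = 1 := by simp [counit]

lemma counit_sec_mul (X : L) (u : Envelope A) :
    counit A (ofSec A X * u) = A.anchor X (counit A u) := by
  simp [counit, funAct]

/-- The counit as a map that is linear over functions. -/
def counitₗ : Envelope A →ₗ[R] R where
  toFun := counit A
  map_add' := counit_add A
  map_smul' := counit_smul A

@[simp] lemma counitₗ_apply (u : Envelope A) : counitₗ A u = counit A u := rfl

lemma counit_ofSec (X : L) : counit A (ofSec A X) = 0 := by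
  have := counit_sec_mul A X 1
  rwa [mul_one, counit_one, Derivation.map_one_eq_zero] at this

lemma comm_secAct (X : L) (t : Envelope A ⊗[R] Envelope A) :
    TensorProduct.comm R _ _ (secAct A X t) = secAct A X (TensorProduct.comm R _ _ t) := by
  induction t using TensorProduct.induction_on with
  | zero => simp
  | tmul u v => simp [add_comm]
  | add s t hs ht => simp only [map_add, hs, ht]

/-- `UA` is cocommutative. -/
lemma comm_comul (u : Envelope A) : TensorProduct.comm R _ _ (comul A u) = comul A u := by
  induction u using induction_left with
  | one => simp [comul_one]
  | add u v hu hv => rw [comul_add, map_add, hu, hv]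
  | smul f u hu => rw [comul_smul, map_smul, hu]
  | sec X u hu => rw [comul_sec_mul, comm_secAct, hu]

/-- The products of fewer than `k` sections, with coefficients in `R`. -/
def fil : ℕ → Submodule R (Envelope A)
  | 0 => ⊥
  | k + 1 => Submodule.span R ({1} ∪ {w | ∃ X, ∃ v ∈ fil k, w = ofSec A X * v})

lemma one_mem_fil (k : ℕ) : (1 : Envelope A) ∈ fil A (k + 1) :=
  Submodule.subset_span (Or.inl rfl)

variable {A} in
lemma sec_mul_mem_fil {k : ℕ} {v : Envelope A} (X : L) (hv : v ∈ fil A k) :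
    ofSec A X * v ∈ fil A (k + 1) :=
  Submodule.subset_span (Or.inr ⟨X, v, hv, rfl⟩)

variable {A} in
theorem fil_induction {k : ℕ} {p : Envelope A → Prop} (one : p 1) (zero : p 0)
    (add : ∀ u v, p u → p v → p (u + v)) (smul : ∀ (f : R) u, p u → p (f • u))
    (sec : ∀ X, ∀ v ∈ fil A k, p (ofSec A X * v)) {u : Envelope A} (hu : u ∈ fil A (k + 1)) :
    p u := by
  rw [fil] at hu
  induction hu using Submodule.span_induction with
  | mem x hx =>
    rcases hx with rfl | ⟨X, v, hv, rfl⟩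
    · exact one
    · exact sec X v hv
  | zero => exact zero
  | add x y _ _ hx hy => exact add x y hx hy
  | smul f x _ hx => exact smul f x hx

lemma fil_le_succ (k : ℕ) : fil A k ≤ fil A (k + 1) := by
  induction k with
  | zero => exact bot_le
  | succ k ih =>
    intro u hu
    refine fil_induction (p := fun u => u ∈ fil A (k + 1 + 1)) (one_mem_fil A _)
      (zero_mem _) (fun _ _ => add_mem) (fun f _ h => Submodule.smul_mem _ f h)
      (fun X v hv => sec_mul_mem_fil X (ih hv)) hu

lemma fil_mono : Monotone (fil A) := monotone_nat_of_le_succ (fil_le_succ A)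

lemma exists_mem_fil (u : Envelope A) : ∃ k, u ∈ fil A k := by
  induction u using induction_left with
  | one => exact ⟨1, one_mem_fil A 0⟩
  | add u v hu hv =>
    obtain ⟨k, hk⟩ := hu
    obtain ⟨l, hl⟩ := hv
    exact ⟨max k l, add_mem (fil_mono A (le_max_left _ _) hk) (fil_mono A (le_max_right _ _) hl)⟩
  | smul f u hu =>
    obtain ⟨k, hk⟩ := hu
    exact ⟨k, Submodule.smul_mem _ f hk⟩
  | sec X u hu =>
    obtain ⟨k, hk⟩ := hu
    exact ⟨k + 1, sec_mul_mem_fil X hk⟩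

variable {A} in
lemma mul_sec_mem_fil {k : ℕ} {v : Envelope A} (hv : v ∈ fil A k) (X : L) :
    v * ofSec A X ∈ fil A (k + 1) := by
  induction k generalizing v with
  | zero => rw [fil, Submodule.mem_bot] at hv; simp [hv]
  | succ k ih =>
    refine fil_induction (p := fun v => v * ofSec A X ∈ fil A (k + 1 + 1)) ?_ ?_ ?_ ?_ ?_ hv
    · simpa using sec_mul_mem_fil X (one_mem_fil A k)
    · simp
    · intro u v hu hv; rw [add_mul]; exact add_mem hu hv
    · intro f u hu; rw [fun_smul_mul]; exact Submodule.smul_mem _ f hu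
    · intro Y w hw; rw [mul_assoc]; exact sec_mul_mem_fil Y (ih hw)

variable {A} in
lemma mul_fun_sub_mem_fil {k : ℕ} {v : Envelope A} (hv : v ∈ fil A (k + 1)) (f : R) :
    v * ofFun A f - f • v ∈ fil A k := by
  induction k generalizing v with
  | zero =>
    refine fil_induction (p := fun v => v * ofFun A f - f • v ∈ fil A 0) ?_ ?_ ?_ ?_ ?_ hv
    · simp [fun_smul_def]
    · simp
    · intro u v hu hv
      rw [add_mul, smul_add, add_sub_add_comm]; exact add_mem hu hv
    · intro g u hu
      rw [fun_smul_mul, smul_comm f g, ← smul_sub]; exact Submodule.smul_mem _ g hu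
    · intro Y w hw; rw [fil, Submodule.mem_bot] at hw; simp [hw]
  | succ k ih =>
    refine fil_induction (p := fun v => v * ofFun A f - f • v ∈ fil A (k + 1)) ?_ ?_ ?_ ?_ ?_ hv
    · simp [fun_smul_def]
    · simp
    · intro u v hu hv
      rw [add_mul, smul_add, add_sub_add_comm]; exact add_mem hu hv
    · intro g u hu
      rw [fun_smul_mul, smul_comm f g, ← smul_sub]; exact Submodule.smul_mem _ g hu
    · intro Y w hw
      have h : ofSec A Y * w * ofFun A f - f • (ofSec A Y * w)
          = ofSec A Y * (w * ofFun A f - f • w) + A.anchor Y f • w := by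
        rw [mul_sub, ofSec_mul_smul, mul_assoc]; abel
      rw [h]
      exact add_mem (sec_mul_mem_fil Y (ih hw)) (Submodule.smul_mem _ _ hw)

variable {A} in
lemma mul_sec_sub_mem_fil {k : ℕ} {v : Envelope A} (hv : v ∈ fil A k) (X : L) :
    v * ofSec A X - ofSec A X * v ∈ fil A k := by
  induction k generalizing v with
  | zero => rw [fil, Submodule.mem_bot] at hv; simp [hv]
  | succ k ih =>
    have smul : ∀ (g : R) (u : Envelope A), u ∈ fil A (k + 1) →
        u * ofSec A X - ofSec A X * u ∈ fil A (k + 1) →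
        (g • u) * ofSec A X - ofSec A X * (g • u) ∈ fil A (k + 1) := by
      intro g u hu h
      rw [ofSec_mul_smul, fun_smul_mul, ← sub_sub, ← smul_sub]
      exact sub_mem (Submodule.smul_mem _ _ h) (Submodule.smul_mem _ _ hu)
    refine (fil_induction (p := fun v => v ∈ fil A (k + 1) ∧
      v * ofSec A X - ofSec A X * v ∈ fil A (k + 1)) ?_ ?_ ?_ ?_ ?_ hv).2
    · exact ⟨one_mem_fil A k, by simp⟩
    · simp
    · rintro u v ⟨hu, hu'⟩ ⟨hv, hv'⟩
      refine ⟨add_mem hu hv, ?_⟩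
      rw [add_mul, mul_add, add_sub_add_comm]; exact add_mem hu' hv'
    · rintro g u ⟨hu, hu'⟩
      exact ⟨Submodule.smul_mem _ g hu, smul g u hu hu'⟩
    · intro Y w hw
      refine ⟨sec_mul_mem_fil Y hw, ?_⟩
      have h : ofSec A Y * w * ofSec A X - ofSec A X * (ofSec A Y * w)
          = ofSec A Y * (w * ofSec A X - ofSec A X * w) + ofSec A (A.bracket Y X) * w := by
        rw [← mul_assoc (ofSec A X), ← sub_eq_zero]
        have := ofSec_mul_ofSec A Y X
        rw [mul_sub, ← mul_assoc _ _ w, this]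
        noncomm_ring
      rw [h]
      exact add_mem (sec_mul_mem_fil Y (ih hw)) (sec_mul_mem_fil _ hw)

/-- Contraction of the first leg of the coproduct, `u ↦ φ(u₍₁₎) u₍₂₎`. -/
def contr (φ : Envelope A →ₗ[R] R) : Envelope A →ₗ[R] Envelope A :=
  (TensorProduct.lid R _).toLinearMap ∘ₗ φ.rTensor _ ∘ₗ comulₗ A

/-- The functional `u ↦ φ(X u) - ρ(X)(φ(u))`, which measures how far `φ` is from being
horizontal along `X`. -/
def secFunctional (φ : Envelope A →ₗ[R] R) (X : L) : Envelope A →ₗ[R] R where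
  toFun u := φ (ofSec A X * u) - A.anchor X (φ u)
  map_add' u v := by simp only [mul_add, map_add]; abel
  map_smul' f u := by
    simp only [ofSec_mul_smul, map_add, map_smul, smul_eq_mul, Derivation.leibniz,
      RingHom.id_apply]
    ring

lemma secFunctional_apply (φ : Envelope A →ₗ[R] R) (X : L) (u : Envelope A) :
    secFunctional A φ X u = φ (ofSec A X * u) - A.anchor X (φ u) := rfl

lemma contr_one (φ : Envelope A →ₗ[R] R) : contr A φ 1 = φ 1 • (1 : Envelope A) := by
  simp [contr, comul_one]

lemma contr_sec_mul (φ : Envelope A →ₗ[R] R) (X : L) (u : Envelope A) :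
    contr A φ (ofSec A X * u)
      = ofSec A X * contr A φ u + contr A (secFunctional A φ X) u := by
  simp only [contr, LinearMap.comp_apply, comulₗ_apply, comul_sec_mul, LinearEquiv.coe_coe]
  induction comul A u using TensorProduct.induction_on with
  | zero => simp
  | tmul u v =>
    simp only [secAct_tmul, map_add, LinearMap.rTensor_tmul, TensorProduct.lid_tmul,
      ofSec_mul_smul, secFunctional_apply, sub_smul]
    abel
  | add s t hs ht => simp only [map_add, hs, ht, mul_add]; abel

lemma contr_zero (u : Envelope A) : contr A 0 u = 0 := by
  simp [contr]

lemma contr_counit (u : Envelope A) : contr A (counitₗ A) u = u := by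
  induction u using induction_left with
  | one => simp [contr_one, counit_one]
  | add u v hu hv => rw [map_add, hu, hv]
  | smul f u hu => rw [map_smul, hu]
  | sec X u hu =>
    have : secFunctional A (counitₗ A) X = 0 := by
      ext v; simp [secFunctional_apply, counit_sec_mul]
    rw [contr_sec_mul, hu, this, contr_zero, add_zero]

variable {A} in
lemma contr_sub_mem_fil {k : ℕ} (φ : Envelope A →ₗ[R] R) {u : Envelope A}
    (hu : u ∈ fil A (k + 1)) : contr A φ u - φ 1 • u ∈ fil A k := by
  induction k generalizing φ u with
  | zero =>
    refine fil_induction (p := fun u => contr A φ u - φ 1 • u ∈ fil A 0) ?_ ?_ ?_ ?_ ?_ hu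
    · simp [contr_one]
    · simp
    · intro u v hu hv
      rw [map_add, smul_add, add_sub_add_comm]; exact add_mem hu hv
    · intro g u hu
      rw [map_smul, smul_comm _ g, ← smul_sub]; exact Submodule.smul_mem _ g hu
    · intro Y w hw; rw [fil, Submodule.mem_bot] at hw; simp [hw]
  | succ k ih =>
    refine fil_induction (p := fun u => contr A φ u - φ 1 • u ∈ fil A (k + 1)) ?_ ?_ ?_ ?_ ?_ hu
    · simp [contr_one]
    · simp
    · intro u v hu hv
      rw [map_add, smul_add, add_sub_add_comm]; exact add_mem hu hv
    · intro g u hu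
      rw [map_smul, smul_comm _ g, ← smul_sub]; exact Submodule.smul_mem _ g hu
    · intro X w hw
      have h₁ := ih φ hw
      have h₂ : contr A (secFunctional A φ X) w ∈ fil A (k + 1) := by
        have := add_mem (fil_le_succ A k (ih (secFunctional A φ X) hw))
          (Submodule.smul_mem _ (secFunctional A φ X 1) hw)
        simpa using this
      have h₃ : contr A φ (ofSec A X * w) - φ 1 • (ofSec A X * w)
          = ofSec A X * (contr A φ w - φ 1 • w) + A.anchor X (φ 1) • w
            + contr A (secFunctional A φ X) w := by
        rw [contr_sec_mul, mul_sub, ofSec_mul_smul]; abel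
      rw [h₃]
      exact add_mem (add_mem (sec_mul_mem_fil X h₁) (Submodule.smul_mem _ _ hw)) h₂

variable {A} in
lemma contr_mem_fil {k : ℕ} {φ : Envelope A →ₗ[R] R} (hφ : φ 1 = 0) {u : Envelope A}
    (hu : u ∈ fil A (k + 1)) : contr A φ u ∈ fil A k := by
  simpa [hφ] using contr_sub_mem_fil φ hu

end Envelope

/-- A finite dual system: sections `sᵢ` and linear forms `ξᵢ` with `X = ∑ ξᵢ(X) sᵢ`. -/
structure DualSystem (R L : Type*) [CommRing R] [AddCommGroup L] [Module R L] where
  card : ℕ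
  sec : Fin card → L
  form : Fin card → L →ₗ[R] R
  sum_eq : ∀ X, ∑ i, form i X • sec i = X

/-- A retraction of the canonical map `L → UA` that is linear over functions and kills `1`.
Together with a finite dual system this is all that is needed of the
Poincaré-Birkhoff-Witt theorem. -/
structure Envelope.Retraction {R L : Type*} [CommRing R] [Algebra ℝ R] [AddCommGroup L]
    [Module R L] (A : LieRinehart R L) where
  proj : Envelope A →ₗ[R] L
  proj_one : proj 1 = 0
  proj_ofSec : ∀ X, proj (Envelope.ofSec A X) = X

namespace Envelope

variable {R L : Type*} [CommRing R] [Algebra ℝ R] [AddCommGroup L] [Module R L]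
  {A : LieRinehart R L} (r : Retraction A) (B : DualSystem R L)

/-- The functional on `UA` given by a linear form on sections. -/
def Retraction.functional (i : Fin B.card) : Envelope A →ₗ[R] R := B.form i ∘ₗ r.proj

@[simp] lemma Retraction.functional_one (i : Fin B.card) : r.functional B i 1 = 0 := by
  simp [Retraction.functional, r.proj_one]

/-- The Euler operator `u ↦ ∑ φᵢ(u₍₁₎) u₍₂₎ sᵢ`, which multiplies the symbol of an element by
its order. -/
def euler : Envelope A →ₗ[R] Envelope A :=
  ∑ i, mulRight A (ofSec A (B.sec i)) ∘ₗ contr A (r.functional B i)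

lemma euler_apply (u : Envelope A) :
    euler r B u = ∑ i, contr A (r.functional B i) u * ofSec A (B.sec i) := by
  simp [euler]


lemma ofSec_injective (r : Retraction A) : Function.Injective (ofSec A) :=
  fun X Y h => by rw [← r.proj_ofSec X, h, r.proj_ofSec]

lemma sum_smul_mul_sec_sub_mem_fil {k : ℕ} {v : Envelope A} (hv : v ∈ fil A (k + 1)) (X : L) :
    ∑ i, (B.form i X • v) * ofSec A (B.sec i) - ofSec A X * v ∈ fil A (k + 1) := by
  have h₁ := mul_sec_sub_mem_fil hv X
  have h₂ : ∑ i, (v * ofFun A (B.form i X) - B.form i X • v) * ofSec A (B.sec i)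
      ∈ fil A (k + 1) :=
    sum_mem fun i _ => mul_sec_mem_fil (mul_fun_sub_mem_fil hv _) _
  have h₃ : v * ofSec A X = ∑ i, v * ofFun A (B.form i X) * ofSec A (B.sec i) := by
    conv_lhs => rw [← B.sum_eq X, map_sum, Finset.mul_sum]
    refine Finset.sum_congr rfl fun i _ => ?_
    rw [map_smul, fun_smul_def, mul_assoc]
  have := sub_mem h₁ h₂
  rw [h₃] at this
  convert this using 1
  simp only [sub_mul, Finset.sum_sub_distrib]
  abel

/-- The Euler operator acts on the symbols of order `k` as multiplication by `k`. -/
lemma euler_sub_mem_fil {k : ℕ} {u : Envelope A} (hu : u ∈ fil A (k + 1)) :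
    euler r B u - (k : ℝ) • u ∈ fil A k := by
  have one : euler r B 1 = 0 := by simp [euler_apply, contr_one]
  induction k generalizing u with
  | zero =>
    refine fil_induction (p := fun u => euler r B u - ((0 : ℕ) : ℝ) • u ∈ fil A 0)
      ?_ ?_ ?_ ?_ ?_ hu
    · simp [one]
    · simp
    · intro u v hu hv
      rw [map_add, smul_add, add_sub_add_comm]; exact add_mem hu hv
    · intro g u hu
      rw [map_smul, ← smul_comm g, ← smul_sub]; exact Submodule.smul_mem _ g hu
    · intro Y w hw; rw [fil, Submodule.mem_bot] at hw; simp [hw]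
  | succ k ih =>
    refine fil_induction (p := fun u => euler r B u - ((k + 1 : ℕ) : ℝ) • u ∈ fil A (k + 1))
      ?_ ?_ ?_ ?_ ?_ hu
    · rw [one, zero_sub, ← algebraMap_smul R]
      exact neg_mem (Submodule.smul_mem _ _ (one_mem_fil A k))
    · simp
    · intro u v hu hv
      rw [map_add, smul_add, add_sub_add_comm]; exact add_mem hu hv
    · intro g u hu
      rw [map_smul, ← smul_comm g, ← smul_sub]; exact Submodule.smul_mem _ g hu
    · intro X w hw
      have h₁ : ofSec A X * (euler r B w - (k : ℝ) • w) ∈ fil A (k + 1) :=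
        sec_mul_mem_fil X (ih hw)
      have h₂ : ∑ i, (contr A (secFunctional A (r.functional B i) X) w - B.form i X • w)
          * ofSec A (B.sec i) ∈ fil A (k + 1) := by
        refine sum_mem fun i _ => mul_sec_mem_fil ?_ _
        convert contr_sub_mem_fil (secFunctional A (r.functional B i) X) hw using 3
        simp [secFunctional_apply, Retraction.functional, r.proj_ofSec, r.proj_one]
      have h₃ := sum_smul_mul_sec_sub_mem_fil B hw X
      have h := add_mem (add_mem h₁ h₂) h₃
      convert h using 1
      simp only [euler_apply, contr_sec_mul, add_mul, Finset.sum_add_distrib, sub_mul,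
        Finset.sum_sub_distrib, mul_sub, Finset.mul_sum, mul_assoc, mul_smul_comm]
      push_cast
      rw [add_smul, one_smul]
      abel

/-- The primitive elements of `UA` are the sections. -/
lemma eq_ofSec_of_primitive (B : DualSystem R L) {u : Envelope A} (hu : comul A u = u ⊗ₜ[R] 1 + 1 ⊗ₜ[R] u) :
    u = ofSec A (r.proj u) := by
  have hE : euler r B u = ofSec A (r.proj u) := by
    have : ∀ i, contr A (r.functional B i) u = r.functional B i u • (1 : Envelope A) := by
      intro i
      simp [contr, hu]
    simp only [euler_apply, this, fun_smul_mul, one_mul]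
    rw [← B.sum_eq (r.proj u), map_sum]
    simp only [map_smul]
    rfl
  have hε : counit A u = 0 := by
    have h := contr_counit A u
    have h' := congrArg (counit A) h
    simp only [contr, LinearMap.comp_apply, comulₗ_apply, hu, map_add, LinearMap.rTensor_tmul,
      LinearEquiv.coe_coe, TensorProduct.lid_tmul, counitₗ_apply, counit_one, one_smul] at h'
    rw [counit_add, counit_smul, counit_one, mul_one] at h'
    simpa using h'
  have key : ∀ k, u ∈ fil A (k + 2) → u ∈ fil A 2 := by
    intro k
    induction k with
    | zero => exact id
    | succ k ih =>
      intro h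
      refine ih ?_
      have h₁ := euler_sub_mem_fil r B h
      have h₂ : ofSec A (r.proj u) ∈ fil A (k + 2) := by
        have := sec_mul_mem_fil (r.proj u) (one_mem_fil A k)
        simpa using this
      rw [hE] at h₁
      have h₃ := sub_mem h₂ h₁
      rw [sub_sub_cancel] at h₃
      have h₄ : u = algebraMap ℝ R ((k + 1 + 1 : ℕ) : ℝ)⁻¹ • ((k + 1 + 1 : ℕ) : ℝ) • u := by
        rw [algebraMap_smul, smul_smul, inv_mul_cancel₀ (by positivity), one_smul]
      rw [h₄]
      exact Submodule.smul_mem _ _ h₃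
  obtain ⟨k, hk⟩ := exists_mem_fil A u
  have h₂ : u ∈ fil A 2 := key k (fil_mono A (by omega) hk)
  have h₁ := euler_sub_mem_fil r B h₂
  rw [hE, Nat.cast_one, one_smul] at h₁
  have h₀ : ∃ c : R, ofSec A (r.proj u) - u = c • 1 := by
    refine fil_induction (p := fun w => ∃ c : R, w = c • (1 : Envelope A)) ⟨1, by simp⟩
      ⟨0, by simp⟩ ?_ ?_ ?_ h₁
    · rintro _ _ ⟨c, rfl⟩ ⟨d, rfl⟩; exact ⟨c + d, by rw [add_smul]⟩
    · rintro f _ ⟨c, rfl⟩; exact ⟨f * c, by rw [mul_smul]⟩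
    · intro X v hv; rw [fil, Submodule.mem_bot] at hv; exact ⟨0, by simp [hv]⟩
  obtain ⟨c, hc⟩ := h₀
  have hc' : c = 0 := by
    have h := congrArg (counitₗ A) hc
    rw [map_sub, map_smul] at h
    simpa [counit_ofSec, hε, counit_one] using h.symm
  rw [hc', zero_smul, sub_eq_zero] at hc
  exact hc.symm

end Envelope

end QuantumGroupoids

namespace QuantumGroupoids

/-! ### Local finite-rank approximations of the identity -/

section FiniteRank

variable {R M N P : Type*} [CommRing R] [AddCommGroup M] [Module R M] [AddCommGroup N] [Module R N]
  [AddCommGroup P] [Module R P]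

/-- The linear maps of the form `x ↦ ∑ ψⱼ(x) wⱼ`, with finitely many summands. -/
def finiteRank (R M N : Type*) [CommRing R] [AddCommGroup M] [Module R M] [AddCommGroup N]
    [Module R N] : Submodule R (M →ₗ[R] N) := LinearMap.range (dualTensorHom R M N)

lemma smulRight_mem_finiteRank (ψ : M →ₗ[R] R) (w : N) : ψ.smulRight w ∈ finiteRank R M N :=
  ⟨ψ ⊗ₜ w, by ext; simp⟩

lemma finiteRank_induction {p : (M →ₗ[R] N) → Prop} (zero : p 0)
    (rank_one : ∀ (ψ : M →ₗ[R] R) (w : N), p (ψ.smulRight w))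
    (add : ∀ S T, p S → p T → p (S + T)) {T : M →ₗ[R] N} (hT : T ∈ finiteRank R M N) : p T := by
  obtain ⟨t, rfl⟩ := hT
  induction t using TensorProduct.induction_on with
  | zero => simpa
  | tmul ψ w =>
    convert rank_one ψ w using 1
    ext; simp
  | add s t hs ht => rw [map_add]; exact add _ _ hs ht

lemma comp_mem_finiteRank (f : N →ₗ[R] P) {T : M →ₗ[R] N} (hT : T ∈ finiteRank R M N) :
    f ∘ₗ T ∈ finiteRank R M P := by
  refine finiteRank_induction (p := fun T => f ∘ₗ T ∈ finiteRank R M P) ?_ (fun ψ w => ?_)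
    (fun S T hS hT => ?_) hT
  · simp [zero_mem]
  · convert smulRight_mem_finiteRank ψ (f w) using 1
    ext; simp
  · rw [LinearMap.comp_add]; exact add_mem hS hT

lemma mem_finiteRank_comp (f : P →ₗ[R] M) {T : M →ₗ[R] N} (hT : T ∈ finiteRank R M N) :
    T ∘ₗ f ∈ finiteRank R P N := by
  refine finiteRank_induction (p := fun T => T ∘ₗ f ∈ finiteRank R P N) ?_ (fun ψ w => ?_)
    (fun S T hS hT => ?_) hT
  · simp [zero_mem]
  · exact smulRight_mem_finiteRank (ψ ∘ₗ f) w
  · rw [LinearMap.add_comp]; exact add_mem hS hT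

lemma map_mem_finiteRank {S : M →ₗ[R] M} (hS : S ∈ finiteRank R M M) {T : N →ₗ[R] N}
    (hT : T ∈ finiteRank R N N) :
    TensorProduct.map S T ∈ finiteRank R (M ⊗[R] N) (M ⊗[R] N) := by
  refine finiteRank_induction
    (p := fun S => TensorProduct.map S T ∈ finiteRank R (M ⊗[R] N) (M ⊗[R] N)) ?_ (fun ψ w => ?_)
    (fun S S' hS hS' => ?_) hS
  · simp [zero_mem]
  · refine finiteRank_induction (p := fun T => TensorProduct.map (ψ.smulRight w) T ∈
      finiteRank R (M ⊗[R] N) (M ⊗[R] N)) ?_ (fun ψ' w' => ?_) (fun T T' hT hT' => ?_) hT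
    · simp [zero_mem]
    · convert smulRight_mem_finiteRank
        ((TensorProduct.lid R R).toLinearMap ∘ₗ TensorProduct.map ψ ψ') (w ⊗ₜ[R] w') using 1
      ext x y
      simp [← TensorProduct.smul_tmul', smul_smul, mul_comm]
    · rw [TensorProduct.map_add_right]; exact add_mem hT hT'
  · rw [TensorProduct.map_add_left]; exact add_mem hS hS'

/-- Every finite subset of `M` is fixed by an endomorphism of the form `x ↦ ∑ ψⱼ(x) wⱼ`.
This is a form of flatness. -/
def LocallyFiniteRank (R M : Type*) [CommRing R] [AddCommGroup M] [Module R M] : Prop :=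
  ∀ S : Finset M, ∃ T ∈ finiteRank R M M, ∀ u ∈ S, T u = u

lemma LocallyFiniteRank.tensor (hM : LocallyFiniteRank R M) (hN : LocallyFiniteRank R N) :
    LocallyFiniteRank R (M ⊗[R] N) := by
  classical
  intro S
  have one : ∀ t : M ⊗[R] N, ∃ (S₁ : Finset M) (S₂ : Finset N), ∀ (T₁ : M →ₗ[R] M)
      (T₂ : N →ₗ[R] N), (∀ u ∈ S₁, T₁ u = u) → (∀ u ∈ S₂, T₂ u = u) →
      TensorProduct.map T₁ T₂ t = t := by
    intro t
    induction t using TensorProduct.induction_on with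
    | zero => exact ⟨∅, ∅, by simp⟩
    | tmul u v => exact ⟨{u}, {v}, by simp +contextual⟩
    | add s t hs ht =>
      obtain ⟨A₁, A₂, hA⟩ := hs
      obtain ⟨B₁, B₂, hB⟩ := ht
      refine ⟨A₁ ∪ B₁, A₂ ∪ B₂, fun T₁ T₂ h₁ h₂ => ?_⟩
      rw [map_add, hA T₁ T₂ (fun u hu => h₁ u (by simp [hu])) (fun u hu => h₂ u (by simp [hu])),
        hB T₁ T₂ (fun u hu => h₁ u (by simp [hu])) (fun u hu => h₂ u (by simp [hu]))]
  choose S₁ S₂ h using one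
  obtain ⟨T₁, hT₁, h₁⟩ := hM (S.biUnion S₁)
  obtain ⟨T₂, hT₂, h₂⟩ := hN (S.biUnion S₂)
  refine ⟨_, map_mem_finiteRank hT₁ hT₂, fun t ht => h t T₁ T₂ (fun u hu => h₁ u ?_)
    (fun u hu => h₂ u ?_)⟩
  · exact Finset.mem_biUnion.2 ⟨t, ht, hu⟩
  · exact Finset.mem_biUnion.2 ⟨t, ht, hu⟩

end FiniteRank

namespace Envelope

variable {R L : Type*} [CommRing R] [Algebra ℝ R] [AddCommGroup L] [Module R L]
  {A : LieRinehart R L} (r : Retraction A) (B : DualSystem R L)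

include r B in
lemma exists_finiteRank_fil (k : ℕ) :
    ∃ T ∈ finiteRank R (Envelope A) (Envelope A), ∀ u ∈ fil A k, T u = u := by
  induction k with
  | zero => exact ⟨0, zero_mem _, fun u hu => by rw [fil, Submodule.mem_bot] at hu; simp [hu]⟩
  | succ k ih =>
    obtain ⟨T, hT, hTu⟩ := ih
    rcases Nat.eq_zero_or_pos k with rfl | hk
    · refine ⟨_, smulRight_mem_finiteRank (counitₗ A) 1, fun u hu => ?_⟩
      refine fil_induction (p := fun u => (counitₗ A).smulRight 1 u = u) ?_ ?_ ?_ ?_ ?_ hu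
      · simp [counit_one]
      · exact map_zero _
      · intro u v hu hv; rw [map_add, hu, hv]
      · intro f u hu; rw [map_smul, hu]
      · intro X v hv
        rw [fil, Submodule.mem_bot] at hv
        rw [hv, mul_zero, map_zero]
    · -- the Euler operator factors through elements of lower order, and so does `u - E(u) / k`
      set c : R := algebraMap ℝ R (k : ℝ)⁻¹ with hc
      have hck (u : Envelope A) : c • (k : ℝ) • u = u := by
        rw [hc, algebraMap_smul, smul_smul, inv_mul_cancel₀ (by positivity), one_smul]
      refine ⟨T ∘ₗ (LinearMap.id - c • euler r B) + c • ∑ i, mulRight A (ofSec A (B.sec i)) ∘ₗ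
          (T ∘ₗ contr A (r.functional B i)), add_mem (mem_finiteRank_comp _ hT)
          (Submodule.smul_mem _ _ (sum_mem fun i _ =>
            comp_mem_finiteRank _ (mem_finiteRank_comp _ hT))), fun u hu => ?_⟩
      have h₁ : u - c • euler r B u ∈ fil A k := by
        have h := Submodule.smul_mem _ (-c) (euler_sub_mem_fil r B hu)
        rwa [neg_smul, smul_sub, hck, neg_sub] at h
      have h₂ := fun i => hTu _ (contr_mem_fil (r.functional_one B i) hu)
      simp only [LinearMap.add_apply, LinearMap.comp_apply, LinearMap.sub_apply,
        LinearMap.smul_apply, LinearMap.id_apply, LinearMap.sum_apply, hTu _ h₁, mulRight_apply,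
        h₂, ← euler_apply]
      abel

include r B in
lemma locallyFiniteRank : LocallyFiniteRank R (Envelope A) := by
  intro S
  choose k hk using exists_mem_fil A
  obtain ⟨T, hT, h⟩ := exists_finiteRank_fil r B (S.sup k)
  exact ⟨T, hT, fun u hu => h u (fil_mono A (Finset.le_sup hu) (hk u))⟩

/-! ### Two-cocycles of the enveloping coalgebra -/

section Contraction

variable {M : Type*} [AddCommGroup M] [Module R M]

/-- Contraction of the first factor with a functional. -/
def contrFst (φ : Envelope A →ₗ[R] R) : Envelope A ⊗[R] M →ₗ[R] M :=
  (TensorProduct.lid R M).toLinearMap ∘ₗ φ.rTensor M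

/-- Contraction of the last factor with a functional. -/
def contrSnd (φ : Envelope A →ₗ[R] R) : M ⊗[R] Envelope A →ₗ[R] M :=
  (TensorProduct.rid R M).toLinearMap ∘ₗ φ.lTensor M

@[simp] lemma contrFst_tmul (φ : Envelope A →ₗ[R] R) (u : Envelope A) (m : M) :
    contrFst φ (u ⊗ₜ m) = φ u • m := by simp [contrFst]

@[simp] lemma contrSnd_tmul (φ : Envelope A →ₗ[R] R) (u : Envelope A) (m : M) :
    contrSnd φ (m ⊗ₜ u) = φ u • m := by simp [contrSnd]

end Contraction

lemma contrFst_comul (φ : Envelope A →ₗ[R] R) (u : Envelope A) :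
    contrFst φ (comul A u) = contr A φ u := rfl

lemma contrSnd_eq (φ : Envelope A →ₗ[R] R) (t : Envelope A ⊗[R] Envelope A) :
    contrSnd φ t = contrFst φ (TensorProduct.comm R _ _ t) := by
  induction t using TensorProduct.induction_on with
  | zero => simp
  | tmul u v => simp
  | add s t hs ht => simp only [map_add, hs, ht]

lemma contrSnd_comul (φ : Envelope A →ₗ[R] R) (u : Envelope A) :
    contrSnd φ (comul A u) = contr A φ u := by
  rw [contrSnd_eq, comm_comul, contrFst_comul]

variable (A) in
/-- The map `Δ ⊗ id` on `UA ⊗ UA`. -/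
def comulL : Envelope A ⊗[R] Envelope A →ₗ[R] Envelope A ⊗[R] (Envelope A ⊗[R] Envelope A) :=
  (TensorProduct.assoc R _ _ _).toLinearMap ∘ₗ (comulₗ A).rTensor _

variable (A) in
/-- The map `id ⊗ Δ` on `UA ⊗ UA`. -/
def comulR : Envelope A ⊗[R] Envelope A →ₗ[R] Envelope A ⊗[R] (Envelope A ⊗[R] Envelope A) :=
  (comulₗ A).lTensor _

lemma comulL_tmul (u v : Envelope A) :
    comulL A (u ⊗ₜ v) = TensorProduct.assoc R _ _ _ (comul A u ⊗ₜ[R] v) := by simp [comulL]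

lemma comulR_tmul (u v : Envelope A) : comulR A (u ⊗ₜ v) = u ⊗ₜ[R] comul A v := by simp [comulR]

/-- The cocycle condition `y ⊗ 1 + (Δ ⊗ id) y = 1 ⊗ y + (id ⊗ Δ) y`. -/
def IsCocycle (y : Envelope A ⊗[R] Envelope A) : Prop :=
  TensorProduct.assoc R _ _ _ (y ⊗ₜ[R] (1 : Envelope A)) + comulL A y
    = (1 : Envelope A) ⊗ₜ[R] y + comulR A y

lemma contrFst_assoc (φ : Envelope A →ₗ[R] R) (t : Envelope A ⊗[R] Envelope A)
    (v : Envelope A) :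
    contrFst φ (TensorProduct.assoc R _ _ _ (t ⊗ₜ[R] v)) = contrFst φ t ⊗ₜ[R] v := by
  induction t using TensorProduct.induction_on with
  | zero => simp
  | tmul u w => simp [TensorProduct.smul_tmul']
  | add s t hs ht => simp only [TensorProduct.add_tmul, map_add, hs, ht]

lemma contrMid_assoc (φ : Envelope A →ₗ[R] R) (t : Envelope A ⊗[R] Envelope A)
    (v : Envelope A) :
    (contrFst φ).lTensor _ (TensorProduct.assoc R _ _ _ (t ⊗ₜ[R] v)) = contrSnd φ t ⊗ₜ[R] v := by
  induction t using TensorProduct.induction_on with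
  | zero => simp
  | tmul u w => simp [TensorProduct.smul_tmul']
  | add s t hs ht => simp only [TensorProduct.add_tmul, map_add, hs, ht]

lemma contrLast_assoc (φ : Envelope A →ₗ[R] R) (t : Envelope A ⊗[R] Envelope A)
    (v : Envelope A) :
    (contrSnd φ).lTensor _ (TensorProduct.assoc R _ _ _ (t ⊗ₜ[R] v)) = φ v • t := by
  induction t using TensorProduct.induction_on with
  | zero => simp
  | tmul u w => simp
  | add s t hs ht => simp only [TensorProduct.add_tmul, map_add, hs, ht, smul_add]

lemma contrFst_comulL (φ : Envelope A →ₗ[R] R) (t : Envelope A ⊗[R] Envelope A) :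
    contrFst φ (comulL A t) = (contr A φ).rTensor _ t := by
  induction t using TensorProduct.induction_on with
  | zero => simp
  | tmul u v => simp [comulL_tmul, contrFst_assoc, contrFst_comul]
  | add s t hs ht => simp only [map_add, hs, ht]

lemma contrFst_comulR (φ : Envelope A →ₗ[R] R) (t : Envelope A ⊗[R] Envelope A) :
    contrFst φ (comulR A t) = comul A (contrFst φ t) := by
  induction t using TensorProduct.induction_on with
  | zero => simp [← comulₗ_apply]
  | tmul u v => simp [comulR_tmul, comul_smul]
  | add s t hs ht => simp only [map_add, hs, ht, comul_add]

lemma contrMid_comulL (φ : Envelope A →ₗ[R] R) (t : Envelope A ⊗[R] Envelope A) :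
    (contrFst φ).lTensor _ (comulL A t) = (contr A φ).rTensor _ t := by
  induction t using TensorProduct.induction_on with
  | zero => simp
  | tmul u v => simp [comulL_tmul, contrMid_assoc, contrSnd_comul]
  | add s t hs ht => simp only [map_add, hs, ht]

lemma contrMid_comulR (φ : Envelope A →ₗ[R] R) (t : Envelope A ⊗[R] Envelope A) :
    (contrFst φ).lTensor _ (comulR A t) = (contr A φ).lTensor _ t := by
  induction t using TensorProduct.induction_on with
  | zero => simp
  | tmul u v => simp [comulR_tmul, contrFst_comul]
  | add s t hs ht => simp only [map_add, hs, ht]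

lemma contrLast_comulL (φ : Envelope A →ₗ[R] R) (t : Envelope A ⊗[R] Envelope A) :
    (contrSnd φ).lTensor _ (comulL A t) = comul A (contrSnd φ t) := by
  induction t using TensorProduct.induction_on with
  | zero => simp [← comulₗ_apply]
  | tmul u v => simp [comulL_tmul, contrLast_assoc, comul_smul]
  | add s t hs ht => simp only [map_add, hs, ht, comul_add]

lemma contrLast_comulR (φ : Envelope A →ₗ[R] R) (t : Envelope A ⊗[R] Envelope A) :
    (contrSnd φ).lTensor _ (comulR A t) = (contr A φ).lTensor _ t := by
  induction t using TensorProduct.induction_on with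
  | zero => simp
  | tmul u v => simp [comulR_tmul, contrSnd_comul]
  | add s t hs ht => simp only [map_add, hs, ht]

lemma comm_lTensor_contr (φ : Envelope A →ₗ[R] R) (t : Envelope A ⊗[R] Envelope A) :
    TensorProduct.comm R _ _ ((contr A φ).lTensor _ t)
      = (contr A φ).rTensor _ (TensorProduct.comm R _ _ t) := by
  induction t using TensorProduct.induction_on with
  | zero => simp
  | tmul u v => simp
  | add s t hs ht => simp only [map_add, hs, ht]

variable {y : Envelope A ⊗[R] Envelope A}

lemma IsCocycle.contr_fst (hy : IsCocycle y) (φ : Envelope A →ₗ[R] R) :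
    contrFst φ y ⊗ₜ[R] 1 + (contr A φ).rTensor _ y = φ 1 • y + comul A (contrFst φ y) := by
  have h := congrArg (contrFst φ) hy
  rwa [map_add, map_add, contrFst_assoc, contrFst_comulL, contrFst_comulR, contrFst_tmul] at h

lemma IsCocycle.contr_mid (hy : IsCocycle y) (φ : Envelope A →ₗ[R] R) :
    contrSnd φ y ⊗ₜ[R] 1 + (contr A φ).rTensor _ y
      = 1 ⊗ₜ[R] contrFst φ y + (contr A φ).lTensor _ y := by
  have h := congrArg ((contrFst φ).lTensor _) hy
  rwa [map_add, map_add, contrMid_assoc, contrMid_comulL, contrMid_comulR,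
    LinearMap.lTensor_tmul] at h

lemma IsCocycle.contr_last (hy : IsCocycle y) (φ : Envelope A →ₗ[R] R) :
    φ 1 • y + comul A (contrSnd φ y) = 1 ⊗ₜ[R] contrSnd φ y + (contr A φ).lTensor _ y := by
  have h := congrArg ((contrSnd φ).lTensor _) hy
  rwa [map_add, map_add, contrLast_assoc, contrLast_comulL, contrLast_comulR,
    LinearMap.lTensor_tmul] at h

/-- The skew-symmetrization of a cocycle satisfies `(Δ ⊗ id) s = s₁₃ + s₂₃`, contracted with
a functional in the first factor. -/
lemma IsCocycle.contr_skew (hy : IsCocycle y) {φ : Envelope A →ₗ[R] R} (hφ : φ 1 = 0) :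
    (contr A φ).rTensor _ (y - TensorProduct.comm R _ _ y)
      = 1 ⊗ₜ[R] contrFst φ (y - TensorProduct.comm R _ _ y) := by
  have hb := hy.contr_mid φ
  have hc := hy.contr_last φ
  have hc' := congrArg (TensorProduct.comm R (Envelope A) (Envelope A)) hc
  rw [map_add, map_add, comm_lTensor_contr, comm_comul, TensorProduct.comm_tmul, hφ, zero_smul,
    map_zero, zero_add] at hc'
  rw [hφ, zero_smul, zero_add] at hc
  rw [map_sub, map_sub, ← contrSnd_eq, TensorProduct.tmul_sub, eq_sub_of_add_eq' hb,
    eq_sub_of_add_eq' hc'.symm, eq_sub_of_add_eq' hc.symm]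
  abel

lemma contr_counitₗ : contr A (counitₗ A) = LinearMap.id := LinearMap.ext (contr_counit A)

lemma contrFst_counit_comul (u : Envelope A) : contrFst (counitₗ A) (comul A u) = u :=
  contr_counit A u

lemma IsCocycle.counit_skew (hy : IsCocycle y) :
    contrFst (counitₗ A) (y - TensorProduct.comm R _ _ y) = 0 := by
  have ha := hy.contr_fst (counitₗ A)
  have hc := hy.contr_last (counitₗ A)
  rw [contr_counitₗ, LinearMap.rTensor_id, LinearMap.id_apply, counitₗ_apply, counit_one,
    one_smul, add_comm, add_right_inj] at ha
  rw [contr_counitₗ, LinearMap.lTensor_id, LinearMap.id_apply, counitₗ_apply, counit_one,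
    one_smul, add_comm, add_left_inj] at hc
  have ha' := congrArg (contrFst (counitₗ A)) ha
  have hc' := congrArg (contrSnd (counitₗ A)) hc
  rw [contrFst_tmul, contrFst_counit_comul] at ha'
  rw [contrSnd_tmul, contrSnd_comul, contr_counit] at hc'
  have h : ∀ t : Envelope A ⊗[R] Envelope A,
      counit A (contrFst (counitₗ A) t) = counit A (contrSnd (counitₗ A) t) := by
    intro t
    induction t using TensorProduct.induction_on with
    | zero => simp
    | tmul u v => simp [counit_smul, mul_comm]
    | add s t hs ht => simp only [map_add, counit_add, hs, ht]
  rw [map_sub, ← contrSnd_eq, ← ha', hc', sub_eq_zero]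
  rw [counitₗ_apply, counitₗ_apply, h]

lemma exists_inv_smul (R : Type*) [CommRing R] [Algebra ℝ R] (k : ℕ) (hk : k ≠ 0) :
    ∃ c : R, c * k = 1 :=
  ⟨algebraMap ℝ R (k : ℝ)⁻¹, by
    rw [← map_natCast (algebraMap ℝ R), ← map_mul, inv_mul_cancel₀ (by exact_mod_cast hk),
      map_one]⟩

lemma mem_of_nsmul_mem {M : Type*} [AddCommGroup M] [Module R M] (p : Submodule R M) {k : ℕ}
    (hk : k ≠ 0) {m : M} (h : k • m ∈ p) : m ∈ p := by
  obtain ⟨c, hc⟩ := exists_inv_smul R k hk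
  have : m = c • k • m := by rw [← Nat.cast_smul_eq_nsmul R, smul_smul, hc, one_smul]
  rw [this]
  exact p.smul_mem c h

variable (A) in
/-- The filtration of `UA ⊗ UA` by the order of the first factor. -/
def filFst (k : ℕ) : Submodule R (Envelope A ⊗[R] Envelope A) :=
  Submodule.span R {t | ∃ u ∈ fil A k, ∃ v, t = u ⊗ₜ v}

lemma filFst_mono : Monotone (filFst A) := fun _ _ h =>
  Submodule.span_mono fun _ ⟨u, hu, v, ht⟩ => ⟨u, fil_mono A h hu, v, ht⟩

lemma exists_mem_filFst (t : Envelope A ⊗[R] Envelope A) : ∃ k, t ∈ filFst A k := by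
  induction t using TensorProduct.induction_on with
  | zero => exact ⟨0, zero_mem _⟩
  | tmul u v =>
    obtain ⟨k, hk⟩ := exists_mem_fil A u
    exact ⟨k, Submodule.subset_span ⟨u, hk, v, rfl⟩⟩
  | add s t hs ht =>
    obtain ⟨k, hk⟩ := hs
    obtain ⟨l, hl⟩ := ht
    exact ⟨max k l, add_mem (filFst_mono (le_max_left _ _) hk)
      (filFst_mono (le_max_right _ _) hl)⟩

lemma euler_rTensor_sub_mem {k : ℕ} {t : Envelope A ⊗[R] Envelope A}
    (ht : t ∈ filFst A (k + 1)) : (euler r B).rTensor _ t - k • t ∈ filFst A k := by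
  induction ht using Submodule.span_induction with
  | mem x hx =>
    obtain ⟨u, hu, v, rfl⟩ := hx
    refine Submodule.subset_span ⟨_, euler_sub_mem_fil r B hu, v, ?_⟩
    rw [TensorProduct.sub_tmul, Nat.cast_smul_eq_nsmul, LinearMap.rTensor_tmul,
      TensorProduct.smul_tmul']
  | zero => simp
  | add x y _ _ hx hy => rw [map_add, smul_add, add_sub_add_comm]; exact add_mem hx hy
  | smul f x _ hx => 
    convert Submodule.smul_mem _ f hx using 1
    simp only [map_smul, smul_sub, smul_comm k]

lemma sum_ofSec_tmul_contrFst (t : Envelope A ⊗[R] Envelope A) :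
    ∑ i, ofSec A (B.sec i) ⊗ₜ[R] contrFst (r.functional B i) t
      = (ofSec A ∘ₗ r.proj).rTensor _ t := by
  induction t using TensorProduct.induction_on with
  | zero => simp
  | tmul u v =>
    simp only [contrFst_tmul, ← TensorProduct.smul_tmul, ← TensorProduct.sum_tmul,
      LinearMap.rTensor_tmul, LinearMap.comp_apply, Retraction.functional, ← map_smul, ← map_sum,
      B.sum_eq]
  | add s t hs ht =>
    simp only [map_add, TensorProduct.tmul_add, Finset.sum_add_distrib, hs, ht]

lemma rTensor_ofSec_mem_filFst (f : Envelope A →ₗ[R] L) (t : Envelope A ⊗[R] Envelope A) :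
    (ofSec A ∘ₗ f).rTensor _ t ∈ filFst A 2 := by
  induction t using TensorProduct.induction_on with
  | zero => simp
  | tmul u v =>
    refine Submodule.subset_span ⟨ofSec A (f u), ?_, v, by simp⟩
    simpa using sec_mul_mem_fil (f u) (one_mem_fil A 0)
  | add s t hs ht => rw [map_add]; exact add_mem hs ht

lemma euler_rTensor (t : Envelope A ⊗[R] Envelope A) :
    (euler r B).rTensor (Envelope A) t = ∑ i, (mulRight A (ofSec A (B.sec i))).rTensor _
      ((contr A (r.functional B i)).rTensor _ t) := by
  rw [euler, ← LinearMap.coe_rTensorHom, map_sum, LinearMap.sum_apply]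
  simp only [LinearMap.coe_rTensorHom, LinearMap.rTensor_comp, LinearMap.comp_apply]

lemma euler_lTensor (t : Envelope A ⊗[R] Envelope A) :
    (euler r B).lTensor (Envelope A) t = ∑ i, (mulRight A (ofSec A (B.sec i))).lTensor _
      ((contr A (r.functional B i)).lTensor _ t) := by
  rw [euler, ← LinearMap.coe_lTensorHom, map_sum, LinearMap.sum_apply]
  simp only [LinearMap.coe_lTensorHom, LinearMap.lTensor_comp, LinearMap.comp_apply]

include B in
/-- The skew-symmetrization of a cocycle is a bivector. -/
theorem IsCocycle.skew_eq (hy : IsCocycle y) :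
    TensorProduct.map (ofSec A ∘ₗ r.proj) (ofSec A ∘ₗ r.proj) (y - TensorProduct.comm R _ _ y)
      = y - TensorProduct.comm R _ _ y := by
  set s := y - TensorProduct.comm R _ _ y with hs
  have hE : (euler r B).rTensor _ s = (ofSec A ∘ₗ r.proj).rTensor _ s := by
    rw [← sum_ofSec_tmul_contrFst r B]
    simp only [euler_rTensor, hs, hy.contr_skew (r.functional_one B _), LinearMap.rTensor_tmul,
      mulRight_apply, one_mul]
  have key : ∀ k, s ∈ filFst A (k + 2) → s ∈ filFst A 2 := by
    intro k
    induction k with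
    | zero => exact id
    | succ k ih =>
      intro h
      refine ih (mem_of_nsmul_mem _ (k + 1).succ_ne_zero ?_)
      have h₁ := euler_rTensor_sub_mem r B h
      rw [hE] at h₁
      simpa using sub_mem (filFst_mono (by omega) (rTensor_ofSec_mem_filFst r.proj s)) h₁
  obtain ⟨k, hk⟩ := exists_mem_filFst s
  have h₁ := euler_rTensor_sub_mem r B (key k (filFst_mono (by omega) hk))
  rw [hE, one_nsmul] at h₁
  have h₀ : ∃ v : Envelope A, (ofSec A ∘ₗ r.proj).rTensor _ s - s = 1 ⊗ₜ v := by
    refine Submodule.span_induction (p := fun t _ => ∃ v : Envelope A, t = 1 ⊗ₜ[R] v) ?_ ?_ ?_ ?_ h₁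
    · rintro _ ⟨u, hu, v, rfl⟩
      refine fil_induction (p := fun u => ∃ w : Envelope A, u ⊗ₜ[R] v = 1 ⊗ₜ[R] w)
        ⟨v, rfl⟩ ⟨0, by simp⟩ ?_ ?_ ?_ hu
      · rintro u u' ⟨w, hw⟩ ⟨w', hw'⟩
        exact ⟨w + w', by rw [TensorProduct.add_tmul, hw, hw', TensorProduct.tmul_add]⟩
      · rintro f u ⟨w, hw⟩
        exact ⟨f • w, by rw [← TensorProduct.smul_tmul', hw, TensorProduct.tmul_smul]⟩
      · intro X w hw
        rw [fil, Submodule.mem_bot] at hw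
        exact ⟨0, by simp [hw]⟩
    · exact ⟨0, by simp⟩
    · rintro _ _ _ _ ⟨v, rfl⟩ ⟨w, rfl⟩
      exact ⟨v + w, by rw [TensorProduct.tmul_add]⟩
    · rintro f _ _ ⟨v, rfl⟩
      exact ⟨f • v, by rw [TensorProduct.tmul_smul]⟩
  obtain ⟨v, hv⟩ := h₀
  have hε : ∀ t : Envelope A ⊗[R] Envelope A,
      contrFst (counitₗ A) ((ofSec A ∘ₗ r.proj).rTensor _ t) = 0 := by
    intro t
    induction t using TensorProduct.induction_on with
    | zero => simp
    | tmul u v => simp [counit_ofSec]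
    | add s t hs ht => rw [map_add, map_add, hs, ht, add_zero]
  have hv₀ : v = 0 := by
    have h := congrArg (contrFst (counitₗ A)) hv
    rw [map_sub, hε, hs, hy.counit_skew, contrFst_tmul, counitₗ_apply, counit_one, one_smul,
      sub_zero] at h
    exact h.symm
  have hl : (ofSec A ∘ₗ r.proj).rTensor _ s = s := by
    rw [← sub_eq_zero, hv, hv₀, TensorProduct.tmul_zero]
  have hskew : TensorProduct.comm R _ _ s = -s := by
    rw [hs, map_sub, neg_sub, TensorProduct.comm_comm]
  have hcomm : ∀ t : Envelope A ⊗[R] Envelope A,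
      (ofSec A ∘ₗ r.proj).lTensor _ (TensorProduct.comm R _ _ t)
        = TensorProduct.comm R _ _ ((ofSec A ∘ₗ r.proj).rTensor _ t) := by
    intro t
    induction t using TensorProduct.induction_on with
    | zero => simp
    | tmul u v => simp
    | add s t hs ht => simp only [map_add, hs, ht]
  have hr : (ofSec A ∘ₗ r.proj).lTensor _ s = s := by
    have h := hcomm s
    rwa [hl, hskew, map_neg, neg_inj] at h
  rw [← LinearMap.lTensor_comp_rTensor, LinearMap.comp_apply, hl, hr]

variable (A) in
/-- The filtration of `UA ⊗ UA` by the total order. -/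
def filTot (k : ℕ) : Submodule R (Envelope A ⊗[R] Envelope A) :=
  Submodule.span R {t | ∃ a b, a + b < k ∧ ∃ u ∈ fil A (a + 1), ∃ v ∈ fil A (b + 1), t = u ⊗ₜ v}

lemma filTot_mono : Monotone (filTot A) := fun _ _ h =>
  Submodule.span_mono fun _ ⟨a, b, hab, ht⟩ => ⟨a, b, by omega, ht⟩

lemma exists_mem_filTot (t : Envelope A ⊗[R] Envelope A) : ∃ k, t ∈ filTot A k := by
  induction t using TensorProduct.induction_on with
  | zero => exact ⟨0, zero_mem _⟩
  | tmul u v =>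
    obtain ⟨k, hk⟩ := exists_mem_fil A u
    obtain ⟨l, hl⟩ := exists_mem_fil A v
    exact ⟨k + l + 1, Submodule.subset_span ⟨k, l, by omega, u, fil_le_succ A k hk, v,
      fil_le_succ A l hl, rfl⟩⟩
  | add s t hs ht =>
    obtain ⟨k, hk⟩ := hs
    obtain ⟨l, hl⟩ := ht
    exact ⟨max k l, add_mem (filTot_mono (le_max_left _ _) hk)
      (filTot_mono (le_max_right _ _) hl)⟩

lemma tmul_mem_filTot_of_left {a b : ℕ} {u v : Envelope A} (hu : u ∈ fil A a)
    (hv : v ∈ fil A (b + 1)) : u ⊗ₜ[R] v ∈ filTot A (a + b) := by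
  rcases a with _ | a
  · rw [fil, Submodule.mem_bot] at hu; simp [hu]
  · exact Submodule.subset_span ⟨a, b, by omega, u, hu, v, hv, rfl⟩

lemma tmul_mem_filTot_of_right {a b : ℕ} {u v : Envelope A} (hu : u ∈ fil A (a + 1))
    (hv : v ∈ fil A b) : u ⊗ₜ[R] v ∈ filTot A (a + b) := by
  rcases b with _ | b
  · rw [fil, Submodule.mem_bot] at hv; simp [hv]
  · exact Submodule.subset_span ⟨a, b, by omega, u, hu, v, hv, rfl⟩

lemma euler_add_sub_mem {k : ℕ} {t : Envelope A ⊗[R] Envelope A} (ht : t ∈ filTot A (k + 1)) :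
    (euler r B).rTensor _ t + (euler r B).lTensor _ t - k • t ∈ filTot A k := by
  induction ht using Submodule.span_induction with
  | mem x hx =>
    obtain ⟨a, b, hab, u, hu, v, hv, rfl⟩ := hx
    have h₁ := tmul_mem_filTot_of_left (euler_sub_mem_fil r B hu) hv
    have h₂ := tmul_mem_filTot_of_right hu (euler_sub_mem_fil r B hv)
    have h₃ := filTot_mono (A := A) (show a + b ≤ k by omega) (add_mem h₁ h₂)
    have h₄ : (k - (a + b)) • (u ⊗ₜ[R] v : Envelope A ⊗[R] Envelope A) ∈ filTot A k := by
      rcases (show a + b ≤ k by omega).eq_or_lt with h | h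
      · simp [h]
      · refine Submodule.smul_of_tower_mem _ _ (Submodule.subset_span ⟨a, b, h, u, hu, v, hv, rfl⟩)
    convert sub_mem h₃ h₄ using 1
    have hk : k • (u ⊗ₜ[R] v : Envelope A ⊗[R] Envelope A)
        = (k - (a + b)) • (u ⊗ₜ[R] v) + (a • (u ⊗ₜ[R] v) + b • (u ⊗ₜ[R] v)) := by
      rw [← add_smul, ← add_smul]; congr 1; omega
    rw [hk, TensorProduct.sub_tmul, TensorProduct.tmul_sub, Nat.cast_smul_eq_nsmul,
      Nat.cast_smul_eq_nsmul, LinearMap.rTensor_tmul, LinearMap.lTensor_tmul,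
      ← TensorProduct.smul_tmul', TensorProduct.tmul_smul]
    abel
  | zero => simp
  | add x y _ _ hx hy =>
    convert add_mem hx hy using 1
    simp only [map_add, smul_add]; abel
  | smul f x _ hx =>
    convert Submodule.smul_mem _ f hx using 1
    simp only [map_smul, smul_add, smul_sub, smul_comm k]

lemma comul_mul_sec (u : Envelope A) (X : L) :
    comul A (u * ofSec A X) = (mulRight A (ofSec A X)).rTensor _ (comul A u)
      + (mulRight A (ofSec A X)).lTensor _ (comul A u) := by
  induction u using induction_left with
  | one => simp [comul_one, comul_ofSec]
  | add u v hu hv => rw [add_mul, comul_add, comul_add, hu, hv, map_add, map_add]; abel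
  | smul f u hu => rw [fun_smul_mul, comul_smul, comul_smul, hu, map_smul, map_smul, smul_add]
  | sec Y u hu =>
    rw [mul_assoc, comul_sec_mul, comul_sec_mul, hu, map_add]
    congr 1
    all_goals
      induction comul A u using TensorProduct.induction_on with
      | zero => simp
      | tmul v w => simp [mul_assoc]
      | add s t hs ht => simp only [map_add, hs, ht]

variable (A) in
/-- The coboundary `u ↦ Δ u - u ⊗ 1 - 1 ⊗ u`. -/
def cobound : Envelope A →ₗ[R] Envelope A ⊗[R] Envelope A :=
  comulₗ A - (TensorProduct.mk R _ _).flip 1 - TensorProduct.mk R _ _ 1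

lemma cobound_apply (u : Envelope A) :
    cobound A u = comul A u - u ⊗ₜ[R] 1 - 1 ⊗ₜ[R] u := rfl

lemma comm_cobound (u : Envelope A) : TensorProduct.comm R _ _ (cobound A u) = cobound A u := by
  simp only [cobound_apply, map_sub, comm_comul, TensorProduct.comm_tmul]
  abel

lemma isCocycle_cobound (h : ∀ u, comulL A (comul A u) = comulR A (comul A u)) (u : Envelope A) :
    IsCocycle (cobound A u) := by
  simp only [IsCocycle, cobound_apply, TensorProduct.sub_tmul, TensorProduct.tmul_sub, map_sub, h,
    comulL_tmul, comulR_tmul, TensorProduct.assoc_tmul, comul_one]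
  abel

lemma IsCocycle.sub {y z : Envelope A ⊗[R] Envelope A} (hy : IsCocycle y) (hz : IsCocycle z) :
    IsCocycle (y - z) := by
  simp only [IsCocycle, TensorProduct.sub_tmul, TensorProduct.tmul_sub, map_sub] at hy hz ⊢
  rw [sub_add_sub_comm, hy, hz]
  abel

lemma IsCocycle.smul {y : Envelope A ⊗[R] Envelope A} (hy : IsCocycle y) (c : R) :
    IsCocycle (c • y) := by
  simp only [IsCocycle, TensorProduct.tmul_smul, ← TensorProduct.smul_tmul', map_smul] at hy ⊢
  rw [← smul_add, hy, smul_add]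

/-- The homotopy `y ↦ ∑ (φᵢ ⊗ id)(y) sᵢ`. -/
def homotopy : Envelope A ⊗[R] Envelope A →ₗ[R] Envelope A :=
  ∑ i, mulRight A (ofSec A (B.sec i)) ∘ₗ contrFst (r.functional B i)

lemma IsCocycle.cobound_homotopy (hy : IsCocycle y) (hs : TensorProduct.comm R _ _ y = y) :
    cobound A (homotopy r B y) = (euler r B).rTensor _ y + (euler r B).lTensor _ y := by
  simp only [homotopy, euler_rTensor, euler_lTensor, LinearMap.sum_apply, LinearMap.comp_apply,
    map_sum, ← Finset.sum_add_distrib]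
  refine Finset.sum_congr rfl fun i _ => ?_
  have ha := hy.contr_fst (r.functional B i)
  have hb := hy.contr_mid (r.functional B i)
  rw [r.functional_one, zero_smul, zero_add] at ha
  rw [contrSnd_eq, hs] at hb
  rw [mulRight_apply, cobound_apply, comul_mul_sec, ← ha, map_add]
  conv_lhs => enter [1, 1, 2]; rw [eq_sub_of_add_eq' hb]
  simp only [map_sub, map_add]
  simp only [LinearMap.rTensor_tmul, LinearMap.lTensor_tmul, mulRight_apply]
  abel

include r B in
/-- In characteristic zero a symmetric cocycle of the enveloping coalgebra is a coboundary. -/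
theorem IsCocycle.exists_cobound (h : ∀ u, comulL A (comul A u) = comulR A (comul A u))
    (hy : IsCocycle y) (hs : TensorProduct.comm R _ _ y = y) : ∃ u, cobound A u = y := by
  obtain ⟨k, hk⟩ := exists_mem_filTot y
  induction k generalizing y with
  | zero =>
    refine ⟨0, ?_⟩
    have : filTot A 0 = ⊥ := by
      rw [filTot, Submodule.span_eq_bot]
      rintro _ ⟨a, b, hab, -⟩
      omega
    rw [this, Submodule.mem_bot] at hk
    rw [hk, map_zero]
  | succ k ih =>
    rcases Nat.eq_zero_or_pos k with rfl | hk₀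
    · have : ∃ c : R, y = c • (1 ⊗ₜ[R] 1 : Envelope A ⊗[R] Envelope A) := by
        refine Submodule.span_induction
          (p := fun t _ => ∃ c : R, t = c • (1 ⊗ₜ[R] 1 : Envelope A ⊗[R] Envelope A))
          ?_ ⟨0, by simp⟩ ?_ ?_ hk
        · rintro _ ⟨a, b, hab, u, hu, v, hv, rfl⟩
          obtain ⟨rfl, rfl⟩ : a = 0 ∧ b = 0 := by omega
          have aux : ∀ w ∈ fil A 1, ∃ c : R, w = c • 1 := by
            intro w hw
            refine fil_induction (p := fun w => ∃ c : R, w = c • (1 : Envelope A)) ⟨1, by simp⟩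
              ⟨0, by simp⟩ ?_ ?_ ?_ hw
            · rintro _ _ ⟨c, rfl⟩ ⟨d, rfl⟩; exact ⟨c + d, by rw [add_smul]⟩
            · rintro f _ ⟨c, rfl⟩; exact ⟨f * c, by rw [mul_smul]⟩
            · intro X v hv; rw [fil, Submodule.mem_bot] at hv; exact ⟨0, by simp [hv]⟩
          obtain ⟨c, rfl⟩ := aux u hu
          obtain ⟨d, rfl⟩ := aux v hv
          exact ⟨c * d, TensorProduct.smul_tmul_smul _ _ _ _⟩
        · rintro _ _ _ _ ⟨c, rfl⟩ ⟨d, rfl⟩; exact ⟨c + d, by rw [add_smul]⟩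
        · rintro f _ _ ⟨c, rfl⟩; exact ⟨f * c, by rw [mul_smul]⟩
      obtain ⟨c, rfl⟩ := this
      exact ⟨(-c) • 1, by rw [map_smul, cobound_apply, comul_one]; simp⟩
    · obtain ⟨c, hc⟩ := exists_inv_smul R k hk₀.ne'
      have h₁ := Submodule.smul_mem _ (-c) (euler_add_sub_mem r B hk)
      rw [← hy.cobound_homotopy r B hs, neg_smul, smul_sub, neg_sub,
        ← Nat.cast_smul_eq_nsmul R, smul_smul, hc, one_smul] at h₁
      obtain ⟨u, hu⟩ := ih (hy.sub ((isCocycle_cobound h _).smul c))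
        (by rw [map_sub, map_smul, hs, comm_cobound]) h₁
      refine ⟨u + c • homotopy r B y, ?_⟩
      rw [map_add, hu, map_smul]
      abel

end Envelope
end QuantumGroupoids

namespace QuantumGroupoids

/-! ### Modules over `ℝ[[ħ]]` and their reductions modulo `ħ` -/

section Hbar

variable {R : Type*} [CommRing R] [Algebra ℝ R] {M N T S : Type*} [AddCommGroup M] [Module ℝ⟦X⟧ M]
  [AddCommGroup N] [Module ℝ⟦X⟧ N] [AddCommGroup T] [Module R T] [AddCommGroup S] [Module R S]

/-- Multiplication by `ħ` is injective on `M`. -/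
def NoHbarTorsion (M : Type*) [AddCommGroup M] [Module ℝ⟦X⟧ M] : Prop :=
  ∀ m : M, (PowerSeries.X : ℝ⟦X⟧) • m = 0 → m = 0

/-- The map `ev : M → T` identifies `T` with `M / ħ M`. -/
structure IsReduction (ev : M →ₛₗ[evalZero R] T) : Prop where
  surjective : Function.Surjective ev
  exists_smul : ∀ m, ev m = 0 → ∃ m', (PowerSeries.X : ℝ⟦X⟧) • m' = m

lemma evalZero_X : evalZero R PowerSeries.X = 0 := by simp [evalZero]

lemma evalZero_apply (c : ℝ⟦X⟧) :
    evalZero R c = algebraMap ℝ R (PowerSeries.constantCoeff c) := rfl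

@[simp] lemma red_X_smul (ev : M →ₛₗ[evalZero R] T) (m : M) :
    ev ((PowerSeries.X : ℝ⟦X⟧) • m) = 0 := by
  rw [LinearMap.map_smulₛₗ, evalZero_X, zero_smul]

lemma NoHbarTorsion.cancel (hM : NoHbarTorsion M) {m m' : M}
    (h : (PowerSeries.X : ℝ⟦X⟧) • m = (PowerSeries.X : ℝ⟦X⟧) • m') : m = m' := by
  rw [← sub_eq_zero]
  exact hM _ (by rw [smul_sub, h, sub_self])

lemma NoHbarTorsion.isTorsionFree (hM : NoHbarTorsion M) : Module.IsTorsionFree ℝ⟦X⟧ M := by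
  have hpow : ∀ n (m : M), (PowerSeries.X ^ n : ℝ⟦X⟧) • m = 0 → m = 0 := by
    intro n
    induction n with
    | zero => intro m hm; simpa using hm
    | succ n ih => intro m hm; rw [pow_succ', mul_smul] at hm; exact ih m (hM _ hm)
  refine .of_smul_eq_zero fun c m h => ?_
  by_cases hc : c = 0
  · exact Or.inl hc
  · right
    obtain ⟨n, u, rfl⟩ := IsDiscreteValuationRing.eq_unit_mul_pow_irreducible hc
      PowerSeries.X_irreducible
    rw [mul_smul] at h
    have h' := congrArg (fun z => ((u⁻¹ : ℝ⟦X⟧ˣ) : ℝ⟦X⟧) • z) h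
    simp only [smul_zero, smul_smul] at h'
    rw [← mul_assoc, Units.inv_mul, one_mul] at h'
    exact hpow n m h'

lemma NoHbarTorsion.tensor (hM : NoHbarTorsion M) (hN : NoHbarTorsion N) :
    NoHbarTorsion (M ⊗[ℝ⟦X⟧] N) := by
  have := hM.isTorsionFree
  have := hN.isTorsionFree
  intro m hm
  have hf : Module.IsTorsionFree ℝ⟦X⟧ (M ⊗[ℝ⟦X⟧] N) := inferInstance
  exact (smul_eq_zero_iff_right PowerSeries.X_ne_zero).1 hm

/-- Every quotient of `x` by `ħ` computes the limit. -/
lemma NoHbarTorsion.hbarLimit {T : Type*} (hM : NoHbarTorsion M) (ev : M → T) {x y : M}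
    (h : (PowerSeries.X : ℝ⟦X⟧) • y = x) : HbarLimit ev x (ev y) :=
  ⟨⟨y, h⟩, fun y' h' => by rw [hM.cancel (h'.trans h.symm)]⟩

lemma HbarLimit.unique {T : Type*} {ev : M → T} {x : M} {t t' : T} (h : HbarLimit ev x t)
    (h' : HbarLimit ev x t') : t = t' := by
  obtain ⟨y, hy⟩ := h.1
  rw [← h.2 y hy, h'.2 y hy]

lemma mem_hbar_smul_top {m : M} :
    m ∈ (hbarIdeal • ⊤ : Submodule ℝ⟦X⟧ M) ↔ ∃ m', (PowerSeries.X : ℝ⟦X⟧) • m' = m := by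
  simp [hbarIdeal, Submodule.ideal_span_singleton_smul, Submodule.mem_smul_pointwise_iff_exists]

lemma mem_hbar_pow_smul_top {m : M} (n : ℕ) :
    m ∈ (hbarIdeal ^ n • ⊤ : Submodule ℝ⟦X⟧ M)
      ↔ ∃ m', (PowerSeries.X ^ n : ℝ⟦X⟧) • m' = m := by
  simp [hbarIdeal, Ideal.span_singleton_pow, Submodule.ideal_span_singleton_smul,
    Submodule.mem_smul_pointwise_iff_exists]

lemma NoHbarTorsion.completion (hM : NoHbarTorsion M) :
    NoHbarTorsion (AdicCompletion hbarIdeal M) := by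
  intro y hy
  refine AdicCompletion.ext fun n => ?_
  obtain ⟨m, hm⟩ := Submodule.Quotient.mk_surjective _ (y.val (n + 1))
  have h₁ : ((PowerSeries.X : ℝ⟦X⟧) • y).val (n + 1) = 0 := by rw [hy]; rfl
  rw [AdicCompletion.val_smul_apply, ← hm, ← Submodule.Quotient.mk_smul,
    Submodule.Quotient.mk_eq_zero, mem_hbar_pow_smul_top] at h₁
  obtain ⟨m', hm'⟩ := h₁
  rw [pow_succ', mul_smul] at hm'
  have h₂ := hM.cancel hm'
  have h₃ : y.val n = AdicCompletion.transitionMap hbarIdeal M n.le_succ (y.val (n + 1)) :=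
    (y.prop n.le_succ).symm
  rw [h₃, ← hm]
  change Submodule.Quotient.mk m = _
  rw [AdicCompletion.val_zero_apply, Submodule.Quotient.mk_eq_zero, mem_hbar_pow_smul_top]
  exact ⟨m', h₂⟩

lemma completion_eq_of_add (y : AdicCompletion hbarIdeal M) :
    ∃ m y', y = AdicCompletion.of hbarIdeal M m + (PowerSeries.X : ℝ⟦X⟧) • y' := by
  obtain ⟨m, hm⟩ := Submodule.Quotient.mk_surjective _ (y.val 1)
  have h : y - AdicCompletion.of hbarIdeal M m ∈
      (AdicCompletion.eval hbarIdeal M 1).ker := by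
    rw [LinearMap.mem_ker, map_sub, AdicCompletion.eval_of, AdicCompletion.eval_apply, sub_eq_zero]
    exact hm.symm
  rw [← AdicCompletion.pow_smul_top_eq_ker_eval ⟨{PowerSeries.X}, by simp⟩, pow_one,
    mem_hbar_smul_top] at h
  obtain ⟨y', hy'⟩ := h
  exact ⟨m, y', by rw [hy']; abel⟩

/-- A map that reduces `M` modulo `ħ`, extended to the completion of `M`. -/
def completionRed (ev : M →ₛₗ[evalZero R] T) :
    AdicCompletion hbarIdeal M →ₛₗ[evalZero R] T :=
  (Submodule.liftQ _ ev (by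
    rw [pow_one]
    intro x hx
    obtain ⟨m', rfl⟩ := mem_hbar_smul_top.1 hx
    exact red_X_smul ev m')).comp (AdicCompletion.eval hbarIdeal M 1)

lemma IsReduction.of_completion {ev : M →ₛₗ[evalZero R] T} (h : IsReduction ev)
    (f : AdicCompletion hbarIdeal M →ₛₗ[evalZero R] T)
    (hf : ∀ m, f (AdicCompletion.of hbarIdeal M m) = ev m) : IsReduction f where
  surjective t := by
    obtain ⟨m, rfl⟩ := h.surjective t
    exact ⟨_, hf m⟩
  exists_smul y hy := by
    obtain ⟨m, y', rfl⟩ := completion_eq_of_add y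
    rw [map_add, red_X_smul, add_zero, hf] at hy
    obtain ⟨m', rfl⟩ := h.exists_smul m hy
    exact ⟨AdicCompletion.of hbarIdeal M m' + y', by rw [smul_add, map_smul]⟩

/-- Two additive maps out of a completion that kill the multiples of `ħ` agree if they agree on
the uncompleted module. -/
lemma completion_ext {G : Type*} [AddCommGroup G] {f g : AdicCompletion hbarIdeal M →+ G}
    (hf : ∀ y, f ((PowerSeries.X : ℝ⟦X⟧) • y) = 0) (hg : ∀ y, g ((PowerSeries.X : ℝ⟦X⟧) • y) = 0)
    (h : ∀ m, f (AdicCompletion.of hbarIdeal M m) = g (AdicCompletion.of hbarIdeal M m))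
    (y : AdicCompletion hbarIdeal M) : f y = g y := by
  obtain ⟨m, y', rfl⟩ := completion_eq_of_add y
  rw [map_add, map_add, hf, hg, h]

/-- The map `m ⊗ n ↦ ev m ⊗ ev' n`. -/
def redTensor (ev : M →ₛₗ[evalZero R] T) (ev' : N →ₛₗ[evalZero R] S) :
    M ⊗[ℝ⟦X⟧] N →ₛₗ[evalZero R] T ⊗[R] S :=
  TensorProduct.lift (LinearMap.mk₂'ₛₗ (evalZero R) (evalZero R)
    (fun m n => ev m ⊗ₜ[R] ev' n)
    (fun _ _ _ => by simp [TensorProduct.add_tmul])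
    (fun _ _ _ => by simp [TensorProduct.smul_tmul'])
    (fun _ _ _ => by simp [TensorProduct.tmul_add])
    (fun _ _ _ => by simp))

@[simp] lemma redTensor_tmul (ev : M →ₛₗ[evalZero R] T) (ev' : N →ₛₗ[evalZero R] S) (m : M)
    (n : N) : redTensor ev ev' (m ⊗ₜ n) = ev m ⊗ₜ[R] ev' n := rfl

/-- The kernel of `M ⊗ N → T ⊗ S` is generated by the multiples of `ħ` and the balancing
relations (right exactness of the tensor product). -/
lemma mem_of_redTensor_eq_zero {ev : M →ₛₗ[evalZero R] T} {ev' : N →ₛₗ[evalZero R] S}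
    (h : IsReduction ev) (h' : IsReduction ev') (q : AddSubgroup (M ⊗[ℝ⟦X⟧] N))
    (hq : ∀ (a : R) (m m' : M) (n n' : N), ev m' = a • ev m → ev' n' = a • ev' n →
      m' ⊗ₜ[ℝ⟦X⟧] n - m ⊗ₜ[ℝ⟦X⟧] n' ∈ q)
    {x : M ⊗[ℝ⟦X⟧] N} (hx : redTensor ev ev' x = 0) : x ∈ q := by
  have hq' : ∀ (m m' : M) (n n' : N), ev m' = ev m → ev' n' = ev' n →
      (QuotientAddGroup.mk' q) (m' ⊗ₜ[ℝ⟦X⟧] n') = (QuotientAddGroup.mk' q) (m ⊗ₜ n) := by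
    intro m m' n n' hm hn
    have h₁ := hq 1 m m' n n (by rw [hm, one_smul]) (one_smul _ _).symm
    have h₂ := hq 1 m' m' n' n (one_smul _ _).symm (by rw [hn, one_smul])
    rw [← sub_eq_zero, ← map_sub, QuotientAddGroup.mk'_apply, QuotientAddGroup.eq_zero_iff]
    simpa using add_mem h₁ h₂
  choose s hs using h.surjective
  choose s' hs' using h'.surjective
  let g : T ⊗[R] S →+ (M ⊗[ℝ⟦X⟧] N) ⧸ q := TensorProduct.liftAddHom
    (AddMonoidHom.mk' (fun t => AddMonoidHom.mk' (fun u => QuotientAddGroup.mk' q (s t ⊗ₜ s' u))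
      (fun u v => by
        rw [← map_add, ← TensorProduct.tmul_add]
        exact hq' _ _ _ _ rfl (by simp [hs'])))
      (fun t u => by
        ext v
        simp only [AddMonoidHom.mk'_apply, AddMonoidHom.add_apply]
        rw [← map_add, ← TensorProduct.add_tmul]
        exact hq' _ _ _ _ (by simp [hs]) rfl))
    (fun a t u => by
      simp only [AddMonoidHom.mk'_apply]
      rw [← sub_eq_zero, ← map_sub, QuotientAddGroup.mk'_apply, QuotientAddGroup.eq_zero_iff]
      exact hq a _ _ _ _ (by rw [hs, hs]) (by rw [hs', hs']))
  have hg : ∀ y, g (redTensor ev ev' y) = QuotientAddGroup.mk' q y := by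
    intro y
    induction y using TensorProduct.induction_on with
    | zero => simp
    | tmul m n => exact hq' _ _ _ _ (by rw [hs]) (by rw [hs'])
    | add y z hy hz => rw [map_add, map_add, map_add, hy, hz]
  have := hg x
  rw [hx, map_zero] at this
  exact (QuotientAddGroup.eq_zero_iff x).1 this.symm

/-- A reduction map, seen as semilinear over `ℝ[[ħ]] → ℝ`. -/
def redReal [Module ℝ T] [IsScalarTower ℝ R T] (ev : M →ₛₗ[evalZero R] T) :
    M →ₛₗ[evalZero ℝ] T where
  toFun := ev
  map_add' := map_add ev
  map_smul' c m := by
    rw [LinearMap.map_smulₛₗ, evalZero_apply, evalZero_apply, algebraMap_smul]; rfl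

@[simp] lemma redReal_apply [Module ℝ T] [IsScalarTower ℝ R T] (ev : M →ₛₗ[evalZero R] T)
    (m : M) : redReal ev m = ev m := rfl

lemma IsReduction.redReal [Module ℝ T] [IsScalarTower ℝ R T] {ev : M →ₛₗ[evalZero R] T}
    (h : IsReduction ev) : IsReduction (redReal ev) := ⟨h.1, h.2⟩

lemma IsReduction.exists_smul_tensor [Module ℝ T] [Module ℝ S] {ev : M →ₛₗ[evalZero ℝ] T}
    {ev' : N →ₛₗ[evalZero ℝ] S} (h : IsReduction ev) (h' : IsReduction ev')
    {x : M ⊗[ℝ⟦X⟧] N} (hx : redTensor ev ev' x = 0) :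
    ∃ y, (PowerSeries.X : ℝ⟦X⟧) • y = x := by
  have := mem_of_redTensor_eq_zero h h' (hbarIdeal • ⊤ : Submodule ℝ⟦X⟧ _).toAddSubgroup
    ?_ hx
  · exact mem_hbar_smul_top.1 this
  · intro a m m' n n' hm hn
    have hc : ∀ c : ℝ, evalZero ℝ (PowerSeries.C c) = c := fun c => by simp [evalZero]
    obtain ⟨k, hk⟩ := h.exists_smul (m' - PowerSeries.C a • m) (by
      rw [map_sub, LinearMap.map_smulₛₗ, hc, hm, sub_self])
    obtain ⟨l, hl⟩ := h'.exists_smul (n' - PowerSeries.C a • n) (by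
      rw [map_sub, LinearMap.map_smulₛₗ, hc, hn, sub_self])
    refine mem_hbar_smul_top.2 ⟨k ⊗ₜ n - m ⊗ₜ l, ?_⟩
    rw [smul_sub, TensorProduct.smul_tmul', hk, ← TensorProduct.tmul_smul, hl,
      TensorProduct.sub_tmul, TensorProduct.tmul_sub, TensorProduct.tmul_smul,
      TensorProduct.smul_tmul']
    abel

end Hbar

/-! ### Tensor products over a deformed base algebra -/

/-- A right module `H` and a left module `N` over a deformation `Rh` of the commutative algebra
`R`, with their reductions modulo `ħ`. -/
structure ModulePair (Rh H N R H₀ N₀ : Type*) [Ring Rh] [Algebra ℝ⟦X⟧ Rh] [AddCommGroup H]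
    [Module ℝ⟦X⟧ H] [AddCommGroup N] [Module ℝ⟦X⟧ N] [CommRing R] [Algebra ℝ R] [AddCommGroup H₀]
    [Module R H₀] [AddCommGroup N₀] [Module R N₀] where
  redBase : Rh →ₛₗ[evalZero R] R
  redFst : H →ₛₗ[evalZero R] H₀
  redSnd : N →ₛₗ[evalZero R] N₀
  isRed_base : IsReduction redBase
  isRed_fst : IsReduction redFst
  isRed_snd : IsReduction redSnd
  redBase_mul : ∀ a b, redBase (a * b) = redBase a * redBase b
  right : Rh →ₗ[ℝ⟦X⟧] H →ₗ[ℝ⟦X⟧] H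
  left : Rh →ₗ[ℝ⟦X⟧] N →ₗ[ℝ⟦X⟧] N
  right_mul : ∀ a b h, right (a * b) h = right b (right a h)
  left_mul : ∀ a b n, left (a * b) n = left a (left b n)
  red_right : ∀ a h, redFst (right a h) = redBase a • redFst h
  red_left : ∀ a n, redSnd (left a n) = redBase a • redSnd n

namespace ModulePair

variable {Rh H N R H₀ N₀ : Type*} [Ring Rh] [Algebra ℝ⟦X⟧ Rh] [AddCommGroup H]
    [Module ℝ⟦X⟧ H] [AddCommGroup N] [Module ℝ⟦X⟧ N] [CommRing R] [Algebra ℝ R] [AddCommGroup H₀]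
    [Module R H₀] [AddCommGroup N₀] [Module R N₀] (Q : ModulePair Rh H N R H₀ N₀)

/-- The relations `h a ⊗ n = h ⊗ a n`. -/
def rel : Submodule ℝ⟦X⟧ (H ⊗[ℝ⟦X⟧] N) :=
  Submodule.span _ {t | ∃ a h n, t = Q.right a h ⊗ₜ n - h ⊗ₜ Q.left a n}

/-- The reduction of `H ⊗_{Rh} N` modulo `ħ`. -/
def red : (H ⊗[ℝ⟦X⟧] N) ⧸ Q.rel →ₛₗ[evalZero R] H₀ ⊗[R] N₀ :=
  Submodule.liftQ Q.rel (redTensor Q.redFst Q.redSnd) (by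
    rw [rel, Submodule.span_le]
    rintro _ ⟨a, h, n, rfl⟩
    rw [SetLike.mem_coe, LinearMap.mem_ker, map_sub, redTensor_tmul, redTensor_tmul, Q.red_right,
      Q.red_left, TensorProduct.smul_tmul, sub_self])

lemma red_mk (x : H ⊗[ℝ⟦X⟧] N) :
    Q.red (Submodule.Quotient.mk x) = redTensor Q.redFst Q.redSnd x := rfl

lemma isReduction : IsReduction Q.red where
  surjective t := by
    induction t using TensorProduct.induction_on with
    | zero => exact ⟨0, map_zero _⟩
    | tmul u v =>
      obtain ⟨h, rfl⟩ := Q.isRed_fst.surjective u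
      obtain ⟨n, rfl⟩ := Q.isRed_snd.surjective v
      exact ⟨Submodule.Quotient.mk (h ⊗ₜ n), rfl⟩
    | add s t hs ht =>
      obtain ⟨x, rfl⟩ := hs
      obtain ⟨y, rfl⟩ := ht
      exact ⟨x + y, map_add _ _ _⟩
  exists_smul y hy := by
    obtain ⟨x, rfl⟩ := Submodule.Quotient.mk_surjective _ y
    rw [red_mk] at hy
    have := mem_of_redTensor_eq_zero Q.isRed_fst Q.isRed_snd
      (Q.rel ⊔ (hbarIdeal • ⊤ : Submodule ℝ⟦X⟧ _)).toAddSubgroup ?_ hy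
    · obtain ⟨z, hz, w, hw, hzw⟩ := Submodule.mem_sup.1 this
      obtain ⟨w', rfl⟩ := mem_hbar_smul_top.1 hw
      refine ⟨Submodule.Quotient.mk w', ?_⟩
      rw [← Submodule.Quotient.mk_smul, Submodule.Quotient.eq, ← hzw]
      simpa using hz
    · intro f m m' n n' hm hn
      obtain ⟨a, rfl⟩ := Q.isRed_base.surjective f
      obtain ⟨k, hk⟩ := Q.isRed_fst.exists_smul (m' - Q.right a m) (by
        rw [map_sub, Q.red_right, hm, sub_self])
      obtain ⟨l, hl⟩ := Q.isRed_snd.exists_smul (n' - Q.left a n) (by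
        rw [map_sub, Q.red_left, hn, sub_self])
      refine Submodule.mem_sup.2 ⟨Q.right a m ⊗ₜ n - m ⊗ₜ Q.left a n,
        Submodule.subset_span ⟨a, m, n, rfl⟩, _, mem_hbar_smul_top.2 ⟨k ⊗ₜ n - m ⊗ₜ l, rfl⟩, ?_⟩
      rw [smul_sub, TensorProduct.smul_tmul', hk, ← TensorProduct.tmul_smul, hl,
        TensorProduct.sub_tmul, TensorProduct.tmul_sub]
      abel

/-- The map `h ⊗ a ↦ h a ⊗ w - h ⊗ a w`. -/
def relMap (w : N) : H ⊗[ℝ⟦X⟧] Rh →ₗ[ℝ⟦X⟧] H ⊗[ℝ⟦X⟧] N :=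
  TensorProduct.lift (Q.right.flip.compr₂ ((TensorProduct.mk ℝ⟦X⟧ H N).flip w))
    - (Q.left.flip w).lTensor H

lemma relMap_tmul (w : N) (h : H) (a : Rh) :
    Q.relMap w (h ⊗ₜ a) = Q.right a h ⊗ₜ w - h ⊗ₜ Q.left a w := by
  simp [relMap]

lemma relMap_mem (w : N) (y : H ⊗[ℝ⟦X⟧] Rh) : Q.relMap w y ∈ Q.rel := by
  induction y using TensorProduct.induction_on with
  | zero => simp
  | tmul h a => rw [relMap_tmul]; exact Submodule.subset_span ⟨a, h, w, rfl⟩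
  | add y z hy hz => rw [map_add]; exact add_mem hy hz

variable [Module ℝ H₀] [IsScalarTower ℝ R H₀] [Module ℝ N₀] [IsScalarTower ℝ R N₀]

/-- Flatness: if every finite subset of `N₀` is fixed by an endomorphism of finite rank, then
`H ⊗_{Rh} N` has no `ħ`-torsion. -/
theorem noHbarTorsion (hH : NoHbarTorsion H) (hN : NoHbarTorsion N)
    (hN₀ : LocallyFiniteRank R N₀) : NoHbarTorsion ((H ⊗[ℝ⟦X⟧] N) ⧸ Q.rel) := by
  classical
  intro y hy
  obtain ⟨x, rfl⟩ := Submodule.Quotient.mk_surjective _ y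
  rw [← Submodule.Quotient.mk_smul, Submodule.Quotient.mk_eq_zero, rel,
    Submodule.mem_span_set'] at hy
  obtain ⟨m, c, g, hg⟩ := hy
  have hg' : ∀ i, ∃ a h n, c i • (g i : H ⊗[ℝ⟦X⟧] N) = Q.right a h ⊗ₜ n - h ⊗ₜ Q.left a n := by
    intro i
    obtain ⟨a, h, n, hh⟩ := (g i).2
    refine ⟨a, c i • h, n, ?_⟩
    rw [hh, map_smul, smul_sub, TensorProduct.smul_tmul', TensorProduct.smul_tmul']
  choose a h ν hx using hg'
  obtain ⟨T, ⟨t, rfl⟩, hT⟩ := hN₀ (Finset.univ.image fun i => Q.redSnd (ν i))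
  obtain ⟨s, rfl⟩ := TensorProduct.exists_finset t
  have hT' : ∀ i, Q.redSnd (ν i) = ∑ j ∈ s, j.1 (Q.redSnd (ν i)) • j.2 := by
    intro i
    conv_lhs => rw [← hT _ (Finset.mem_image_of_mem _ (Finset.mem_univ i))]
    simp
  choose w hw using Q.isRed_snd.surjective
  choose b hb using Q.isRed_base.surjective
  -- lift the coefficients `ψⱼ(ν̄ᵢ)` and the vectors `wⱼ`
  let C : Fin m → (N₀ →ₗ[R] R) × N₀ → Rh := fun i j => b (j.1 (Q.redSnd (ν i)))
  have hk : ∀ i, ∃ k, (PowerSeries.X : ℝ⟦X⟧) • k = ν i - ∑ j ∈ s, Q.left (C i j) (w j.2) := by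
    intro i
    refine Q.isRed_snd.exists_smul _ ?_
    simp only [map_sub, map_sum, Q.red_left, hw, C, hb]
    rw [← hT' i, sub_self]
  choose k hk using hk
  let y : (N₀ →ₗ[R] R) × N₀ → H ⊗[ℝ⟦X⟧] Rh := fun j =>
    ∑ i, (h i ⊗ₜ (a i * C i j) - Q.right (a i) (h i) ⊗ₜ C i j)
  have hy : ∀ j, ∃ y', (PowerSeries.X : ℝ⟦X⟧) • y' = y j := by
    intro j
    refine Q.isRed_fst.redReal.exists_smul_tensor Q.isRed_base.redReal ?_
    have h₀ : redTensor (redReal Q.redFst) (redReal Q.redSnd) ((PowerSeries.X : ℝ⟦X⟧) • x) = 0 :=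
      red_X_smul _ x
    have h₁ := congrArg ((j.1.restrictScalars ℝ).lTensor H₀) h₀
    rw [← hg, Finset.sum_congr rfl fun i _ => hx i] at h₁
    simp only [map_sum, map_sub, redTensor_tmul, redReal_apply, Q.red_left, Q.red_right,
      LinearMap.lTensor_tmul, LinearMap.coe_restrictScalars, map_smul, map_zero] at h₁
    simp only [y, map_sum, map_sub, redTensor_tmul, redReal_apply, Q.redBase_mul, Q.red_right, C,
      hb]
    rw [← neg_eq_zero, ← h₁, ← Finset.sum_neg_distrib]
    refine Finset.sum_congr rfl fun i _ => ?_
    rw [neg_sub, smul_eq_mul]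
  choose y' hy' using hy
  have hmain : (PowerSeries.X : ℝ⟦X⟧) • x = (PowerSeries.X : ℝ⟦X⟧) •
      (∑ j ∈ s, Q.relMap (w j.2) (y' j) + ∑ i, (Q.right (a i) (h i) ⊗ₜ k i
        - h i ⊗ₜ Q.left (a i) (k i))) := by
    rw [← hg, Finset.sum_congr rfl fun i _ => hx i, smul_add, Finset.smul_sum, Finset.smul_sum]
    simp only [← map_smul, hy', smul_sub, ← TensorProduct.tmul_smul, hk, map_sub, map_sum,
      TensorProduct.tmul_sub, TensorProduct.tmul_sum, y, relMap_tmul, Q.right_mul, Q.left_mul]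
    rw [Finset.sum_comm, ← Finset.sum_add_distrib]
    refine Finset.sum_congr rfl fun i _ => ?_
    simp only [Finset.sum_sub_distrib]
    abel
  rw [(hH.tensor hN).cancel hmain, Submodule.Quotient.mk_eq_zero]
  refine add_mem (sum_mem fun j _ => Q.relMap_mem _ _) (sum_mem fun i _ => ?_)
  exact Submodule.subset_span ⟨_, _, _, rfl⟩

end ModulePair

/-! ### The tensor powers of a quantum groupoid -/

namespace MapsDeformation

variable {R L : Type*} [CommRing R] [Algebra ℝ R] [AddCommGroup L] [Module R L]
  {A : LieRinehart R L} {Rh Hh : Type*} [Ring Rh] [Algebra ℝ⟦X⟧ Rh]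
  [Ring Hh] [Algebra ℝ⟦X⟧ Hh] {S : SourceTarget ℝ⟦X⟧ Rh Hh} (Q : MapsDeformation A S)

lemma baseEquiv_X_smul (a : Rh) :
    Q.baseEquiv ((PowerSeries.X : ℝ⟦X⟧) • a) = PowerSeries.X * Q.baseEquiv a := by
  rw [Q.baseEquiv_smul, PowerSeries.map_X]

lemma totalEquiv_X_smul (h : Hh) :
    Q.totalEquiv ((PowerSeries.X : ℝ⟦X⟧) • h) = PowerSeries.X * Q.totalEquiv h := by
  rw [Q.totalEquiv_smul, PowerSeries.map_X]

lemma powerSeries_X_mul_cancel {B : Type*} [Ring B] {p : B⟦X⟧} (h : PowerSeries.X * p = 0) :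
    p = 0 := by
  ext n
  have := congrArg (PowerSeries.coeff (n + 1)) h
  rwa [PowerSeries.coeff_succ_X_mul, map_zero] at this

include Q in
lemma noHbarTorsion_base : NoHbarTorsion Rh := by
  intro a ha
  have := congrArg Q.baseEquiv ha
  rw [Q.baseEquiv_X_smul, map_zero] at this
  exact Q.baseEquiv.map_eq_zero_iff.1 (powerSeries_X_mul_cancel this)

include Q in
lemma noHbarTorsion_total : NoHbarTorsion Hh := by
  intro a ha
  have := congrArg Q.totalEquiv ha
  rw [Q.totalEquiv_X_smul, map_zero] at this
  exact Q.totalEquiv.map_eq_zero_iff.1 (powerSeries_X_mul_cancel this)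

/-- The reduction `R_ħ → R` as a semilinear map. -/
def baseRedₗ : Rh →ₛₗ[evalZero R] R where
  toFun := Q.baseRed
  map_add' a b := by simp [baseRed]
  map_smul' c a := by
    rw [baseRed, Q.baseEquiv_smul, map_mul, ← PowerSeries.coeff_zero_eq_constantCoeff_apply,
      PowerSeries.coeff_map, PowerSeries.coeff_zero_eq_constantCoeff_apply]
    rfl

@[simp] lemma baseRedₗ_apply (a : Rh) : Q.baseRedₗ a = Q.baseRed a := rfl

lemma isReduction_base : IsReduction Q.baseRedₗ where
  surjective f := ⟨Q.liftFun f, by simp [baseRed, liftFun]⟩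
  exists_smul a ha := by
    obtain ⟨p, hp⟩ := PowerSeries.X_dvd_iff.2 (ha : (Q.baseEquiv a).constantCoeff = 0)
    refine ⟨Q.baseEquiv.symm p, Q.baseEquiv.injective ?_⟩
    rw [Q.baseEquiv_X_smul, AddEquiv.apply_symm_apply]; exact hp.symm

lemma isReduction_total : IsReduction Q.totalRed where
  surjective u := ⟨Q.liftTotal u, by simp [totalRed, liftTotal]⟩
  exists_smul a ha := by
    obtain ⟨p, hp⟩ := PowerSeries.X_dvd_iff.2 (ha : (Q.totalEquiv a).constantCoeff = 0)
    refine ⟨Q.totalEquiv.symm p, Q.totalEquiv.injective ?_⟩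
    rw [Q.totalEquiv_X_smul, AddEquiv.apply_symm_apply]; exact hp.symm

lemma totalRed_liftTotal (u : Envelope A) : Q.totalRed (Q.liftTotal u) = u := by
  simp [totalRed, liftTotal]

lemma baseRed_liftFun (f : R) : Q.baseRed (Q.liftFun f) = f := by
  simp [baseRed, liftFun]

lemma baseRed_mul (a b : Rh) : Q.baseRed (a * b) = Q.baseRed a * Q.baseRed b := Q.base_mul a b

lemma totalRed_mul (h k : Hh) : Q.totalRed (h * k) = Q.totalRed h * Q.totalRed k :=
  Q.total_mul h k

lemma totalRed_one : Q.totalRed 1 = 1 := by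
  change (Q.totalEquiv 1).constantCoeff = 1
  rw [Q.totalEquiv_one, map_one]

lemma totalRed_α (a : Rh) : Q.totalRed (S.α a) = Envelope.ofFun A (Q.baseRed a) := Q.source_mod a

lemma totalRed_β (a : Rh) : Q.totalRed (S.β a) = Envelope.ofFun A (Q.baseRed a) := Q.target_mod a

/-- `H_ħ` as a right and as a left module over `R_ħ`. -/
def pair₂ : ModulePair Rh Hh Hh R (Envelope A) (Envelope A) where
  redBase := Q.baseRedₗ
  redFst := Q.totalRed
  redSnd := Q.totalRed
  isRed_base := Q.isReduction_base
  isRed_fst := Q.isReduction_total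
  isRed_snd := Q.isReduction_total
  redBase_mul := Q.baseRed_mul
  right := LinearMap.mul ℝ⟦X⟧ Hh ∘ₗ
    ((MulOpposite.opLinearEquiv ℝ⟦X⟧).symm.toLinearMap ∘ₗ S.target.toLinearMap)
  left := LinearMap.mul ℝ⟦X⟧ Hh ∘ₗ S.source.toLinearMap
  right_mul a b h := by simp [mul_assoc]
  left_mul a b h := by simp [mul_assoc]
  red_right a h := (Q.totalRed_mul (S.β a) h).trans (by rw [Q.totalRed_β]; rfl)
  red_left a h := (Q.totalRed_mul (S.α a) h).trans (by rw [Q.totalRed_α]; rfl)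

/-- The reduction of the uncompleted tensor product. -/
def pairRed : (Hh ⊗[ℝ⟦X⟧] Hh) ⧸ S.rel₂ →ₛₗ[evalZero R] Envelope A ⊗[R] Envelope A := Q.pair₂.red

lemma isReduction_pair : IsReduction Q.pairRed :=
  Q.pair₂.isReduction

lemma isReduction_tensorRed : IsReduction Q.tensorRed :=
  Q.isReduction_pair.of_completion _ fun m => by
    obtain ⟨x, rfl⟩ := Submodule.Quotient.mk_surjective _ m
    rfl

lemma tensorRed_mk₂ (h k : Hh) :
    Q.tensorRed (S.mk₂ hbarIdeal (h ⊗ₜ k)) = Q.totalRed h ⊗ₜ[R] Q.totalRed k := rfl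

/-- The left action of `R_ħ` on the uncompleted tensor product `H_ħ ⊗_{R_ħ} H_ħ`. -/
def leftTensor : Rh →ₗ[ℝ⟦X⟧] (Hh ⊗[ℝ⟦X⟧] Hh) ⧸ S.rel₂ →ₗ[ℝ⟦X⟧] (Hh ⊗[ℝ⟦X⟧] Hh) ⧸ S.rel₂ where
  toFun a := Submodule.mapQ S.rel₂ S.rel₂
    (TensorProduct.map (LinearMap.mulLeft ℝ⟦X⟧ (S.α a)) LinearMap.id)
    (S.rel₂_le _ _ fun b h h' => Submodule.subset_span ⟨b, S.α a * h, h', by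
      simp only [TensorProduct.map_tmul, LinearMap.mulLeft_apply, LinearMap.id_apply,
        ← mul_assoc, S.α_comm_β]⟩)
  map_add' a b := by
    refine Submodule.linearMap_qext _ (TensorProduct.ext' fun u v => ?_)
    simp [SourceTarget.α, add_mul, TensorProduct.add_tmul]
  map_smul' c a := by
    refine Submodule.linearMap_qext _ (TensorProduct.ext' fun u v => ?_)
    simp [SourceTarget.α]
    rw [← TensorProduct.smul_tmul']; rfl

lemma leftTensor_mk (a : Rh) (h k : Hh) :
    leftTensor (S := S) a (Submodule.Quotient.mk (h ⊗ₜ k))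
      = Submodule.Quotient.mk ((S.α a * h) ⊗ₜ k) := rfl

/-- `H_ħ` as a right module and `H_ħ ⊗_{R_ħ} H_ħ` as a left module over `R_ħ`. -/
def pair₃ : ModulePair Rh Hh ((Hh ⊗[ℝ⟦X⟧] Hh) ⧸ S.rel₂) R (Envelope A)
    (Envelope A ⊗[R] Envelope A) where
  redBase := Q.baseRedₗ
  redFst := Q.totalRed
  redSnd := Q.pairRed
  isRed_base := Q.isReduction_base
  isRed_fst := Q.isReduction_total
  isRed_snd := Q.isReduction_pair
  redBase_mul := Q.baseRed_mul
  right := Q.pair₂.right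
  left := leftTensor
  right_mul := Q.pair₂.right_mul
  left_mul a b n := by
    obtain ⟨x, rfl⟩ := Submodule.Quotient.mk_surjective _ n
    induction x using TensorProduct.induction_on with
    | zero => simp
    | tmul h k => simp only [leftTensor_mk, SourceTarget.α, map_mul, mul_assoc]
    | add x y hx hy => rw [Submodule.Quotient.mk_add, map_add, hx, hy, map_add, map_add]
  red_right := Q.pair₂.red_right
  red_left a n := by
    obtain ⟨x, rfl⟩ := Submodule.Quotient.mk_surjective _ n
    induction x using TensorProduct.induction_on with
    | zero => simp
    | tmul h k =>
      rw [leftTensor_mk]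
      change Q.totalRed _ ⊗ₜ[R] Q.totalRed k = _
      rw [Q.totalRed_mul, Q.totalRed_α]
      rfl
    | add x y hx hy => rw [Submodule.Quotient.mk_add, map_add, map_add, hx, hy, map_add, smul_add]

/-- `H_ħ ⊗_{R_ħ} H_ħ ⊗_{R_ħ} H_ħ` as an iterated tensor product. -/
def assocMap : (Hh ⊗[ℝ⟦X⟧] (Hh ⊗[ℝ⟦X⟧] Hh)) ⧸ S.rel₃ →ₗ[ℝ⟦X⟧]
    (Hh ⊗[ℝ⟦X⟧] ((Hh ⊗[ℝ⟦X⟧] Hh) ⧸ S.rel₂)) ⧸ Q.pair₃.rel :=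
  Submodule.mapQ _ _ (S.rel₂.mkQ.lTensor Hh) (by
    rw [SourceTarget.rel₃, Submodule.span_le]
    rintro _ (⟨a, h, h', h'', rfl⟩ | ⟨a, h, h', h'', rfl⟩)
    · exact Submodule.subset_span ⟨a, h, Submodule.Quotient.mk (h' ⊗ₜ h''), rfl⟩
    · have : S.rel₂.mkQ ((S.β a * h') ⊗ₜ h'') = S.rel₂.mkQ (h' ⊗ₜ (S.α a * h'')) :=
        (Submodule.Quotient.eq _).2 (Submodule.subset_span ⟨a, h', h'', rfl⟩)
      rw [SetLike.mem_coe, Submodule.mem_comap, map_sub, LinearMap.lTensor_tmul,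
        LinearMap.lTensor_tmul, this, sub_self]
      exact zero_mem _)

lemma assocMap_mk (x : Hh ⊗[ℝ⟦X⟧] (Hh ⊗[ℝ⟦X⟧] Hh)) :
    Q.assocMap (Submodule.Quotient.mk x) = Submodule.Quotient.mk (S.rel₂.mkQ.lTensor Hh x) := rfl

lemma assocMap_bijective : Function.Bijective Q.assocMap := by
  have hs : Function.Surjective (S.rel₂.mkQ.lTensor Hh) :=
    LinearMap.lTensor_surjective _ (Submodule.mkQ_surjective _)
  constructor
  · rw [injective_iff_map_eq_zero]
    intro y hy
    obtain ⟨x, rfl⟩ := Submodule.Quotient.mk_surjective _ y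
    rw [assocMap_mk, Submodule.Quotient.mk_eq_zero] at hy
    have hle : Q.pair₃.rel ≤ S.rel₃.map (S.rel₂.mkQ.lTensor Hh) := by
      rw [ModulePair.rel, Submodule.span_le]
      rintro _ ⟨a, h, n, rfl⟩
      obtain ⟨z, rfl⟩ := Submodule.Quotient.mk_surjective _ n
      induction z using TensorProduct.induction_on with
      | zero => exact ⟨0, zero_mem _, by simp⟩
      | tmul h' h'' =>
        exact ⟨_, Submodule.subset_span (Or.inl ⟨a, h, h', h'', rfl⟩), by
          rw [map_sub]; rfl⟩
      | add z w hz hw =>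
        rw [SetLike.mem_coe] at *
        convert add_mem hz hw using 1
        simp only [Submodule.Quotient.mk_add, TensorProduct.tmul_add, map_add]
        abel
    obtain ⟨z, hz, hzx⟩ := hle hy
    have hker : x - z ∈ LinearMap.range (S.rel₂.subtype.lTensor Hh) := by
      have hex := lTensor_exact Hh (f := S.rel₂.subtype) (g := S.rel₂.mkQ)
        (LinearMap.exact_subtype_mkQ _) (Submodule.mkQ_surjective _)
      exact (hex (x - z)).1 (by rw [map_sub, hzx, sub_self])
    have hrel : ∀ w, S.rel₂.subtype.lTensor Hh w ∈ S.rel₃ := by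
      intro w
      induction w using TensorProduct.induction_on with
      | zero => rw [map_zero]; exact zero_mem _
      | tmul h t =>
        obtain ⟨t, ht⟩ := t
        rw [LinearMap.lTensor_tmul]
        change h ⊗ₜ t ∈ _
        refine Submodule.span_induction (p := fun t _ => h ⊗ₜ[ℝ⟦X⟧] t ∈ S.rel₃) ?_ ?_ ?_ ?_ ht
        · rintro _ ⟨a, h', h'', rfl⟩
          rw [TensorProduct.tmul_sub]
          exact Submodule.subset_span (Or.inr ⟨a, h, h', h'', rfl⟩)
        · simp
        · intro s t _ _ hs ht; rw [TensorProduct.tmul_add]; exact add_mem hs ht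
        · intro c s _ hs; rw [TensorProduct.tmul_smul]; exact Submodule.smul_mem _ c hs
      | add s t hs ht => rw [map_add]; exact add_mem hs ht
    have hmem : x - z ∈ S.rel₃ := by
      obtain ⟨w, hw⟩ := hker
      rw [← hw]
      exact hrel w
    rw [Submodule.Quotient.mk_eq_zero]
    simpa using add_mem hmem hz
  · intro y
    obtain ⟨x, rfl⟩ := Submodule.Quotient.mk_surjective _ y
    obtain ⟨x, rfl⟩ := hs x
    exact ⟨Submodule.Quotient.mk x, rfl⟩

/-- The reduction of the uncompleted triple tensor product. -/
def tripleRed₀ : (Hh ⊗[ℝ⟦X⟧] (Hh ⊗[ℝ⟦X⟧] Hh)) ⧸ S.rel₃ →ₛₗ[evalZero R]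
    Envelope A ⊗[R] (Envelope A ⊗[R] Envelope A) := Q.pair₃.red.comp Q.assocMap

/-- The reduction `H_ħ ⊗ H_ħ ⊗ H_ħ → UA ⊗ UA ⊗ UA` modulo `ħ`. -/
def tripleRed : S.Tensor₃ hbarIdeal →ₛₗ[evalZero R]
    Envelope A ⊗[R] (Envelope A ⊗[R] Envelope A) := completionRed Q.tripleRed₀

lemma tripleRed_mk₃ (h k l : Hh) : Q.tripleRed (S.mk₃ hbarIdeal (h ⊗ₜ (k ⊗ₜ l)))
    = Q.totalRed h ⊗ₜ[R] (Q.totalRed k ⊗ₜ[R] Q.totalRed l) := rfl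

include Q in
lemma noHbarTorsion_pair (hU : LocallyFiniteRank R (Envelope A)) :
    NoHbarTorsion ((Hh ⊗[ℝ⟦X⟧] Hh) ⧸ S.rel₂) :=
  Q.pair₂.noHbarTorsion Q.noHbarTorsion_total Q.noHbarTorsion_total hU

include Q in
lemma noHbarTorsion_tensor₂ (hU : LocallyFiniteRank R (Envelope A)) :
    NoHbarTorsion (S.Tensor₂ hbarIdeal) :=
  (Q.noHbarTorsion_pair hU).completion

include Q in
lemma noHbarTorsion_tensor₃ (hU : LocallyFiniteRank R (Envelope A)) :
    NoHbarTorsion (S.Tensor₃ hbarIdeal) := by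
  refine NoHbarTorsion.completion fun m hm => Q.assocMap_bijective.1 ?_
  rw [map_zero]
  refine Q.pair₃.noHbarTorsion Q.noHbarTorsion_total (Q.noHbarTorsion_pair hU)
    (hU.tensor hU) _ ?_
  rw [← map_smul, hm, map_zero]

end MapsDeformation

end QuantumGroupoids

namespace QuantumGroupoids

/-! ### Reduction of the structure maps modulo `ħ` -/

namespace MapsDeformation

variable {R L : Type*} [CommRing R] [Algebra ℝ R] [AddCommGroup L] [Module R L]
  {A : LieRinehart R L} {Rh Hh : Type*} [Ring Rh] [Algebra ℝ⟦X⟧ Rh]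
  [Ring Hh] [Algebra ℝ⟦X⟧ Hh] {S : SourceTarget ℝ⟦X⟧ Rh Hh} (D : MapsDeformation A S)

/-- A map out of the completed tensor product is determined modulo `ħ` by its values on the
classes of pure tensors. -/
lemma red_comp_eq {N T : Type*} [AddCommGroup N] [Module ℝ⟦X⟧ N] [AddCommGroup T] [Module R T]
    (f : S.Tensor₂ hbarIdeal →ₗ[ℝ⟦X⟧] N) (ev : N →ₛₗ[evalZero R] T)
    (φ : Envelope A ⊗[R] Envelope A →+ T)
    (h : ∀ a b, ev (f (S.mk₂ hbarIdeal (a ⊗ₜ b))) = φ (D.totalRed a ⊗ₜ D.totalRed b))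
    (y : S.Tensor₂ hbarIdeal) : ev (f y) = φ (D.tensorRed y) := by
  refine completion_ext (f := (ev.toAddMonoidHom.comp f.toAddMonoidHom))
    (g := φ.comp D.tensorRed.toAddMonoidHom) (fun y => ?_) (fun y => ?_) (fun m => ?_) y
  · change ev (f _) = 0
    rw [map_smul, red_X_smul]
  · change φ (D.tensorRed _) = 0
    rw [red_X_smul, map_zero]
  · obtain ⟨x, rfl⟩ := Submodule.Quotient.mk_surjective _ m
    change ev (f (S.mk₂ hbarIdeal x)) = φ (D.tensorRed (S.mk₂ hbarIdeal x))
    induction x using TensorProduct.induction_on with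
    | zero => simp
    | tmul a b => exact h a b
    | add x y hx hy => simp only [map_add, hx, hy]

lemma tensorRed_rightMul (h k : Hh) (t : S.Tensor₂ hbarIdeal) :
    D.tensorRed (S.rightMul hbarIdeal (h ⊗ₜ k) t) = TensorProduct.map
      (Envelope.mulRight A (D.totalRed h)) (Envelope.mulRight A (D.totalRed k))
      (D.tensorRed t) := by
  refine D.red_comp_eq (S.rightMul hbarIdeal (h ⊗ₜ k)) D.tensorRed (TensorProduct.map
    (Envelope.mulRight A (D.totalRed h)) (Envelope.mulRight A (D.totalRed k))).toAddMonoidHom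
    (fun a b => ?_) t
  have : S.rightMul hbarIdeal (h ⊗ₜ k) (S.mk₂ hbarIdeal (a ⊗ₜ b))
      = S.mk₂ hbarIdeal ((a * h) ⊗ₜ (b * k)) := by
    refine (AdicCompletion.map_of ..).trans ?_
    change S.mk₂ hbarIdeal (a ⊗ₜ b * h ⊗ₜ k) = _
    rw [Algebra.TensorProduct.tmul_mul_tmul]
  rw [this, tensorRed_mk₂, totalRed_mul, totalRed_mul]
  rfl

lemma leftAct_mk₂ (a : Rh) (h k : Hh) :
    S.leftAct hbarIdeal a (S.mk₂ hbarIdeal (h ⊗ₜ k)) = S.mk₂ hbarIdeal ((S.α a * h) ⊗ₜ k) :=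
  (AdicCompletion.map_of ..).trans rfl

lemma rightAct_mk₂ (a : Rh) (h k : Hh) :
    S.rightAct hbarIdeal a (S.mk₂ hbarIdeal (h ⊗ₜ k)) = S.mk₂ hbarIdeal (h ⊗ₜ (S.β a * k)) :=
  (AdicCompletion.map_of ..).trans rfl

lemma rightMul_mk₂ (x y : Hh ⊗[ℝ⟦X⟧] Hh) :
    S.rightMul hbarIdeal x (S.mk₂ hbarIdeal y) = S.mk₂ hbarIdeal (y * x) :=
  (AdicCompletion.map_of ..).trans rfl

lemma tensorRight_mk₂ (h k l : Hh) :
    S.tensorRight hbarIdeal l (S.mk₂ hbarIdeal (h ⊗ₜ k)) = S.mk₃ hbarIdeal (h ⊗ₜ (k ⊗ₜ l)) :=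
  (AdicCompletion.map_of ..).trans rfl

lemma tensorLeft_mk₂ (h k l : Hh) :
    S.tensorLeft hbarIdeal l (S.mk₂ hbarIdeal (h ⊗ₜ k)) = S.mk₃ hbarIdeal (l ⊗ₜ (h ⊗ₜ k)) :=
  (AdicCompletion.map_of ..).trans rfl

lemma mk₂_β_tmul (a : Rh) (h k : Hh) :
    S.mk₂ hbarIdeal ((S.β a * h) ⊗ₜ k) = S.mk₂ hbarIdeal (h ⊗ₜ (S.α a * k)) := by
  refine congrArg (AdicCompletion.of hbarIdeal _) ((Submodule.Quotient.eq _).2 ?_)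
  exact Submodule.subset_span ⟨a, h, k, rfl⟩

lemma tensorRed_leftAct (a : Rh) (t : S.Tensor₂ hbarIdeal) :
    D.tensorRed (S.leftAct hbarIdeal a t) = D.baseRed a • D.tensorRed t := by
  refine D.red_comp_eq (S.leftAct hbarIdeal a) _
    (DistribSMul.toAddMonoidHom _ (D.baseRed a)) (fun h k => ?_) t
  rw [leftAct_mk₂, tensorRed_mk₂, totalRed_mul, totalRed_α]
  rfl

lemma tripleRed_tensorRight (k : Hh) (t : S.Tensor₂ hbarIdeal) :
    D.tripleRed (S.tensorRight hbarIdeal k t)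
      = TensorProduct.assoc R _ _ _ (D.tensorRed t ⊗ₜ[R] D.totalRed k) := by
  refine D.red_comp_eq (S.tensorRight hbarIdeal k) _ (AddMonoidHom.mk' (fun t =>
    TensorProduct.assoc R _ _ _ (t ⊗ₜ[R] D.totalRed k))
      (fun s t => by rw [TensorProduct.add_tmul, map_add])) (fun a b => ?_) t
  rw [tensorRight_mk₂, tripleRed_mk₃]
  rfl

lemma tripleRed_tensorLeft (k : Hh) (t : S.Tensor₂ hbarIdeal) :
    D.tripleRed (S.tensorLeft hbarIdeal k t) = D.totalRed k ⊗ₜ[R] D.tensorRed t := by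
  refine D.red_comp_eq (S.tensorLeft hbarIdeal k) _ (AddMonoidHom.mk' (fun t =>
    D.totalRed k ⊗ₜ[R] t) (fun s t => by rw [TensorProduct.tmul_add])) (fun a b => ?_) t
  rw [tensorLeft_mk₂, tripleRed_mk₃]
  rfl

end MapsDeformation

open Envelope

namespace QuantumGroupoid

variable {R L : Type*} [CommRing R] [Algebra ℝ R] [AddCommGroup L] [Module R L]
  {A : LieRinehart R L} {Rh Hh : Type*} [Ring Rh] [Algebra ℝ⟦X⟧ Rh]
  [Ring Hh] [Algebra ℝ⟦X⟧ Hh] (Q : QuantumGroupoid A Rh Hh)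

lemma comulLeft_mk₂ (a b : Hh) :
    Q.comul.comulLeft (Q.maps.mk₂ hbarIdeal (a ⊗ₜ b))
      = Q.maps.tensorRight hbarIdeal b (Q.comul.Δ a) :=
  (completionExtend_of ..).trans rfl

lemma comulRight_mk₂ (a b : Hh) :
    Q.comul.comulRight (Q.maps.mk₂ hbarIdeal (a ⊗ₜ b))
      = Q.maps.tensorLeft hbarIdeal a (Q.comul.Δ b) :=
  (completionExtend_of ..).trans rfl

lemma act_mk₂ (h a b : Hh) :
    Q.comul.act h (Q.maps.mk₂ hbarIdeal (a ⊗ₜ b))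
      = Q.maps.rightMul hbarIdeal (a ⊗ₜ b) (Q.comul.Δ h) :=
  (completionExtend_of ..).trans rfl

lemma tripleRed_comulLeft (t : Q.maps.Tensor₂ hbarIdeal) :
    Q.deform.tripleRed (Q.comul.comulLeft t) = comulL A (Q.deform.tensorRed t) := by
  refine Q.deform.red_comp_eq Q.comul.comulLeft _ (comulL A).toAddMonoidHom (fun a b => ?_) t
  rw [comulLeft_mk₂, MapsDeformation.tripleRed_tensorRight, Q.comul_mod]
  exact (comulL_tmul _ _).symm

lemma tripleRed_comulRight (t : Q.maps.Tensor₂ hbarIdeal) :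
    Q.deform.tripleRed (Q.comul.comulRight t) = comulR A (Q.deform.tensorRed t) := by
  refine Q.deform.red_comp_eq Q.comul.comulRight _ (comulR A).toAddMonoidHom (fun a b => ?_) t
  rw [comulRight_mk₂, MapsDeformation.tripleRed_tensorLeft, Q.comul_mod]
  exact (comulR_tmul _ _).symm

include Q in
/-- The enveloping algebra is coassociative, as the reduction of a coassociative coproduct. -/
lemma comul_coassoc (u : Envelope A) : comulL A (comul A u) = comulR A (comul A u) := by
  have := congrArg Q.deform.tripleRed (Q.coassoc (Q.deform.liftTotal u))
  rwa [tripleRed_comulLeft, tripleRed_comulRight, Q.comul_mod,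
    MapsDeformation.totalRed_liftTotal] at this

lemma tensorAct_tmul (u a b : Envelope A) :
    tensorAct A u (a ⊗ₜ b) = TensorProduct.map (mulRight A a) (mulRight A b) (comul A u) := by
  induction u using induction_left with
  | one => simp [comul_one]
  | add u v hu hv => rw [map_add, comul_add, map_add, ← hu, ← hv]; rfl
  | smul f u hu =>
    rw [comul_smul, LinearMap.map_smul, ← hu, fun_smul_def, map_mul, Module.End.mul_apply]
    simp [tensorAct]
  | sec X u hu =>
    rw [comul_sec_mul, map_mul, Module.End.mul_apply, hu]
    simp only [tensorAct, lift_ofSec]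
    change secAct A X _ = _
    induction comul A u using TensorProduct.induction_on with
    | zero => simp
    | tmul v w => simp [mul_assoc]
    | add s t hs ht => simp only [map_add, hs, ht]

lemma tensorRed_act (h : Hh) (t : Q.maps.Tensor₂ hbarIdeal) :
    Q.deform.tensorRed (Q.comul.act h t)
      = tensorAct A (Q.deform.totalRed h) (Q.deform.tensorRed t) := by
  refine Q.deform.red_comp_eq (Q.comul.act h) _
    (tensorAct A (Q.deform.totalRed h)).toAddMonoidHom (fun a b => ?_) t
  rw [act_mk₂, MapsDeformation.tensorRed_rightMul, Q.comul_mod]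
  exact (tensorAct_tmul _ _ _).symm

/-! ### The operator `δ` on functions and the bracket of functions -/

/-- `Δ h = h ⊗ 1 + 1 ⊗ h + ħ y`: the element `y` is the first order term of the coproduct of
`h`. -/
def IsFirstOrder (h : Hh) (y : Q.maps.Tensor₂ hbarIdeal) : Prop :=
  Q.comul.Δ h = Q.maps.mk₂ hbarIdeal (h ⊗ₜ 1) + Q.maps.mk₂ hbarIdeal (1 ⊗ₜ h)
    + (PowerSeries.X : ℝ⟦X⟧) • y

variable {Q}

lemma α_add (a b : Rh) : Q.maps.α (a + b) = Q.maps.α a + Q.maps.α b := map_add _ _ _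
lemma α_sub (a b : Rh) : Q.maps.α (a - b) = Q.maps.α a - Q.maps.α b := map_sub _ _ _
lemma α_smul (c : ℝ⟦X⟧) (a : Rh) : Q.maps.α (c • a) = c • Q.maps.α a := map_smul _ _ _
lemma α_mul (a b : Rh) : Q.maps.α (a * b) = Q.maps.α a * Q.maps.α b := map_mul _ _ _
lemma β_add (a b : Rh) : Q.maps.β (a + b) = Q.maps.β a + Q.maps.β b := by
  simp [SourceTarget.β]
lemma β_sub (a b : Rh) : Q.maps.β (a - b) = Q.maps.β a - Q.maps.β b := by
  simp [SourceTarget.β]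
lemma β_smul (c : ℝ⟦X⟧) (a : Rh) : Q.maps.β (c • a) = c • Q.maps.β a := by
  simp [SourceTarget.β]
lemma β_mul (a b : Rh) : Q.maps.β (a * b) = Q.maps.β b * Q.maps.β a := by
  simp [SourceTarget.β]

variable (Q) in
lemma exists_sub_eq (a : Rh) : ∃ d, (PowerSeries.X : ℝ⟦X⟧) • d = Q.maps.α a - Q.maps.β a :=
  Q.deform.isReduction_total.exists_smul _ (by
    rw [map_sub, MapsDeformation.totalRed_α, MapsDeformation.totalRed_β, sub_self])

variable (Q) in
include Q in
lemma exists_commutator_eq (a b : Rh) : ∃ c, (PowerSeries.X : ℝ⟦X⟧) • c = a * b - b * a :=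
  Q.deform.isReduction_base.exists_smul _ (by
    rw [map_sub, MapsDeformation.baseRedₗ_apply, MapsDeformation.baseRedₗ_apply,
      MapsDeformation.baseRed_mul, MapsDeformation.baseRed_mul, mul_comm, sub_self])

section Functions

variable (hU : LocallyFiniteRank R (Envelope A))
include hU

lemma isFirstOrder_zero {a : Rh} {d : Hh}
    (hd : (PowerSeries.X : ℝ⟦X⟧) • d = Q.maps.α a - Q.maps.β a) : Q.IsFirstOrder d 0 := by
  rw [IsFirstOrder, smul_zero, add_zero]
  refine (Q.deform.noHbarTorsion_tensor₂ hU).cancel ?_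
  have h₁ := Q.comul.Δ_left a 1
  have h₂ := Q.comul.Δ_right a 1
  have h₃ := MapsDeformation.mk₂_β_tmul (S := Q.maps) a 1 1
  rw [mul_one, Q.comul.Δ_one, MapsDeformation.leftAct_mk₂, mul_one] at h₁
  rw [mul_one, Q.comul.Δ_one, MapsDeformation.rightAct_mk₂, mul_one] at h₂
  rw [mul_one, mul_one] at h₃
  rw [← map_smul, smul_add, ← map_smul, ← map_smul, TensorProduct.smul_tmul',
    ← TensorProduct.tmul_smul, hd, map_sub, h₁, h₂, TensorProduct.sub_tmul,
    TensorProduct.tmul_sub, map_sub, map_sub, h₃]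
  abel

variable (r : Retraction A) (B : DualSystem R L)
include B

lemma totalRed_eq_ofSec {a : Rh} {d : Hh}
    (hd : (PowerSeries.X : ℝ⟦X⟧) • d = Q.maps.α a - Q.maps.β a) :
    Q.deform.totalRed d = ofSec A (r.proj (Q.deform.totalRed d)) := by
  refine eq_ofSec_of_primitive r B ?_
  have h := congrArg Q.deform.tensorRed (isFirstOrder_zero hU hd)
  rwa [smul_zero, add_zero, Q.comul_mod, map_add, MapsDeformation.tensorRed_mk₂,
    MapsDeformation.tensorRed_mk₂, MapsDeformation.totalRed_one] at h

end Functions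

lemma totalRed_eq_of_baseRed_eq {a a' : Rh} {d d' : Hh}
    (hd : (PowerSeries.X : ℝ⟦X⟧) • d = Q.maps.α a - Q.maps.β a)
    (hd' : (PowerSeries.X : ℝ⟦X⟧) • d' = Q.maps.α a' - Q.maps.β a')
    (h : Q.deform.baseRed a = Q.deform.baseRed a') :
    Q.deform.totalRed d = Q.deform.totalRed d' := by
  obtain ⟨b, hb⟩ := Q.deform.isReduction_base.exists_smul (a - a') (by
    rw [map_sub, sub_eq_zero]; exact h)
  have : d - d' = Q.maps.α b - Q.maps.β b := by
    refine Q.deform.noHbarTorsion_total.cancel ?_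
    rw [smul_sub, hd, hd', smul_sub, ← α_smul, ← β_smul, hb, α_sub, β_sub]
    abel
  rw [← sub_eq_zero, ← map_sub, this, map_sub, MapsDeformation.totalRed_α,
    MapsDeformation.totalRed_β, sub_self]

variable (Q) in
/-- The section `δf = lim (α f - β f) / ħ`. -/
def deltaFun (r : Retraction A) (f : R) : L :=
  r.proj (Q.deform.totalRed (Q.exists_sub_eq (Q.deform.liftFun f)).choose)

section Functions

variable (hU : LocallyFiniteRank R (Envelope A)) (r : Retraction A) (B : DualSystem R L)
include hU B

/-- `δf` is computed by any lift of `f`. -/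
lemma totalRed_eq_deltaFun {a : Rh} {d : Hh}
    (hd : (PowerSeries.X : ℝ⟦X⟧) • d = Q.maps.α a - Q.maps.β a) :
    Q.deform.totalRed d = ofSec A (Q.deltaFun r (Q.deform.baseRed a)) := by
  have h := (Q.exists_sub_eq (Q.deform.liftFun (Q.deform.baseRed a))).choose_spec
  rw [deltaFun, ← totalRed_eq_ofSec hU r B h]
  exact totalRed_eq_of_baseRed_eq hd h (by rw [MapsDeformation.baseRed_liftFun])

lemma isDeltaFun_deltaFun (f : R) : Q.IsDeltaFun f (ofSec A (Q.deltaFun r f)) := by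
  have h := (Q.exists_sub_eq (Q.deform.liftFun f)).choose_spec
  have := totalRed_eq_deltaFun hU r B h
  rw [MapsDeformation.baseRed_liftFun] at this
  rw [← this]
  exact Q.deform.noHbarTorsion_total.hbarLimit _ h

lemma deltaFun_add (f g : R) :
    Q.deltaFun r (f + g) = Q.deltaFun r f + Q.deltaFun r g := by
  obtain ⟨a, rfl⟩ := Q.deform.isReduction_base.surjective f
  obtain ⟨b, rfl⟩ := Q.deform.isReduction_base.surjective g
  obtain ⟨d, hd⟩ := Q.exists_sub_eq a
  obtain ⟨e, he⟩ := Q.exists_sub_eq b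
  have h : (PowerSeries.X : ℝ⟦X⟧) • (d + e) = Q.maps.α (a + b) - Q.maps.β (a + b) := by
    rw [smul_add, hd, he, α_add, β_add]; abel
  have h' := totalRed_eq_deltaFun hU r B h
  rw [map_add, totalRed_eq_deltaFun hU r B hd, totalRed_eq_deltaFun hU r B he, ← map_add] at h'
  have := ofSec_injective r h'
  change _ = Q.deltaFun r (Q.deform.baseRedₗ (a + b)) at this
  rw [map_add] at this
  exact this.symm

lemma deltaFun_mul (f g : R) :
    Q.deltaFun r (f * g) = f • Q.deltaFun r g + g • Q.deltaFun r f := by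
  obtain ⟨a, rfl⟩ := Q.deform.isReduction_base.surjective f
  obtain ⟨b, rfl⟩ := Q.deform.isReduction_base.surjective g
  obtain ⟨d, hd⟩ := Q.exists_sub_eq a
  obtain ⟨e, he⟩ := Q.exists_sub_eq b
  have h : (PowerSeries.X : ℝ⟦X⟧) • (Q.maps.α a * e + Q.maps.β b * d)
      = Q.maps.α (a * b) - Q.maps.β (a * b) := by
    rw [smul_add, ← mul_smul_comm, ← mul_smul_comm, hd, he, α_mul, β_mul, mul_sub, mul_sub,
      Q.maps.α_comm_β]
    abel
  have h' := totalRed_eq_deltaFun hU r B h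
  rw [map_add, MapsDeformation.totalRed_mul, MapsDeformation.totalRed_mul,
    totalRed_eq_deltaFun hU r B hd, totalRed_eq_deltaFun hU r B he, MapsDeformation.totalRed_α,
    MapsDeformation.totalRed_β, ← fun_smul_def, ← fun_smul_def, ← map_smul, ← map_smul,
    ← map_add, MapsDeformation.baseRed_mul] at h'
  exact (ofSec_injective r h').symm

lemma deltaFun_const (c : ℝ) : Q.deltaFun r (algebraMap ℝ R c) = 0 := by
  have h : (PowerSeries.X : ℝ⟦X⟧) • (0 : Hh)
      = Q.maps.α (algebraMap _ Rh (PowerSeries.C c)) - Q.maps.β (algebraMap _ Rh (PowerSeries.C c)) := by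
    simp [SourceTarget.α, SourceTarget.β]
  have h' := totalRed_eq_deltaFun hU r B h
  have hc : Q.deform.baseRed (algebraMap _ Rh (PowerSeries.C c)) = algebraMap ℝ R c := by
    rw [Algebra.algebraMap_eq_smul_one, MapsDeformation.baseRed, Q.deform.baseEquiv_smul,
      Q.deform.baseEquiv_one, mul_one, PowerSeries.map_C]
    simp
  rw [map_zero, hc] at h'
  exact (ofSec_injective r (h'.symm.trans (map_zero _).symm))

/-- The commutator of `R_ħ` is to first order the bracket `ρ(δf) g`. -/
lemma baseRed_eq_anchor {a b c : Rh} (h : (PowerSeries.X : ℝ⟦X⟧) • c = a * b - b * a) :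
    Q.deform.baseRed c
      = A.anchor (Q.deltaFun r (Q.deform.baseRed a)) (Q.deform.baseRed b) := by
  obtain ⟨d, hd⟩ := Q.exists_sub_eq a
  have h₁ : Q.maps.α c = d * Q.maps.α b - Q.maps.α b * d := by
    refine Q.deform.noHbarTorsion_total.cancel ?_
    rw [← α_smul, h, smul_sub, ← smul_mul_assoc, ← mul_smul_comm, hd, sub_mul, mul_sub,
      Q.maps.α_comm_β, α_sub, α_mul, α_mul]
    abel
  have h₂ := congrArg Q.deform.totalRed h₁
  rw [map_sub, MapsDeformation.totalRed_mul, MapsDeformation.totalRed_mul,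
    MapsDeformation.totalRed_α, MapsDeformation.totalRed_α, totalRed_eq_deltaFun hU r B hd,
    ofSec_mul_ofFun, add_sub_cancel_left] at h₂
  have h₃ : ∀ f : R, Envelope.counit A (ofFun A f) = f := fun f => by
    have := counit_smul A f 1
    rwa [fun_smul_def, mul_one, counit_one, mul_one] at this
  rw [← h₃ (Q.deform.baseRed c), h₂, h₃]

lemma isStarBracket : Q.IsStarBracket (fun f g => A.anchor (Q.deltaFun r f) g) := by
  intro f g
  obtain ⟨c, hc⟩ := exists_commutator_eq Q (Q.deform.liftFun f) (Q.deform.liftFun g)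
  have := baseRed_eq_anchor (Q := Q) hU r B hc
  rw [MapsDeformation.baseRed_liftFun, MapsDeformation.baseRed_liftFun] at this
  change HbarLimit _ _ (A.anchor _ _)
  rw [← this]
  exact Q.deform.noHbarTorsion_base.hbarLimit _ hc

lemma isPoissonBracket : IsPoissonBracket (fun f g => A.anchor (Q.deltaFun r f) g) where
  smul c f g := by
    simp only [deltaFun_mul hU r B, deltaFun_const hU r B]
    simp [Algebra.smul_def]
  add f g h := by simp only [deltaFun_add hU r B, map_add, Derivation.add_apply]
  skew f g := by
    obtain ⟨a, rfl⟩ := Q.deform.isReduction_base.surjective f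
    obtain ⟨b, rfl⟩ := Q.deform.isReduction_base.surjective g
    obtain ⟨c, hc⟩ := exists_commutator_eq Q a b
    have hc' : (PowerSeries.X : ℝ⟦X⟧) • (-c) = b * a - a * b := by rw [smul_neg, hc, neg_sub]
    have h₁ := baseRed_eq_anchor (Q := Q) hU r B hc
    have h₂ := baseRed_eq_anchor (Q := Q) hU r B hc'
    simp only [MapsDeformation.baseRedₗ_apply]
    rw [← h₁, ← h₂, ← MapsDeformation.baseRedₗ_apply, ← MapsDeformation.baseRedₗ_apply, map_neg,
      neg_neg]
  leibniz f g h := by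
    simp only [Derivation.leibniz, smul_eq_mul]
    ring
  jacobi f g h := by
    obtain ⟨a, rfl⟩ := Q.deform.isReduction_base.surjective f
    obtain ⟨b, rfl⟩ := Q.deform.isReduction_base.surjective g
    obtain ⟨c, rfl⟩ := Q.deform.isReduction_base.surjective h
    obtain ⟨p, hp⟩ := exists_commutator_eq Q b c
    obtain ⟨q, hq⟩ := exists_commutator_eq Q a b
    obtain ⟨s, hs⟩ := exists_commutator_eq Q a c
    obtain ⟨t, ht⟩ := exists_commutator_eq Q a p
    obtain ⟨u, hu⟩ := exists_commutator_eq Q q c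
    obtain ⟨v, hv⟩ := exists_commutator_eq Q b s
    simp only [MapsDeformation.baseRedₗ_apply]
    rw [← baseRed_eq_anchor (Q := Q) hU r B hp, ← baseRed_eq_anchor (Q := Q) hU r B hq,
      ← baseRed_eq_anchor (Q := Q) hU r B hs, ← baseRed_eq_anchor (Q := Q) hU r B ht,
      ← baseRed_eq_anchor (Q := Q) hU r B hu, ← baseRed_eq_anchor (Q := Q) hU r B hv]
    have : t = u + v := by
      refine Q.deform.noHbarTorsion_base.cancel (Q.deform.noHbarTorsion_base.cancel ?_)
      rw [smul_add, ht, hu, hv, smul_sub, smul_add, smul_sub, smul_sub, ← mul_smul_comm _ a p,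
        ← smul_mul_assoc _ p a, hp, ← mul_smul_comm _ c q, ← smul_mul_assoc _ q c, hq,
        ← mul_smul_comm _ b s, ← smul_mul_assoc _ s b, hs]
      noncomm_ring
    rw [this]
    exact map_add Q.deform.baseRedₗ u v

end Functions

end QuantumGroupoid

end QuantumGroupoids

namespace QuantumGroupoids

/-! ### Bivectors -/

section Bivectors

variable {R L : Type*} [CommRing R] [AddCommGroup L] [Module R L]

/-- The projection `X ⊗ Y ↦ X ∧ Y`. -/
def toWedge : L ⊗[R] L →ₗ[R] ⋀[R]^2 L :=
  (LinearMap.mul' R (ExteriorAlgebra R L) ∘ₗ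
    TensorProduct.map (ExteriorAlgebra.ι R) (ExteriorAlgebra.ι R)).codRestrict _ (fun t => by
      induction t using TensorProduct.induction_on with
      | zero => simp
      | tmul X Y =>
        rw [LinearMap.comp_apply, TensorProduct.map_tmul, LinearMap.mul'_apply,
          ExteriorAlgebra.exteriorPower, pow_two]
        exact Submodule.mul_mem_mul (LinearMap.mem_range_self _ X) (LinearMap.mem_range_self _ Y)
      | add s t hs ht => rw [map_add]; exact add_mem hs ht)

@[simp] lemma coe_toWedge_tmul (X Y : L) : (toWedge (X ⊗ₜ[R] Y) : ExteriorAlgebra R L)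
    = ExteriorAlgebra.ι R X * ExteriorAlgebra.ι R Y := rfl

lemma toWedge_tmul (X Y : L) :
    toWedge (X ⊗ₜ[R] Y) = exteriorPower.ιMulti R 2 ![X, Y] := by
  apply Subtype.ext
  rw [coe_toWedge_tmul, exteriorPower.ιMulti_apply_coe, ExteriorAlgebra.ιMulti_apply]
  simp

lemma toWedge_surjective : Function.Surjective (toWedge (R := R) (L := L)) := by
  rw [← LinearMap.range_eq_top, eq_top_iff, ← exteriorPower.ιMulti_span R 2 L, Submodule.span_le]
  rintro _ ⟨v, rfl⟩
  exact ⟨v 0 ⊗ₜ v 1, by rw [toWedge_tmul]; congr 1; ext i; fin_cases i <;> rfl⟩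

lemma wedgeToTensor_toWedge (t : L ⊗[R] L) :
    wedgeToTensor (toWedge t) = t - TensorProduct.comm R L L t := by
  induction t using TensorProduct.induction_on with
  | zero => simp
  | tmul X Y => rw [toWedge_tmul, wedgeToTensor_ιMulti, TensorProduct.comm_tmul]
  | add s t hs ht => rw [map_add, map_add, hs, ht, map_add]; abel

lemma toWedge_comm (t : L ⊗[R] L) : toWedge (TensorProduct.comm R L L t) = -toWedge t := by
  induction t using TensorProduct.induction_on with
  | zero => simp
  | tmul X Y =>
    rw [TensorProduct.comm_tmul]
    apply Subtype.ext
    rw [coe_toWedge_tmul, Submodule.coe_neg, coe_toWedge_tmul]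
    exact eq_neg_of_add_eq_zero_left (ExteriorAlgebra.ι_add_mul_swap Y X)
  | add s t hs ht => rw [map_add, map_add, hs, ht, map_add]; abel

lemma toWedge_wedgeToTensor (w : ⋀[R]^2 L) : toWedge (wedgeToTensor w) = 2 • w := by
  obtain ⟨t, rfl⟩ := toWedge_surjective w
  rw [wedgeToTensor_toWedge, map_sub, toWedge_comm, two_smul, sub_neg_eq_add]

lemma eq_zero_of_two_smul [Algebra ℝ R] {M : Type*} [AddCommGroup M] [Module R M] {m : M}
    (h : 2 • m = 0) : m = 0 :=
  (Envelope.mem_of_nsmul_mem (R := R) ⊥ two_ne_zero (by rw [h]; exact zero_mem _) : m ∈ (⊥ : Submodule R M))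

lemma wedgeToTensor_injective [Algebra ℝ R] :
    Function.Injective (wedgeToTensor (R := R) (L := L)) := by
  rw [injective_iff_map_eq_zero]
  intro w hw
  refine eq_zero_of_two_smul (R := R) ?_
  rw [← toWedge_wedgeToTensor, hw, map_zero]

end Bivectors

open Envelope

namespace QuantumGroupoid

variable {R L : Type*} [CommRing R] [Algebra ℝ R] [AddCommGroup L] [Module R L]
  {A : LieRinehart R L} {Rh Hh : Type*} [Ring Rh] [Algebra ℝ⟦X⟧ Rh]
  [Ring Hh] [Algebra ℝ⟦X⟧ Hh] {Q : QuantumGroupoid A Rh Hh}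

/-! ### First order terms of the coproduct -/

lemma exists_isFirstOrder {h : Hh} {X : L} (hX : Q.deform.totalRed h = ofSec A X) :
    ∃ y, Q.IsFirstOrder h y := by
  obtain ⟨y, hy⟩ := Q.deform.isReduction_tensorRed.exists_smul
    (Q.comul.Δ h - (Q.maps.mk₂ hbarIdeal (h ⊗ₜ 1) + Q.maps.mk₂ hbarIdeal (1 ⊗ₜ h))) (by
      rw [map_sub, map_add, Q.comul_mod, MapsDeformation.tensorRed_mk₂,
        MapsDeformation.tensorRed_mk₂, MapsDeformation.totalRed_one, hX, comul_ofSec, sub_self])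
  exact ⟨y, by rw [IsFirstOrder, hy]; abel⟩

variable (Q) in
/-- The operator whose kernel consists of the cocycles. -/
def cocycleDefect : Q.maps.Tensor₂ hbarIdeal →ₗ[ℝ⟦X⟧] Q.maps.Tensor₃ hbarIdeal :=
  Q.maps.tensorRight hbarIdeal 1 + Q.comul.comulLeft - Q.maps.tensorLeft hbarIdeal 1
    - Q.comul.comulRight

lemma cocycleDefect_apply (y : Q.maps.Tensor₂ hbarIdeal) : Q.cocycleDefect y
    = Q.maps.tensorRight hbarIdeal 1 y + Q.comul.comulLeft y - Q.maps.tensorLeft hbarIdeal 1 y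
      - Q.comul.comulRight y := rfl

lemma cocycleDefect_mk₂ {a b : Hh} {p q : Q.maps.Tensor₂ hbarIdeal} (hp : Q.IsFirstOrder a p)
    (hq : Q.IsFirstOrder b q) :
    Q.cocycleDefect (Q.maps.mk₂ hbarIdeal (a ⊗ₜ b)) = (PowerSeries.X : ℝ⟦X⟧) •
      (Q.maps.tensorRight hbarIdeal b p - Q.maps.tensorLeft hbarIdeal a q) := by
  rw [cocycleDefect_apply, comulLeft_mk₂, comulRight_mk₂, hp, hq]
  simp only [map_add, map_smul, MapsDeformation.tensorRight_mk₂, MapsDeformation.tensorLeft_mk₂,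
    smul_sub]
  abel

lemma tripleRed_cocycleDefect (y : Q.maps.Tensor₂ hbarIdeal) :
    Q.deform.tripleRed (Q.cocycleDefect y)
      = TensorProduct.assoc R _ _ _ (Q.deform.tensorRed y ⊗ₜ[R] (1 : Envelope A))
        + comulL A (Q.deform.tensorRed y) - (1 : Envelope A) ⊗ₜ[R] Q.deform.tensorRed y
        - comulR A (Q.deform.tensorRed y) := by
  rw [cocycleDefect_apply, map_sub, map_sub, map_add, MapsDeformation.tripleRed_tensorRight,
    MapsDeformation.tripleRed_tensorLeft, tripleRed_comulLeft, tripleRed_comulRight,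
    MapsDeformation.totalRed_one]

section

variable (hU : LocallyFiniteRank R (Envelope A))
include hU

lemma IsFirstOrder.cocycleDefect_eq_zero {h : Hh} {y : Q.maps.Tensor₂ hbarIdeal}
    (hy : Q.IsFirstOrder h y) : Q.cocycleDefect y = 0 := by
  refine Q.deform.noHbarTorsion_tensor₃ hU _ ?_
  have hco := Q.coassoc h
  have h₁ := hy
  rw [IsFirstOrder] at h₁
  rw [h₁, map_add, map_add, map_add, map_add, comulLeft_mk₂, comulRight_mk₂, comulLeft_mk₂,
    comulRight_mk₂, h₁, Q.comul.Δ_one] at hco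
  simp only [map_add, map_smul, MapsDeformation.tensorRight_mk₂, MapsDeformation.tensorLeft_mk₂]
    at hco
  rw [← sub_eq_zero] at hco
  rw [cocycleDefect_apply, smul_sub, smul_sub, smul_add, ← hco]
  abel

lemma IsFirstOrder.isCocycle {h : Hh} {y : Q.maps.Tensor₂ hbarIdeal}
    (hy : Q.IsFirstOrder h y) : IsCocycle (Q.deform.tensorRed y) := by
  have := congrArg Q.deform.tripleRed (hy.cocycleDefect_eq_zero hU)
  rw [tripleRed_cocycleDefect, map_zero, sub_sub, sub_eq_zero] at this
  exact this

/-- The first order terms of two lifts of the same element differ by a coboundary. -/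
lemma IsFirstOrder.exists_cobound {h h' : Hh} {y y' : Q.maps.Tensor₂ hbarIdeal}
    (hy : Q.IsFirstOrder h y) (hy' : Q.IsFirstOrder h' y')
    (hh : Q.deform.totalRed h = Q.deform.totalRed h') :
    ∃ u, Q.deform.tensorRed y - Q.deform.tensorRed y' = cobound A u := by
  obtain ⟨k, hk⟩ := Q.deform.isReduction_total.exists_smul (h - h') (by
    rw [map_sub, sub_eq_zero, hh])
  have : y - y' = Q.comul.Δ k - Q.maps.mk₂ hbarIdeal (k ⊗ₜ 1) - Q.maps.mk₂ hbarIdeal (1 ⊗ₜ k) := by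
    refine (Q.deform.noHbarTorsion_tensor₂ hU).cancel ?_
    rw [IsFirstOrder] at hy hy'
    rw [smul_sub, smul_sub, smul_sub, ← map_smul, ← map_smul, ← map_smul,
      TensorProduct.smul_tmul', ← TensorProduct.tmul_smul, hk, map_sub, hy, hy',
      TensorProduct.sub_tmul, TensorProduct.tmul_sub, map_sub, map_sub]
    abel
  refine ⟨Q.deform.totalRed k, ?_⟩
  rw [← map_sub, this, map_sub, map_sub, Q.comul_mod, MapsDeformation.tensorRed_mk₂,
    MapsDeformation.tensorRed_mk₂, MapsDeformation.totalRed_one, cobound_apply]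

end

omit Q in
lemma IsFirstOrder.add {Q : QuantumGroupoid A Rh Hh} {h h' : Hh}
    {y y' : Q.maps.Tensor₂ hbarIdeal} (hy : Q.IsFirstOrder h y)
    (hy' : Q.IsFirstOrder h' y') : Q.IsFirstOrder (h + h') (y + y') := by
  rw [IsFirstOrder] at *
  rw [map_add, hy, hy', TensorProduct.add_tmul, TensorProduct.tmul_add, map_add, map_add, smul_add]
  abel

lemma IsFirstOrder.left {h d : Hh} {a : Rh} {y : Q.maps.Tensor₂ hbarIdeal}
    (hy : Q.IsFirstOrder h y) (hd : (PowerSeries.X : ℝ⟦X⟧) • d = Q.maps.α a - Q.maps.β a) :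
    Q.IsFirstOrder (Q.maps.α a * h)
      (Q.maps.leftAct hbarIdeal a y + Q.maps.mk₂ hbarIdeal (d ⊗ₜ h)) := by
  have h₃ := MapsDeformation.mk₂_β_tmul (S := Q.maps) a 1 h
  rw [mul_one] at h₃
  have hd' : (PowerSeries.X : ℝ⟦X⟧) • Q.maps.mk₂ hbarIdeal (d ⊗ₜ h)
      = Q.maps.mk₂ hbarIdeal (Q.maps.α a ⊗ₜ h)
        - Q.maps.mk₂ hbarIdeal (1 ⊗ₜ (Q.maps.α a * h)) := by
    rw [← map_smul, TensorProduct.smul_tmul', hd, TensorProduct.sub_tmul, map_sub, h₃]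
  rw [IsFirstOrder] at *
  rw [Q.comul.Δ_left, hy, map_add, map_add, MapsDeformation.leftAct_mk₂,
    MapsDeformation.leftAct_mk₂, mul_one, map_smul, smul_add, hd']
  abel

lemma IsFirstOrder.sub_smul {h : Hh} {y : Q.maps.Tensor₂ hbarIdeal}
    (hy : Q.IsFirstOrder h y) (k : Hh) : Q.IsFirstOrder (h - (PowerSeries.X : ℝ⟦X⟧) • k)
      (y - (Q.comul.Δ k - Q.maps.mk₂ hbarIdeal (k ⊗ₜ 1) - Q.maps.mk₂ hbarIdeal (1 ⊗ₜ k))) := by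
  rw [IsFirstOrder] at *
  rw [map_sub, map_smul, hy, TensorProduct.sub_tmul, TensorProduct.tmul_sub, map_sub, map_sub,
    ← TensorProduct.smul_tmul', TensorProduct.tmul_smul, map_smul, map_smul, smul_sub, smul_sub,
    smul_sub]
  abel

lemma IsFirstOrder.commutator {h k : Hh} {y z : Q.maps.Tensor₂ hbarIdeal}
    (hy : Q.IsFirstOrder h y) (hz : Q.IsFirstOrder k z) : Q.IsFirstOrder (h * k - k * h)
      ((Q.comul.act h z - Q.maps.rightMul hbarIdeal (h ⊗ₜ 1 + 1 ⊗ₜ h) z)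
        - (Q.comul.act k y - Q.maps.rightMul hbarIdeal (k ⊗ₜ 1 + 1 ⊗ₜ k) y)) := by
  have key : ∀ {h k : Hh} {y z : Q.maps.Tensor₂ hbarIdeal} (_ : Q.IsFirstOrder h y)
      (_ : Q.IsFirstOrder k z), Q.comul.Δ (h * k) = Q.maps.mk₂ hbarIdeal ((h * k) ⊗ₜ 1)
        + Q.maps.mk₂ hbarIdeal (k ⊗ₜ h) + Q.maps.mk₂ hbarIdeal (h ⊗ₜ k)
        + Q.maps.mk₂ hbarIdeal (1 ⊗ₜ (h * k)) + (PowerSeries.X : ℝ⟦X⟧) • (Q.comul.act h z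
          + Q.maps.rightMul hbarIdeal (k ⊗ₜ 1 + 1 ⊗ₜ k) y) := by
    intro h k y z hy hz
    rw [IsFirstOrder] at hy hz
    rw [Q.comul_mul, hz, map_add, map_add, act_mk₂, act_mk₂, hy]
    simp only [map_add, map_smul, MapsDeformation.rightMul_mk₂,
      Algebra.TensorProduct.tmul_mul_tmul, mul_one, one_mul, LinearMap.add_apply, smul_add]
    abel
  rw [IsFirstOrder, map_sub, key hy hz, key hz hy, TensorProduct.sub_tmul, TensorProduct.tmul_sub,
    map_sub, map_sub]
  simp only [smul_sub, smul_add]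
  abel

/-! ### The operator `δ` on sections -/

section Sections

variable (r : Retraction A)

/-- The map `u ⊗ v ↦ π(u) ∧ π(v)`. -/
def bivector : Envelope A ⊗[R] Envelope A →ₗ[R] ⋀[R]^2 L :=
  toWedge ∘ₗ TensorProduct.map r.proj r.proj

lemma coe_bivector_tmul (u v : Envelope A) : (bivector r (u ⊗ₜ v) : ExteriorAlgebra R L)
    = ExteriorAlgebra.ι R (r.proj u) * ExteriorAlgebra.ι R (r.proj v) := rfl

lemma bivector_comm (t : Envelope A ⊗[R] Envelope A) :
    bivector r (TensorProduct.comm R _ _ t) = -bivector r t := by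
  rw [bivector, LinearMap.comp_apply, LinearMap.comp_apply, ← toWedge_comm]
  congr 1
  induction t using TensorProduct.induction_on with
  | zero => simp
  | tmul u v => simp
  | add s t hs ht => simp only [map_add, hs, ht]

lemma bivector_comul (u : Envelope A) : bivector r (comul A u) = 0 := by
  refine eq_zero_of_two_smul (R := R) ?_
  have := bivector_comm r (comul A u)
  rw [comm_comul] at this
  rw [two_smul]
  exact eq_neg_iff_add_eq_zero.1 this

lemma bivector_cobound (u : Envelope A) : bivector r (cobound A u) = 0 := by
  rw [cobound_apply, map_sub, map_sub, bivector_comul]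
  simp [bivector, r.proj_one]

lemma wedgeToTensor_bivector (t : Envelope A ⊗[R] Envelope A) : wedgeToTensor (bivector r t)
    = TensorProduct.map r.proj r.proj (t - TensorProduct.comm R _ _ t) := by
  rw [bivector, LinearMap.comp_apply, wedgeToTensor_toWedge, map_sub]
  congr 1
  induction t using TensorProduct.induction_on with
  | zero => simp
  | tmul u v => simp
  | add s t hs ht => simp only [map_add, hs, ht]

variable (Q) in
/-- The bivector `δX = Δ¹X - Δ¹_op X`. -/
def deltaSec (X : L) : ⋀[R]^2 L :=
  bivector r (Q.deform.tensorRed (exists_isFirstOrder (Q := Q)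
    (Q.deform.totalRed_liftTotal (ofSec A X))).choose)

variable (hU : LocallyFiniteRank R (Envelope A))
include hU

/-- `δX` is computed by any lift of `X`. -/
lemma IsFirstOrder.bivector_eq {h : Hh} {y : Q.maps.Tensor₂ hbarIdeal} {X : L}
    (hy : Q.IsFirstOrder h y) (hX : Q.deform.totalRed h = ofSec A X) :
    bivector r (Q.deform.tensorRed y) = Q.deltaSec r X := by
  have hz := (exists_isFirstOrder (Q := Q)
    (Q.deform.totalRed_liftTotal (ofSec A X))).choose_spec
  obtain ⟨u, hu⟩ := hy.exists_cobound hU hz (by rw [hX, Q.deform.totalRed_liftTotal])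
  rw [← sub_eq_zero, deltaSec, ← map_sub, hu, bivector_cobound]

lemma deltaSec_add (X Y : L) : Q.deltaSec r (X + Y) = Q.deltaSec r X + Q.deltaSec r Y := by
  obtain ⟨h, hX⟩ := Q.deform.isReduction_total.surjective (ofSec A X)
  obtain ⟨k, hY⟩ := Q.deform.isReduction_total.surjective (ofSec A Y)
  obtain ⟨y, hy⟩ := exists_isFirstOrder hX
  obtain ⟨z, hz⟩ := exists_isFirstOrder hY
  rw [← hy.bivector_eq r hU hX, ← hz.bivector_eq r hU hY,
    ← (hy.add hz).bivector_eq r hU (X := X + Y) (by rw [map_add, hX, hY, map_add]), map_add, map_add]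

variable (B : DualSystem R L)
include B

lemma deltaSec_smul (f : R) (X : L) :
    Q.deltaSec r (f • X) = toWedge (Q.deltaFun r f ⊗ₜ[R] X) + f • Q.deltaSec r X := by
  obtain ⟨h, hX⟩ := Q.deform.isReduction_total.surjective (ofSec A X)
  obtain ⟨a, rfl⟩ := Q.deform.isReduction_base.surjective f
  obtain ⟨d, hd⟩ := Q.exists_sub_eq a
  obtain ⟨y, hy⟩ := exists_isFirstOrder hX
  rw [← hy.bivector_eq r hU hX, ← (hy.left hd).bivector_eq r hU (X := Q.deform.baseRedₗ a • X)
    (by rw [MapsDeformation.totalRed_mul, MapsDeformation.totalRed_α, hX, map_smul]; rfl),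
    map_add, MapsDeformation.tensorRed_leftAct, MapsDeformation.tensorRed_mk₂,
    totalRed_eq_deltaFun hU r B hd, hX, map_add, map_smul, add_comm]
  congr 1
  simp [bivector, r.proj_ofSec]

lemma deltaSec_deltaFun (f : R) : Q.deltaSec r (Q.deltaFun r f) = 0 := by
  obtain ⟨d, hd⟩ := Q.exists_sub_eq (Q.deform.liftFun f)
  have hf := totalRed_eq_deltaFun hU r B hd
  rw [MapsDeformation.baseRed_liftFun] at hf
  rw [← (isFirstOrder_zero hU hd).bivector_eq r hU hf, map_zero, map_zero]

/-- The skew part of the first order term is the bivector `δX`. -/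
lemma IsFirstOrder.skew_eq {h : Hh} {y : Q.maps.Tensor₂ hbarIdeal} {X : L}
    (hy : Q.IsFirstOrder h y) (hX : Q.deform.totalRed h = ofSec A X) :
    TensorProduct.map (ofSec A) (ofSec A) (wedgeToTensor (Q.deltaSec r X))
      = Q.deform.tensorRed y - TensorProduct.comm R _ _ (Q.deform.tensorRed y) := by
  rw [← hy.bivector_eq r hU hX, wedgeToTensor_bivector]
  have := IsCocycle.skew_eq r B (hy.isCocycle hU)
  rwa [TensorProduct.map_comp, LinearMap.comp_apply] at this

lemma exists_isDeltaOne (X : L) : ∃ t, Q.IsDeltaOne X t ∧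
    TensorProduct.map (ofSec A) (ofSec A) (wedgeToTensor (Q.deltaSec r X))
      = t - TensorProduct.comm R _ _ t := by
  have hX := Q.deform.totalRed_liftTotal (ofSec A X)
  obtain ⟨y, hy⟩ := exists_isFirstOrder hX
  refine ⟨_, (Q.deform.noHbarTorsion_tensor₂ hU).hbarLimit _ (y := y) ?_, hy.skew_eq r hU B hX⟩
  rw [IsFirstOrder] at hy
  rw [hy, map_add]
  abel

/-- The commutator with a section, on pairs of elements. -/
def adTensor (X : L) (t : Envelope A ⊗[R] Envelope A) : Envelope A ⊗[R] Envelope A :=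
  tensorAct A (ofSec A X) t - TensorProduct.map (mulRight A (ofSec A X)) (mulRight A 1) t
    - TensorProduct.map (mulRight A 1) (mulRight A (ofSec A X)) t

omit hU B in
lemma adTensor_sub (X : L) (s t : Envelope A ⊗[R] Envelope A) :
    adTensor X (s - t) = adTensor X s - adTensor X t := by
  simp only [adTensor, map_sub]; abel

omit hU B in
lemma adTensor_add (X : L) (s t : Envelope A ⊗[R] Envelope A) :
    adTensor X (s + t) = adTensor X s + adTensor X t := by
  simp only [adTensor, map_add]; abel

omit hU B in
lemma adTensor_tmul (X : L) (u v : Envelope A) : adTensor X (u ⊗ₜ[R] v)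
    = (ofSec A X * u - u * ofSec A X) ⊗ₜ[R] v + u ⊗ₜ[R] (ofSec A X * v - v * ofSec A X) := by
  simp only [adTensor, tensorAct_tmul, comul_ofSec, map_add, TensorProduct.map_tmul,
    mulRight_apply, mul_one, one_mul, TensorProduct.sub_tmul, TensorProduct.tmul_sub]
  abel

omit hU B in
lemma adTensor_zero (X : L) : adTensor X (0 : Envelope A ⊗[R] Envelope A) = 0 := by
  simp [adTensor]

omit hU B in
lemma comm_adTensor (X : L) (t : Envelope A ⊗[R] Envelope A) :
    TensorProduct.comm R _ _ (adTensor X t) = adTensor X (TensorProduct.comm R _ _ t) := by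
  induction t using TensorProduct.induction_on with
  | zero => simp [adTensor_zero]
  | tmul u v => simp [adTensor_tmul, add_comm]
  | add s t hs ht => simp only [adTensor_add, map_add, hs, ht]

omit hU B in
lemma adTensor_map_ofSec (X : L) (t : L ⊗[R] L) :
    adTensor X (TensorProduct.map (ofSec A) (ofSec A) t)
      = TensorProduct.map (ofSec A) (ofSec A) (A.lieDeriv X t) := by
  induction t using TensorProduct.induction_on with
  | zero => simp [adTensor_zero]
  | tmul Y Z =>
    rw [TensorProduct.map_tmul, adTensor_tmul, ofSec_mul_ofSec A X Y, ofSec_mul_ofSec A X Z]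
    simp [LieRinehart.lieDeriv]
  | add s t hs ht => simp only [adTensor_add, map_add, hs, ht]

omit hU B in
lemma map_proj_map_ofSec (t : L ⊗[R] L) :
    TensorProduct.map r.proj r.proj (TensorProduct.map (ofSec A) (ofSec A) t) = t := by
  induction t using TensorProduct.induction_on with
  | zero => simp
  | tmul X Y => simp [r.proj_ofSec]
  | add s t hs ht => simp only [map_add, hs, ht]

/-- `δ` is a derivation of the Schouten bracket. -/
theorem wedgeToTensor_deltaSec_bracket (X Y : L) :
    wedgeToTensor (Q.deltaSec r (A.bracket X Y))
      = -A.lieDeriv Y (wedgeToTensor (Q.deltaSec r X))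
        + A.lieDeriv X (wedgeToTensor (Q.deltaSec r Y)) := by
  obtain ⟨h, hX⟩ := Q.deform.isReduction_total.surjective (ofSec A X)
  obtain ⟨k, hY⟩ := Q.deform.isReduction_total.surjective (ofSec A Y)
  obtain ⟨y, hy⟩ := exists_isFirstOrder hX
  obtain ⟨z, hz⟩ := exists_isFirstOrder hY
  have hXY : Q.deform.totalRed (h * k - k * h) = ofSec A (A.bracket X Y) := by
    rw [map_sub, MapsDeformation.totalRed_mul, MapsDeformation.totalRed_mul, hX, hY,
      ofSec_mul_ofSec A X Y, add_sub_cancel_left]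
  have hred : ∀ {h : Hh} {X : L} (z : Q.maps.Tensor₂ hbarIdeal),
      Q.deform.totalRed h = ofSec A X → Q.deform.tensorRed
        (Q.comul.act h z - Q.maps.rightMul hbarIdeal (h ⊗ₜ 1 + 1 ⊗ₜ h) z)
        = adTensor X (Q.deform.tensorRed z) := by
    intro h X z hX
    rw [map_sub, map_add, LinearMap.add_apply, map_add, tensorRed_act,
      MapsDeformation.tensorRed_rightMul, MapsDeformation.tensorRed_rightMul, hX,
      MapsDeformation.totalRed_one, adTensor]
    abel
  have hs := (hy.commutator hz).skew_eq r hU B hXY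
  rw [map_sub, hred z hX, hred y hY, map_sub (TensorProduct.comm R _ _), comm_adTensor,
    comm_adTensor, sub_sub_sub_comm, ← adTensor_sub, ← adTensor_sub,
    ← hy.skew_eq r hU B hX, ← hz.skew_eq r hU B hY, adTensor_map_ofSec,
    adTensor_map_ofSec] at hs
  rw [← map_proj_map_ofSec r (wedgeToTensor (Q.deltaSec r (A.bracket X Y))), hs, map_sub,
    map_proj_map_ofSec, map_proj_map_ofSec]
  abel

omit hU B in
lemma isCocycle_map_ofSec (t : L ⊗[R] L) :
    IsCocycle (TensorProduct.map (ofSec A) (ofSec A) t) := by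
  induction t using TensorProduct.induction_on with
  | zero => simp [IsCocycle]
  | tmul X Y =>
    simp only [IsCocycle, TensorProduct.map_tmul, comulL_tmul, comulR_tmul, comul_ofSec,
      TensorProduct.add_tmul, TensorProduct.tmul_add, map_add, TensorProduct.assoc_tmul]
    abel
  | add s t hs ht =>
    simp only [IsCocycle, map_add, TensorProduct.add_tmul, TensorProduct.tmul_add] at *
    rw [add_add_add_comm, hs, ht]
    abel

/-- The map `u ⊗ v ⊗ w ↦ π(u) ∧ π(v) ∧ π(w)`. -/
def trivector : Envelope A ⊗[R] (Envelope A ⊗[R] Envelope A) →ₗ[R] ExteriorAlgebra R L :=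
  LinearMap.mul' R _ ∘ₗ TensorProduct.map (ExteriorAlgebra.ι R ∘ₗ r.proj)
    ((⋀[R]^2 L).subtype ∘ₗ bivector r)

omit hU B in
lemma trivector_tmul (u : Envelope A) (t : Envelope A ⊗[R] Envelope A) :
    trivector r (u ⊗ₜ t) = ExteriorAlgebra.ι R (r.proj u) * bivector r t := by
  simp [trivector]

omit hU B in
lemma trivector_assoc (t : Envelope A ⊗[R] Envelope A) (w : Envelope A) :
    trivector r (TensorProduct.assoc R _ _ _ (t ⊗ₜ[R] w))
      = bivector r t * ExteriorAlgebra.ι R (r.proj w) := by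
  induction t using TensorProduct.induction_on with
  | zero => simp
  | tmul u v =>
    rw [TensorProduct.assoc_tmul, trivector_tmul, coe_bivector_tmul, coe_bivector_tmul, mul_assoc]
  | add s t hs ht =>
    rw [TensorProduct.add_tmul, map_add, map_add, hs, ht, map_add, Submodule.coe_add, add_mul]

omit hU B in
lemma trivector_tripleRed_cocycleDefect (z : Q.maps.Tensor₂ hbarIdeal) :
    trivector r (Q.deform.tripleRed (Q.cocycleDefect z)) = 0 := by
  rw [tripleRed_cocycleDefect]
  induction Q.deform.tensorRed z using TensorProduct.induction_on with
  | zero => simp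
  | tmul u v =>
    simp only [map_sub, map_add, trivector_assoc, trivector_tmul, comulL_tmul, comulR_tmul,
      r.proj_one, bivector_comul]
    simp
  | add s t hs ht =>
    rw [← add_zero (0 : ExteriorAlgebra R L)]
    nth_rewrite 1 [← hs]
    rw [← ht]
    simp only [map_sub, map_add, TensorProduct.add_tmul, TensorProduct.tmul_add]
    abel

/-- The relation behind `δ(δX) = 0`: after a change of the lift of `X` by a multiple of `ħ`, the
first order term of its coproduct is a bivector modulo `ħ`, and the next order of the cocycle
identity gives the claim. -/
theorem exists_deltaSec_eq_sum (X : L) : ∃ S : Finset (L × L),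
    Q.deltaSec r X = ∑ p ∈ S, toWedge (p.1 ⊗ₜ[R] p.2) ∧
      ∑ p ∈ S, ((Q.deltaSec r p.1 : ExteriorAlgebra R L) * ExteriorAlgebra.ι R p.2
        - ExteriorAlgebra.ι R p.1 * (Q.deltaSec r p.2 : ExteriorAlgebra R L)) = 0 := by
  classical
  obtain ⟨h, hX⟩ := Q.deform.isReduction_total.surjective (ofSec A X)
  obtain ⟨y, hy⟩ := exists_isFirstOrder hX
  obtain ⟨c, hc⟩ := exists_inv_smul R 2 two_ne_zero
  set s := Q.deform.tensorRed y - TensorProduct.comm R _ _ (Q.deform.tensorRed y) with hs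
  set t : L ⊗[R] L := c • wedgeToTensor (Q.deltaSec r X) with ht
  have hst : c • s = TensorProduct.map (ofSec A) (ofSec A) t := by
    rw [ht, map_smul, hy.skew_eq r hU B hX]
  have hcomm : TensorProduct.comm R _ _ s = -s := by
    rw [hs, map_sub, ← LinearEquiv.trans_apply]
    simp
  have hc' : s = c • s + c • s := by
    rw [← add_smul, ← two_mul, mul_comm]
    norm_cast at hc ⊢
    rw [hc, one_smul]
  -- the symmetric part of the cocycle is a coboundary, which a change of the lift removes
  obtain ⟨u, hu⟩ := IsCocycle.exists_cobound r B (comul_coassoc Q)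
    (y := Q.deform.tensorRed y - c • s)
    ((hy.isCocycle hU).sub (hst ▸ isCocycle_map_ofSec t)) (by
      rw [map_sub, map_smul, hcomm, smul_neg, sub_neg_eq_add, eq_sub_iff_add_eq, add_assoc,
        ← hc', hs]
      abel)
  obtain ⟨k, hk⟩ := Q.deform.isReduction_total.surjective u
  have hy' := hy.sub_smul k
  set y' := y - (Q.comul.Δ k - Q.maps.mk₂ hbarIdeal (k ⊗ₜ 1) - Q.maps.mk₂ hbarIdeal (1 ⊗ₜ k))
    with hy'_def
  have hred : Q.deform.tensorRed y' = TensorProduct.map (ofSec A) (ofSec A) t := by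
    rw [hy'_def, map_sub, map_sub, map_sub, Q.comul_mod, MapsDeformation.tensorRed_mk₂,
      MapsDeformation.tensorRed_mk₂, MapsDeformation.totalRed_one, hk, ← cobound_apply, hu, ← hst]
    abel
  obtain ⟨S, hS⟩ := TensorProduct.exists_finset t
  refine ⟨S, ?_, ?_⟩
  · rw [← hy'.bivector_eq r hU (X := X) (by rw [map_sub, red_X_smul, hX, sub_zero]), hred, bivector,
      LinearMap.comp_apply, map_proj_map_ofSec, hS, map_sum]
  · choose lift hlift using fun Y => Q.deform.isReduction_total.surjective (ofSec A Y)
    choose p hp using fun Y => exists_isFirstOrder (hlift Y)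
    obtain ⟨z, hz⟩ := Q.deform.isReduction_tensorRed.exists_smul
      (y' - ∑ i ∈ S, Q.maps.mk₂ hbarIdeal (lift i.1 ⊗ₜ lift i.2)) (by
        rw [map_sub, map_sum, hred, hS, map_sum, sub_eq_zero]
        refine Finset.sum_congr rfl fun i _ => ?_
        rw [MapsDeformation.tensorRed_mk₂, hlift, hlift, TensorProduct.map_tmul])
    have hzero : ∑ i ∈ S, (Q.maps.tensorRight hbarIdeal (lift i.2) (p i.1)
        - Q.maps.tensorLeft hbarIdeal (lift i.1) (p i.2)) + Q.cocycleDefect z = 0 := by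
      refine Q.deform.noHbarTorsion_tensor₃ hU _ ?_
      rw [smul_add, Finset.smul_sum, ← map_smul, hz, map_sub, hy'.cocycleDefect_eq_zero hU,
        zero_sub, map_sum, ← sub_eq_add_neg, sub_eq_zero]
      exact Finset.sum_congr rfl fun i _ => (cocycleDefect_mk₂ (hp _) (hp _)).symm
    have := congrArg (fun w => trivector r (Q.deform.tripleRed w)) hzero
    simp only [map_add, map_sum, map_sub, trivector_tripleRed_cocycleDefect, add_zero,
      MapsDeformation.tripleRed_tensorRight, MapsDeformation.tripleRed_tensorLeft,
      trivector_assoc, trivector_tmul, hlift, r.proj_ofSec,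
      fun Y => (hp Y).bivector_eq r hU (hlift Y), map_zero] at this
    exact this

end Sections

end QuantumGroupoid

end QuantumGroupoids

namespace QuantumGroupoids

/-! ### Derivations of the exterior algebra -/

section Exterior

variable {R L : Type*} [CommRing R] [AddCommGroup L] [Module R L]

open ExteriorAlgebra

/-- The parity automorphism of the exterior algebra. -/
abbrev parity : ExteriorAlgebra R L →ₐ[R] ExteriorAlgebra R L := CliffordAlgebra.involute

lemma parity_ι (X : L) : parity (ι R X) = -ι R X := CliffordAlgebra.involute_ι X

lemma ι_mul_eq (X : L) (a : ExteriorAlgebra R L) : ι R X * a = parity a * ι R X := by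
  induction a using ExteriorAlgebra.induction with
  | algebraMap f => rw [AlgHom.commutes, Algebra.commutes]
  | ι Y =>
    rw [parity_ι, neg_mul]
    exact eq_neg_of_add_eq_zero_left (ι_add_mul_swap X Y)
  | mul a b ha hb => rw [← mul_assoc, ha, mul_assoc, hb, map_mul, mul_assoc]
  | add a b ha hb => rw [mul_add, ha, hb, map_add, add_mul]

lemma parity_of_mem {k : ℕ} {a : ExteriorAlgebra R L} (ha : a ∈ ⋀[R]^k L) :
    parity a = (-1) ^ k * a := by
  rw [exteriorPower] at ha
  induction ha using Submodule.pow_induction_on_left' with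
  | algebraMap f => simp
  | add x y i _ _ hx hy => rw [map_add, hx, hy, mul_add]
  | mem_mul m hm i x _ hx =>
    obtain ⟨X, rfl⟩ := hm
    rw [map_mul, hx, parity_ι, pow_succ, mul_assoc, neg_mul, ← mul_assoc (ι R X),
      ((Commute.neg_one_right (ι R X)).pow_right i).eq]
    simp [mul_assoc]

lemma ι_mul_bivector (X : L) (w : ⋀[R]^2 L) :
    ι R X * (w : ExteriorAlgebra R L) = w * ι R X := by
  rw [ι_mul_eq, parity_of_mem w.2]; simp

end Exterior

/-- The restriction of a derivation of degree one of the exterior algebra to functions and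
sections. -/
structure PreDifferential (R L : Type*) [CommRing R] [Algebra ℝ R] [AddCommGroup L]
    [Module R L] where
  onFun : R →+ L
  onSec : L →+ ⋀[R]^2 L
  onFun_mul : ∀ f g, onFun (f * g) = f • onFun g + g • onFun f
  onFun_const : ∀ c : ℝ, onFun (algebraMap ℝ R c) = 0
  onSec_smul : ∀ f X, onSec (f • X) = toWedge (onFun f ⊗ₜ[R] X) + f • onSec X

open ExteriorAlgebra

namespace PreDifferential

variable {R L : Type*} [CommRing R] [Algebra ℝ R] [AddCommGroup L] [Module R L]
  (P : PreDifferential R L)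

section Twisted

omit [Algebra ℝ R]

/-- The ring of matrices `(σ(a), b; 0, a)`, where `σ` is the parity automorphism: a ring map
`a ↦ (σ(a), d a; 0, a)` is the same as a graded derivation `d`. -/
def twisted (R L : Type*) [CommRing R] [AddCommGroup L] [Module R L] :
    Subring (Matrix (Fin 2) (Fin 2) (ExteriorAlgebra R L)) where
  carrier := {M | M 1 0 = 0 ∧ M 0 0 = parity (M 1 1)}
  mul_mem' := by
    rintro M N ⟨h₁, h₂⟩ ⟨h₃, h₄⟩
    simp [Matrix.mul_apply, h₁, h₂, h₃, h₄]
  one_mem' := by simp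
  add_mem' := by
    rintro M N ⟨h₁, h₂⟩ ⟨h₃, h₄⟩
    simp [h₁, h₂, h₃, h₄]
  zero_mem' := by simp
  neg_mem' := by
    rintro M ⟨h₁, h₂⟩
    simp [h₁, h₂]

lemma twisted_ext {M N : twisted R L} (h₁ : M.1 1 1 = N.1 1 1) (h₂ : M.1 0 1 = N.1 0 1) :
    M = N := by
  apply Subtype.ext
  ext i j
  fin_cases i <;> fin_cases j
  · change M.1 0 0 = N.1 0 0
    rw [M.2.2, N.2.2, h₁]
  · exact h₂
  · change M.1 1 0 = N.1 1 0
    rw [M.2.1, N.2.1]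
  · exact h₁

lemma twisted_mul_one_one (M N : twisted R L) : (M * N).1 1 1 = M.1 1 1 * N.1 1 1 := by
  change (M.1 * N.1) 1 1 = _
  rw [Matrix.mul_apply, Fin.sum_univ_two, M.2.1, zero_mul, zero_add]

lemma twisted_mul_zero_one (M N : twisted R L) :
    (M * N).1 0 1 = M.1 0 1 * N.1 1 1 + parity (M.1 1 1) * N.1 0 1 := by
  change (M.1 * N.1) 0 1 = _
  rw [Matrix.mul_apply, Fin.sum_univ_two, M.2.2, add_comm]

end Twisted

/-- The action of functions on the twisted matrices. -/
def base : R →+* twisted R L where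
  toFun f := ⟨!![algebraMap R _ f, ι R (P.onFun f); 0, algebraMap R _ f], by simp [twisted]⟩
  map_one' := by
    have : P.onFun 1 = 0 := by simpa using P.onFun_const 1
    refine twisted_ext ?_ ?_ <;> simp [this]
  map_mul' f g := by
    refine twisted_ext ?_ ?_
    · rw [twisted_mul_one_one]; simp
    · rw [twisted_mul_zero_one]
      simp [P.onFun_mul, Algebra.smul_def]
      rw [add_comm, Algebra.commutes g]
  map_zero' := by refine twisted_ext ?_ ?_ <;> simp
  map_add' f g := by refine twisted_ext ?_ ?_ <;> simp

lemma base_commutes (f : R) (M : twisted R L) : P.base f * M = M * P.base f := by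
  refine twisted_ext ?_ ?_
  · rw [twisted_mul_one_one, twisted_mul_one_one]
    change algebraMap R _ f * M.1 1 1 = M.1 1 1 * algebraMap R _ f
    exact Algebra.commutes _ _
  · rw [twisted_mul_zero_one, twisted_mul_zero_one]
    change ι R (P.onFun f) * M.1 1 1 + parity (algebraMap R _ f) * M.1 0 1
      = M.1 0 1 * algebraMap R _ f + parity (M.1 1 1) * ι R (P.onFun f)
    rw [ι_mul_eq, AlgHom.commutes, Algebra.commutes f, add_comm]

/-- The matrix of a section. -/
def secMatrix (X : L) : twisted R L :=
  ⟨!![-ι R X, (P.onSec X : ExteriorAlgebra R L); 0, ι R X], by simp [twisted]⟩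

@[simp] lemma secMatrix_one_one (X : L) : (P.secMatrix X).1 1 1 = ι R X := rfl

@[simp] lemma secMatrix_zero_one (X : L) : (P.secMatrix X).1 0 1 = P.onSec X := rfl

/-- The ring map `a ↦ (σ(a), d a; 0, a)`. -/
def hom : ExteriorAlgebra R L →+* twisted R L :=
  letI : Algebra R (twisted R L) := P.base.toAlgebra' P.base_commutes
  (ExteriorAlgebra.lift R ⟨
    { toFun := P.secMatrix
      map_add' := fun X Y => by refine twisted_ext ?_ ?_ <;> simp
      map_smul' := fun f X => by
        refine twisted_ext ?_ ?_
        · refine Eq.trans ?_ (twisted_mul_one_one (P.base f) _).symm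
          simp [base, Algebra.smul_def]
        · refine Eq.trans ?_ (twisted_mul_zero_one (P.base f) _).symm
          simp [base, P.onSec_smul, Algebra.smul_def] },
    fun X => by
      refine twisted_ext ?_ ?_
      · rw [twisted_mul_one_one]; exact ι_sq_zero X
      · rw [twisted_mul_zero_one]
        change P.onSec X * ι R X + parity (ι R X) * P.onSec X = 0
        rw [parity_ι, neg_mul, ι_mul_bivector, add_neg_cancel]⟩).toRingHom

lemma hom_algebraMap (f : R) : P.hom (algebraMap R _ f) = P.base f :=
  letI : Algebra R (twisted R L) := P.base.toAlgebra' P.base_commutes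
  AlgHom.commutes (ExteriorAlgebra.lift R _) f

lemma hom_ι (X : L) : P.hom (ι R X) = P.secMatrix X :=
  letI : Algebra R (twisted R L) := P.base.toAlgebra' P.base_commutes
  ExteriorAlgebra.lift_ι_apply R _ _ X

lemma hom_one_one (a : ExteriorAlgebra R L) : (P.hom a).1 1 1 = a := by
  induction a using ExteriorAlgebra.induction with
  | algebraMap f => rw [hom_algebraMap]; simp [base]
  | ι X => rw [hom_ι]; simp
  | mul a b ha hb => rw [map_mul, twisted_mul_one_one, ha, hb]
  | add a b ha hb => rw [map_add]; exact congrArg₂ (· + ·) ha hb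

/-- The additive map underlying the derivation. -/
def d : ExteriorAlgebra R L →+ ExteriorAlgebra R L where
  toFun a := (P.hom a).1 0 1
  map_zero' := by simp
  map_add' a b := by simp

lemma d_mul (a b : ExteriorAlgebra R L) : P.d (a * b) = P.d a * b + parity a * P.d b := by
  change (P.hom (a * b)).1 0 1 = _
  rw [map_mul, twisted_mul_zero_one, hom_one_one, hom_one_one]
  rfl

lemma d_algebraMap (f : R) : P.d (algebraMap R _ f) = ι R (P.onFun f) := by
  change (P.hom (algebraMap R _ f)).1 0 1 = _
  rw [hom_algebraMap]; simp [base]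

lemma d_ι (X : L) : P.d (ι R X) = P.onSec X := by
  change (P.hom (ι R X)).1 0 1 = _
  rw [hom_ι]; simp

lemma d_mem {k : ℕ} {a : ExteriorAlgebra R L} (ha : a ∈ ⋀[R]^k L) : P.d a ∈ ⋀[R]^(k + 1) L := by
  rw [exteriorPower] at ha
  induction ha using Submodule.pow_induction_on_left' with
  | algebraMap f =>
    rw [d_algebraMap, exteriorPower, zero_add, pow_one]; exact LinearMap.mem_range_self _ _
  | add x y i _ _ hx hy => rw [map_add]; exact add_mem hx hy
  | mem_mul m hm i x hx hx' =>
    obtain ⟨X, rfl⟩ := hm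
    rw [d_mul, d_ι, parity_ι, neg_mul]
    refine add_mem ?_ (neg_mem ?_)
    · rw [show i.succ + 1 = 2 + i by omega]
      change _ ∈ LinearMap.range (ι R (M := L)) ^ (2 + i)
      rw [pow_add]
      exact Submodule.mul_mem_mul (P.onSec X).2 hx
    · change _ ∈ LinearMap.range (ι R (M := L)) ^ (i + 1 + 1)
      rw [pow_succ']
      exact Submodule.mul_mem_mul (LinearMap.mem_range_self (ι R) X) hx'

/-- The derivation of degree one with the given restrictions to functions and sections. -/
def toDerivation : DegreeOneDerivation R L where
  d := P.d
  smul c a := by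
    rw [Algebra.smul_def, d_mul, d_algebraMap, P.onFun_const, map_zero, zero_mul, zero_add,
      AlgHom.commutes, ← Algebra.smul_def]
  degree _ _ ha := P.d_mem ha
  derivation k a ha b := by rw [d_mul, parity_of_mem ha, mul_assoc]

end PreDifferential

namespace DegreeOneDerivation

variable {R L : Type*} [CommRing R] [Algebra ℝ R] [AddCommGroup L] [Module R L]
  (D D' : DegreeOneDerivation R L)

omit [Algebra ℝ R] in
lemma ι_oneEquiv (a : ⋀[R]^1 L) : ι R (exteriorPower.oneEquiv R L a) = a := by
  obtain ⟨X, rfl⟩ := (exteriorPower.oneEquiv R L).symm.surjective a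
  rw [LinearEquiv.apply_symm_apply, exteriorPower.oneEquiv_symm_apply,
    exteriorPower.ιMulti_apply_coe, ExteriorAlgebra.ιMulti_apply]
  simp

lemma ι_onFun (f : R) : ι R (D.onFun f) = D.d (algebraMap R _ f) := ι_oneEquiv _

lemma coe_onSec (X : L) : (D.onSec X : ExteriorAlgebra R L) = D.d (ι R X) := rfl

lemma d_ι_mul (X : L) (a : ExteriorAlgebra R L) :
    D.d (ι R X * a) = D.onSec X * a - ι R X * D.d a := by
  rw [D.derivation 1 (ι R X) (by
    rw [exteriorPower, pow_one]; exact LinearMap.mem_range_self _ X), coe_onSec, pow_one,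
    neg_one_mul, sub_eq_add_neg]

/-- A derivation of degree one is determined on functions and sections. -/
lemma ext_of (h₀ : ∀ f, D.onFun f = D'.onFun f) (h₁ : ∀ X, D.onSec X = D'.onSec X) : D = D' := by
  refine DegreeOneDerivation.ext (AddMonoidHom.ext fun a => ?_)
  refine DirectSum.Decomposition.inductionOn (fun k => ⋀[R]^k L)
    (motive := fun a => D.d a = D'.d a) (by simp) (fun {k} a => ?_) (fun a b ha hb => by
      rw [map_add, map_add, ha, hb]) a
  obtain ⟨a, ha⟩ := a
  change D.d a = D'.d a
  rw [exteriorPower] at ha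
  induction ha using Submodule.pow_induction_on_left' with
  | algebraMap f => rw [← ι_onFun, ← ι_onFun, h₀]
  | add x y i _ _ hx hy => rw [map_add, map_add, hx, hy]
  | mem_mul m hm i x hx hx' =>
    obtain ⟨X, rfl⟩ := hm
    rw [d_ι_mul, d_ι_mul, h₁, hx']

/-- The square of a derivation of degree one vanishes if it does on functions and sections. -/
lemma d_d_eq_zero (h₀ : ∀ f, D.onSec (D.onFun f) = 0)
    (h₁ : ∀ X, D.d (D.onSec X : ExteriorAlgebra R L) = 0) (a : ExteriorAlgebra R L) :
    D.d (D.d a) = 0 := by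
  refine DirectSum.Decomposition.inductionOn (fun k => ⋀[R]^k L)
    (motive := fun a => D.d (D.d a) = 0) (by simp) (fun {k} a => ?_) (fun a b ha hb => by
      rw [map_add, map_add, ha, hb, add_zero]) a
  obtain ⟨a, ha⟩ := a
  change D.d (D.d a) = 0
  rw [exteriorPower] at ha
  induction ha using Submodule.pow_induction_on_left' with
  | algebraMap f => rw [← ι_onFun, ← coe_onSec, h₀]; rfl
  | add x y i _ _ hx hy => rw [map_add, map_add, hx, hy, add_zero]
  | mem_mul m hm i x hx hx' =>
    obtain ⟨X, rfl⟩ := hm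
    rw [d_ι_mul, map_sub, D.derivation 2 _ (D.onSec X).2, h₁, d_ι_mul, hx']
    simp

end DegreeOneDerivation

namespace PreDifferential

variable {R L : Type*} [CommRing R] [Algebra ℝ R] [AddCommGroup L] [Module R L]
  (P : PreDifferential R L)

lemma toDerivation_onFun (f : R) : P.toDerivation.onFun f = P.onFun f := by
  refine ExteriorAlgebra.ι_leftInverse.injective (?_ : ι R _ = ι R _)
  rw [DegreeOneDerivation.ι_onFun]
  exact P.d_algebraMap f

lemma toDerivation_onSec (X : L) : P.toDerivation.onSec X = P.onSec X :=
  Subtype.ext (P.d_ι X)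

lemma d_toWedge_tmul (X Y : L) : P.d (toWedge (X ⊗ₜ[R] Y))
    = P.onSec X * ι R Y - ι R X * P.onSec Y := by
  rw [coe_toWedge_tmul, d_mul, d_ι, d_ι, parity_ι, neg_mul, sub_eq_add_neg]

end PreDifferential

/-! ### The dual Lie-Rinehart structure -/

section Pairings

variable {R L : Type*} [CommRing R] [AddCommGroup L] [Module R L]

/-- The value of a bivector on two linear forms. -/
def pairing₂ (φ ψ : L →ₗ[R] R) : ⋀[R]^2 L →ₗ[R] R :=
  (TensorProduct.lid R R).toLinearMap ∘ₗ TensorProduct.map φ ψ ∘ₗ wedgeToTensor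

lemma pairing₂_toWedge_tmul (φ ψ : L →ₗ[R] R) (X Y : L) :
    pairing₂ φ ψ (toWedge (X ⊗ₜ[R] Y)) = φ X * ψ Y - φ Y * ψ X := by
  simp [pairing₂, wedgeToTensor_toWedge]

/-- The value of a trivector on three linear forms. -/
def pairing₃ (φ ψ χ : L →ₗ[R] R) : ExteriorAlgebra R L →ₗ[R] R :=
  ExteriorAlgebra.algebraMapInv.toLinearMap ∘ₗ
    CliffordAlgebra.contractLeft (Q := (0 : QuadraticForm R L)) χ ∘ₗ
    CliffordAlgebra.contractLeft (Q := (0 : QuadraticForm R L)) ψ ∘ₗ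
    CliffordAlgebra.contractLeft (Q := (0 : QuadraticForm R L)) φ

lemma contractLeft_ι_mul (φ : L →ₗ[R] R) (X : L) (a : ExteriorAlgebra R L) :
    CliffordAlgebra.contractLeft (Q := (0 : QuadraticForm R L)) φ (ι R X * a)
      = φ X • a - ι R X * CliffordAlgebra.contractLeft (Q := (0 : QuadraticForm R L)) φ a :=
  CliffordAlgebra.contractLeft_ι_mul φ X a

lemma contractLeft_ι (φ : L →ₗ[R] R) (X : L) :
    CliffordAlgebra.contractLeft (Q := (0 : QuadraticForm R L)) φ (ι R X)
      = algebraMap R (ExteriorAlgebra R L) (φ X) :=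
  CliffordAlgebra.contractLeft_ι _ φ X

lemma pairing₃_mul_ι (φ ψ χ : L →ₗ[R] R) (w : ⋀[R]^2 L) (Z : L) :
    pairing₃ φ ψ χ (w * ι R Z)
      = pairing₂ φ ψ w * χ Z - pairing₂ φ χ w * ψ Z + pairing₂ ψ χ w * φ Z := by
  obtain ⟨t, rfl⟩ := toWedge_surjective w
  induction t using TensorProduct.induction_on with
  | zero => simp
  | add s t hs ht =>
    simp only [map_add, Submodule.coe_add, add_mul, hs, ht]
    ring
  | tmul X Y =>
    have h (a : R) : ExteriorAlgebra.algebraMapInv (algebraMap R (ExteriorAlgebra R L) a) = a :=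
      ExteriorAlgebra.algebraMap_leftInverse L a
    have h' (x : ExteriorAlgebra R L) (a : R) : x * algebraMap R _ a = a • x := by
      rw [← Algebra.commutes, Algebra.smul_def]
    simp only [pairing₂_toWedge_tmul, coe_toWedge_tmul, pairing₃, LinearMap.comp_apply, mul_assoc,
      contractLeft_ι_mul, contractLeft_ι, map_sub, map_smul, mul_sub, mul_smul_comm, h', h,
      AlgHom.toLinearMap_apply, smul_eq_mul]
    ring

lemma pairing₂_swap (φ ψ : L →ₗ[R] R) (w : ⋀[R]^2 L) : pairing₂ φ ψ w = -pairing₂ ψ φ w := by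
  obtain ⟨t, rfl⟩ := toWedge_surjective w
  induction t using TensorProduct.induction_on with
  | zero => simp
  | add s t hs ht => rw [map_add, map_add, map_add, hs, ht]; ring
  | tmul X Y => rw [pairing₂_toWedge_tmul, pairing₂_toWedge_tmul]; ring

lemma pairing₂_add_left (φ φ' ψ : L →ₗ[R] R) (w : ⋀[R]^2 L) :
    pairing₂ (φ + φ') ψ w = pairing₂ φ ψ w + pairing₂ φ' ψ w := by
  simp [pairing₂, TensorProduct.map_add_left]

lemma pairing₂_add_right (φ ψ ψ' : L →ₗ[R] R) (w : ⋀[R]^2 L) :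
    pairing₂ φ (ψ + ψ') w = pairing₂ φ ψ w + pairing₂ φ ψ' w := by
  simp [pairing₂, TensorProduct.map_add_right]

lemma pairing₂_smul_right (f : R) (φ ψ : L →ₗ[R] R) (w : ⋀[R]^2 L) :
    pairing₂ φ (f • ψ) w = f * pairing₂ φ ψ w := by
  simp [pairing₂, TensorProduct.map_smul_right]

end Pairings

namespace PreDifferential

variable {R L M : Type*} [CommRing R] [Algebra ℝ R] [AddCommGroup L] [Module R L]
  [AddCommGroup M] [Module R M] (P : PreDifferential R L) (p : M ≃ₗ[R] (L →ₗ[R] R))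

/-- The anchor `⟨ξ, d f⟩` of the dual structure. -/
def dualAnchor : M →ₗ[R] Derivation ℝ R R where
  toFun ξ := Derivation.mk'
    { toFun := fun f => p ξ (P.onFun f)
      map_add' := fun f g => by simp
      map_smul' := fun c f => by
        rw [Algebra.smul_def, P.onFun_mul, P.onFun_const, smul_zero, add_zero, map_smul,
          RingHom.id_apply, smul_eq_mul, ← Algebra.smul_def] }
    (fun f g => by simp [P.onFun_mul])
  map_add' ξ η := by ext f; simp
  map_smul' f ξ := by ext g; simp

lemma dualAnchor_apply (ξ : M) (f : R) : P.dualAnchor p ξ f = p ξ (P.onFun f) := rfl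

/-- The linear form `[ξ, η]`. -/
def dualForm (ξ η : M) : L →ₗ[R] R where
  toFun X := P.dualAnchor p ξ (p η X) - P.dualAnchor p η (p ξ X)
    - pairing₂ (p ξ) (p η) (P.onSec X)
  map_add' X Y := by simp only [map_add]; ring
  map_smul' f X := by
    simp only [map_smul, P.onSec_smul, map_add, pairing₂_toWedge_tmul, smul_eq_mul,
      Derivation.leibniz, RingHom.id_apply, dualAnchor_apply]
    ring

/-- The bracket of the dual structure. -/
def dualBracket (ξ η : M) : M := p.symm (P.dualForm p ξ η)

lemma apply_dualBracket (ξ η : M) (X : L) : p (P.dualBracket p ξ η) X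
    = P.dualAnchor p ξ (p η X) - P.dualAnchor p η (p ξ X)
      - pairing₂ (p ξ) (p η) (P.onSec X) := by
  rw [dualBracket, LinearEquiv.apply_symm_apply]; rfl

variable (h₀ : ∀ f, P.onSec (P.onFun f) = 0)
include h₀

lemma dualAnchor_dualBracket (ξ η : M) (f : R) : P.dualAnchor p (P.dualBracket p ξ η) f
    = P.dualAnchor p ξ (P.dualAnchor p η f) - P.dualAnchor p η (P.dualAnchor p ξ f) := by
  rw [dualAnchor_apply, apply_dualBracket, h₀, map_zero, sub_zero]
  rfl

omit h₀ in
/-- The invariant formula for the differential of a bivector, evaluated on three forms. -/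
lemma pairing₃_d (ξ η ζ : M) (w : ⋀[R]^2 L) : pairing₃ (p ξ) (p η) (p ζ) (P.d w)
    = P.dualAnchor p ξ (pairing₂ (p η) (p ζ) w) - P.dualAnchor p η (pairing₂ (p ξ) (p ζ) w)
      + P.dualAnchor p ζ (pairing₂ (p ξ) (p η) w)
      + pairing₂ (p ξ) (p (P.dualBracket p η ζ)) w - pairing₂ (p (P.dualBracket p ξ η)) (p ζ) w
      - pairing₂ (p η) (p (P.dualBracket p ξ ζ)) w := by
  obtain ⟨t, rfl⟩ := toWedge_surjective w
  induction t using TensorProduct.induction_on with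
  | zero => simp
  | add s t hs ht =>
    simp only [map_add, Submodule.coe_add, hs, ht]
    ring
  | tmul X Y =>
    rw [d_toWedge_tmul, ι_mul_bivector, map_sub, pairing₃_mul_ι, pairing₃_mul_ι]
    simp only [pairing₂_toWedge_tmul, apply_dualBracket, map_sub, Derivation.leibniz, smul_eq_mul]
    ring

/-- The Lie-Rinehart structure on the dual module defined by a differential. -/
def dual (h₁ : ∀ X, P.d (P.onSec X : ExteriorAlgebra R L) = 0) : LieRinehart R M where
  bracket := P.dualBracket p
  anchor := P.dualAnchor p
  add_bracket ξ η ζ := p.injective <| LinearMap.ext fun X => by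
    simp only [map_add, LinearMap.add_apply, apply_dualBracket, pairing₂_add_left,
      Derivation.add_apply]
    ring
  bracket_add ξ η ζ := p.injective <| LinearMap.ext fun X => by
    simp only [map_add, LinearMap.add_apply, apply_dualBracket, pairing₂_add_right,
      Derivation.add_apply]
    ring
  bracket_self ξ := p.injective <| LinearMap.ext fun X => by
    have h : pairing₂ (p ξ) (p ξ) (P.onSec X) = 0 := by
      refine eq_zero_of_two_smul (R := R) ?_
      rw [two_smul]
      exact eq_neg_iff_add_eq_zero.1 (pairing₂_swap _ _ _)
    rw [apply_dualBracket, h, map_zero, LinearMap.zero_apply]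
    ring
  jacobi ξ η ζ := p.injective <| LinearMap.ext fun X => by
    have h := P.pairing₃_d p ξ η ζ (P.onSec X)
    rw [h₁, map_zero] at h
    simp only [map_add, LinearMap.add_apply, apply_dualBracket, P.dualAnchor_dualBracket p h₀,
      map_sub] at h ⊢
    linear_combination h
  leibniz ξ f η := p.injective <| LinearMap.ext fun X => by
    simp only [map_add, map_smul, LinearMap.add_apply, LinearMap.smul_apply, apply_dualBracket,
      pairing₂_smul_right, smul_eq_mul, Derivation.leibniz, Derivation.smul_apply]
    ring
  anchor_bracket := P.dualAnchor_dualBracket p h₀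

lemma isInducedDifferential (h₁ : ∀ X, P.d (P.onSec X : ExteriorAlgebra R L) = 0) :
    IsInducedDifferential (P.dual p h₀ h₁) p.toLinearMap P.toDerivation where
  onFun f ξ := by rw [toDerivation_onFun]; rfl
  onSec X ξ η := by
    rw [toDerivation_onSec]
    change pairing₂ (p ξ) (p η) (P.onSec X) = P.dualAnchor p ξ (p η X)
      - P.dualAnchor p η (p ξ X) - p (P.dualBracket p ξ η) X
    rw [apply_dualBracket]
    ring

end PreDifferential

end QuantumGroupoids

namespace QuantumGroupoids

/-! ### The Poincaré-Birkhoff-Witt theorem for free modules -/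

namespace FreePBW

variable {S N : Type*} [CommRing S] [Algebra ℝ S] [AddCommGroup N] [Module S N]
  (A : LieRinehart S N) {m : ℕ} (b : Module.Basis (Fin m) S N)

/-- Polynomials in `m` variables, as linear combinations of exponents. -/
abbrev Poly (S : Type*) [CommRing S] (m : ℕ) : Type _ := (Fin m →₀ ℕ) →₀ S

section Degree

omit [Algebra ℝ S]

/-- The polynomials of degree at most `k`. -/
def degLE (S : Type*) [CommRing S] (m k : ℕ) : Submodule S (Poly S m) :=
  Finsupp.supported S S {a | a.degree ≤ k}

lemma degLE_mono : Monotone (degLE S m) := fun _ _ h =>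
  Finsupp.supported_mono fun _ ha => le_trans ha h

lemma single_mem_degLE {a : Fin m →₀ ℕ} {k : ℕ} (h : a.degree ≤ k) (c : S) :
    Finsupp.single a c ∈ degLE S m k := Finsupp.single_mem_supported S c h

/-- To check a property on polynomials of bounded degree, check it on monomials. -/
lemma degLE_induction {k : ℕ} {p : Poly S m → Prop} (zero : p 0)
    (add : ∀ u v, p u → p v → p (u + v)) (smul : ∀ (f : S) u, p u → p (f • u))
    (single : ∀ a, a.degree ≤ k → p (Finsupp.single a 1)) {v : Poly S m}
    (hv : v ∈ degLE S m k) : p v := by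
  rw [degLE, Finsupp.supported_eq_span_single] at hv
  induction hv using Submodule.span_induction with
  | mem x hx => obtain ⟨a, ha, rfl⟩ := hx; exact single a ha
  | zero => exact zero
  | add u v _ _ hu hv => exact add u v hu hv
  | smul f u _ hu => exact smul f u hu

end Degree

/-- The operator `xᵢ + ρ(bᵢ) + wᵢ`, where `wᵢ` is linear over functions. -/
def opOf (w : Fin m → (Fin m →₀ ℕ) → Poly S m) (i : Fin m) : Poly S m →ₗ[ℝ] Poly S m :=
  (Finsupp.lmapDomain S ℝ (· + Finsupp.single i 1))
    + Finsupp.mapRange.linearMap ((A.anchor (b i) : Derivation ℝ S S) : S →ₗ[ℝ] S)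
    + (Finsupp.linearCombination S (w i)).restrictScalars ℝ

lemma opOf_single (w : Fin m → (Fin m →₀ ℕ) → Poly S m) (i : Fin m) (a : Fin m →₀ ℕ) :
    opOf A b w i (Finsupp.single a 1) = Finsupp.single (a + Finsupp.single i 1) 1 + w i a := by
  simp [opOf]

lemma opOf_smul (w : Fin m → (Fin m →₀ ℕ) → Poly S m) (i : Fin m) (f : S) (v : Poly S m) :
    opOf A b w i (f • v) = f • opOf A b w i v + A.anchor (b i) f • v := by
  have h₁ : Finsupp.lmapDomain S ℝ (· + Finsupp.single i 1) (f • v)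
      = f • Finsupp.lmapDomain S ℝ (· + Finsupp.single i 1) v := Finsupp.mapDomain_smul f v
  have h₂ : Finsupp.mapRange.linearMap ((A.anchor (b i) : Derivation ℝ S S) : S →ₗ[ℝ] S) (f • v)
      = f • Finsupp.mapRange.linearMap ((A.anchor (b i) : Derivation ℝ S S) : S →ₗ[ℝ] S) v
        + A.anchor (b i) f • v := by
    ext a
    simp [mul_comm]
  simp only [opOf, LinearMap.add_apply, h₁, h₂, LinearMap.coe_restrictScalars, map_smul, smul_add]
  abel

lemma opOf_mem {w : Fin m → (Fin m →₀ ℕ) → Poly S m}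
    (hw : ∀ i a, w i a ∈ degLE S m a.degree) (i : Fin m) {k : ℕ} {v : Poly S m}
    (hv : v ∈ degLE S m k) : opOf A b w i v ∈ degLE S m (k + 1) := by
  have : opOf A b w i v ∈ degLE S m (k + 1) ∧ v ∈ degLE S m (k + 1) := by
    refine degLE_induction (p := fun v => opOf A b w i v ∈ degLE S m (k + 1)
      ∧ v ∈ degLE S m (k + 1)) ⟨by simp, zero_mem _⟩ ?_ ?_ ?_ hv
    · rintro u v ⟨hu, hu'⟩ ⟨hv, hv'⟩
      exact ⟨by rw [map_add]; exact add_mem hu hv, add_mem hu' hv'⟩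
    · rintro f u ⟨hu, hu'⟩
      refine ⟨?_, Submodule.smul_mem _ _ hu'⟩
      rw [opOf_smul]
      exact add_mem (Submodule.smul_mem _ _ hu) (Submodule.smul_mem _ _ hu')
    · intro a ha
      refine ⟨?_, single_mem_degLE (by omega) 1⟩
      rw [opOf_single]
      exact add_mem (single_mem_degLE (by simp; omega) 1) (degLE_mono (by omega) (hw i a))
  exact this.1

lemma opOf_congr {w w' : Fin m → (Fin m →₀ ℕ) → Poly S m} {k : ℕ}
    (hw : ∀ i a, a.degree ≤ k → w i a = w' i a) (i : Fin m) {v : Poly S m}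
    (hv : v ∈ degLE S m k) : opOf A b w i v = opOf A b w' i v := by
  refine degLE_induction (p := fun v => opOf A b w i v = opOf A b w' i v) (by simp) ?_ ?_ ?_ hv
  · intro u v hu hv; rw [map_add, map_add, hu, hv]
  · intro f u hu; rw [opOf_smul, opOf_smul, hu]
  · intro a ha; rw [opOf_single, opOf_single, hw i a ha]

/-- The first variable in a monomial that contains a variable before the `i`-th one. -/
def firstVar {i : Fin m} {a : Fin m →₀ ℕ} (h : ∃ j ∈ a.support, j < i) : Fin m :=
  a.support.min' (h.imp fun _ hj => hj.1)

lemma firstVar_add_single {i j : Fin m} {a : Fin m →₀ ℕ} (h : ∀ k ∈ a.support, j ≤ k)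
    (h' : ∃ j' ∈ (a + Finsupp.single j 1).support, j' < i) : firstVar h' = j := by
  refine le_antisymm (Finset.min'_le _ _ (by simp)) (Finset.le_min' _ _ _ fun k hk => ?_)
  by_cases hkj : k = j
  · exact hkj.ge
  · exact h k (by simpa [Finsupp.single_apply, Ne.symm hkj] using hk)

open Classical in
/-- The correction terms of the operators of the basis sections, computed for exponents of degree
at most `n` by moving the section to the right past the first variable. -/
def corr : ℕ → Fin m → (Fin m →₀ ℕ) → Poly S m
  | 0, _, _ => 0
  | n + 1, i, a =>
    if h : ∃ j ∈ a.support, j < i then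
      opOf A b (corr n) (firstVar h) (corr n i (a - Finsupp.single (firstVar h) 1))
      + ∑ k, b.repr (A.bracket (b i) (b (firstVar h))) k •
        opOf A b (corr n) k (Finsupp.single (a - Finsupp.single (firstVar h) 1) 1)
    else 0

lemma corr_of_le (n : ℕ) {i : Fin m} {a : Fin m →₀ ℕ} (h : ∀ j ∈ a.support, i ≤ j) :
    corr A b n i a = 0 := by
  cases n with
  | zero => rfl
  | succ n =>
    rw [corr, dif_neg]
    push Not
    exact h

lemma corr_succ_add_single (n : ℕ) {i j : Fin m} {a : Fin m →₀ ℕ} (hji : j < i)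
    (h : ∀ k ∈ a.support, j ≤ k) :
    corr A b (n + 1) i (a + Finsupp.single j 1) = opOf A b (corr A b n) j (corr A b n i a)
      + ∑ k, b.repr (A.bracket (b i) (b j)) k •
        opOf A b (corr A b n) k (Finsupp.single a 1) := by
  have hj : j ∈ (a + Finsupp.single j 1).support := by simp
  have h' : ∃ j' ∈ (a + Finsupp.single j 1).support, j' < i := ⟨j, hj, hji⟩
  rw [corr, dif_pos h', firstVar_add_single h h', add_tsub_cancel_right]

lemma exists_eq_add_single {a : Fin m →₀ ℕ} (ha : a ≠ 0) :
    ∃ (j : Fin m) (a' : Fin m →₀ ℕ), a = a' + Finsupp.single j 1 ∧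
      (∀ k ∈ a'.support, j ≤ k) ∧ (∀ k ∈ a.support, j ≤ k) ∧ a.degree = a'.degree + 1 := by
  have hne : a.support.Nonempty := Finsupp.support_nonempty_iff.2 ha
  have hmem := a.support.min'_mem hne
  have hle : ∀ k ∈ a.support, a.support.min' hne ≤ k := fun k hk => Finset.min'_le _ _ hk
  have hsub : a = (a - Finsupp.single (a.support.min' hne) 1)
      + Finsupp.single (a.support.min' hne) 1 := by
    rw [tsub_add_cancel_of_le]
    rw [Finsupp.single_le_iff]
    exact Nat.one_le_iff_ne_zero.2 (Finsupp.mem_support_iff.1 hmem)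
  refine ⟨a.support.min' hne, a - Finsupp.single (a.support.min' hne) 1, hsub, ?_, hle, ?_⟩
  · intro k hk
    refine hle k ?_
    rw [Finsupp.mem_support_iff] at hk ⊢
    intro h
    simp [h] at hk
  · conv_lhs => rw [hsub]
    simp

lemma corr_mem (n : ℕ) (i : Fin m) (a : Fin m →₀ ℕ) : corr A b n i a ∈ degLE S m a.degree := by
  induction n generalizing i a with
  | zero => exact zero_mem _
  | succ n ih =>
    by_cases h : ∀ j ∈ a.support, i ≤ j
    · rw [corr_of_le A b _ h]; exact zero_mem _
    · push Not at h
      obtain ⟨k, hk, hki⟩ := h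
      obtain ⟨j, a', rfl, hj, hj', hdeg⟩ := exists_eq_add_single (a := a) (by
        rintro rfl; simp at hk)
      rw [corr_succ_add_single A b n ((hj' k hk).trans_lt hki) hj, hdeg]
      exact add_mem (opOf_mem A b ih j (ih i a')) (sum_mem fun l _ => Submodule.smul_mem _ _
        (opOf_mem A b ih l (single_mem_degLE le_rfl 1)))

lemma corr_succ (n : ℕ) (i : Fin m) (a : Fin m →₀ ℕ) (ha : a.degree ≤ n) :
    corr A b (n + 1) i a = corr A b n i a := by
  induction n generalizing i a with
  | zero =>
    have : a = 0 := (Finsupp.degree_eq_zero_iff a).1 (by omega)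
    rw [corr_of_le A b _ (by simp [this]), corr_of_le A b _ (by simp [this])]
  | succ n ih =>
    by_cases h : ∀ j ∈ a.support, i ≤ j
    · rw [corr_of_le A b _ h, corr_of_le A b _ h]
    · push Not at h
      obtain ⟨k, hk, hki⟩ := h
      obtain ⟨j, a', rfl, hj, hj', hdeg⟩ := exists_eq_add_single (a := a) (by
        rintro rfl; simp at hk)
      have hji := (hj' k hk).trans_lt hki
      have hdeg' : a'.degree ≤ n := by omega
      rw [corr_succ_add_single A b n hji hj, corr_succ_add_single A b (n + 1) hji hj,
        ih i a' hdeg', opOf_congr A b ih j (degLE_mono hdeg' (corr_mem A b n i a'))]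
      congr 1
      exact Finset.sum_congr rfl fun l _ => by
        rw [opOf_congr A b ih l (single_mem_degLE hdeg' 1)]

lemma corr_eq {n : ℕ} (i : Fin m) {a : Fin m →₀ ℕ} (ha : a.degree ≤ n) :
    corr A b n i a = corr A b a.degree i a := by
  induction n, ha using Nat.le_induction with
  | base => rfl
  | succ n hn ih => rw [corr_succ A b n i a hn, ih]

/-- The operator of the basis section `bᵢ`. -/
def op (i : Fin m) : Poly S m →ₗ[ℝ] Poly S m := opOf A b (fun i a => corr A b a.degree i a) i

lemma op_eq (i : Fin m) {n : ℕ} {v : Poly S m} (hv : v ∈ degLE S m n) :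
    op A b i v = opOf A b (corr A b n) i v :=
  opOf_congr A b (fun i _ ha => (corr_eq A b i ha).symm) i hv

lemma op_smul (i : Fin m) (f : S) (v : Poly S m) :
    op A b i (f • v) = f • op A b i v + A.anchor (b i) f • v := opOf_smul A b _ i f v

lemma op_single_of_le {i : Fin m} {a : Fin m →₀ ℕ} (h : ∀ j ∈ a.support, i ≤ j) :
    op A b i (Finsupp.single a 1) = Finsupp.single (a + Finsupp.single i 1) 1 := by
  rw [op, opOf_single, corr_of_le A b _ h, add_zero]

lemma exists_op_single (i : Fin m) (a : Fin m →₀ ℕ) : ∃ w ∈ degLE S m a.degree,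
    op A b i (Finsupp.single a 1) = Finsupp.single (a + Finsupp.single i 1) 1 + w :=
  ⟨_, corr_mem A b _ i a, opOf_single A b _ i a⟩

/-- The operator of a section. -/
def opSec : N →+ (Poly S m →ₗ[ℝ] Poly S m) where
  toFun Y := ∑ k, (Algebra.lsmul ℝ ℝ (Poly S m) (b.repr Y k)) ∘ₗ op A b k
  map_zero' := by simp
  map_add' Y Z := by simp [LinearMap.add_comp, Finset.sum_add_distrib]

lemma opSec_apply (Y : N) (v : Poly S m) : opSec A b Y v = ∑ k, b.repr Y k • op A b k v := by
  simp [opSec]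

lemma opSec_basis (i : Fin m) (v : Poly S m) : opSec A b (b i) v = op A b i v := by
  rw [opSec_apply, Finset.sum_eq_single i]
  · simp
  · intro j _ hj; simp [hj.symm]
  · simp

lemma opSec_smul_left (f : S) (Y : N) (v : Poly S m) :
    opSec A b (f • Y) v = f • opSec A b Y v := by
  simp [opSec_apply, Finset.smul_sum, mul_smul]

lemma anchor_eq_sum (Y : N) (f : S) :
    A.anchor Y f = ∑ k, b.repr Y k * A.anchor (b k) f := by
  let ev : Derivation ℝ S S →+ S := AddMonoidHom.mk' (fun D => D f) (fun _ _ => rfl)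
  change ev (A.anchor Y) = _
  conv_lhs => rw [← b.sum_repr Y, map_sum, map_sum]
  simp [ev]

lemma opSec_smul (Y : N) (f : S) (v : Poly S m) :
    opSec A b Y (f • v) = f • opSec A b Y v + A.anchor Y f • v := by
  simp only [opSec_apply, op_smul, smul_add, Finset.sum_add_distrib]
  congr 1
  · rw [Finset.smul_sum]
    exact Finset.sum_congr rfl fun k _ => smul_comm _ _ _
  · rw [anchor_eq_sum A b Y, Finset.sum_smul]
    exact Finset.sum_congr rfl fun k _ => by rw [mul_smul]

/-- The curvature of the operators of sections. -/
def defect (Y Z : N) (v : Poly S m) : Poly S m :=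
  opSec A b Y (opSec A b Z v) - opSec A b Z (opSec A b Y v) - opSec A b (A.bracket Y Z) v

lemma defect_add (Y Z : N) (u v : Poly S m) :
    defect A b Y Z (u + v) = defect A b Y Z u + defect A b Y Z v := by
  simp only [defect, map_add]; abel

lemma defect_smul (Y Z : N) (f : S) (v : Poly S m) :
    defect A b Y Z (f • v) = f • defect A b Y Z v := by
  simp only [defect, opSec_smul, map_add, A.anchor_bracket, smul_sub, sub_smul]
  abel

lemma bracket_swap (Y Z : N) : A.bracket Z Y = -A.bracket Y Z := by
  have h := A.bracket_self (Y + Z)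
  rw [A.add_bracket, A.bracket_add, A.bracket_add, A.bracket_self, A.bracket_self, zero_add,
    add_zero, add_comm] at h
  exact eq_neg_of_add_eq_zero_left h

lemma defect_swap (Y Z : N) (v : Poly S m) : defect A b Z Y v = -defect A b Y Z v := by
  simp only [defect, bracket_swap A Y Z, map_neg, LinearMap.neg_apply]; abel

lemma defect_self (Y : N) (v : Poly S m) : defect A b Y Y v = 0 := by
  simp [defect, A.bracket_self]

lemma defect_smul_right (Y Z : N) (f : S) (v : Poly S m) :
    defect A b Y (f • Z) v = f • defect A b Y Z v := by
  simp only [defect, opSec_smul_left, opSec_smul, A.leibniz, map_add, LinearMap.add_apply,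
    smul_sub]
  abel

lemma defect_add_right (Y Z W : N) (v : Poly S m) :
    defect A b Y (Z + W) v = defect A b Y Z v + defect A b Y W v := by
  simp only [defect, A.bracket_add, map_add, LinearMap.add_apply]
  abel

/-- The curvature vanishes if it does on basis sections. -/
lemma defect_eq_zero_of_basis {v : Poly S m} (h : ∀ i j, defect A b (b i) (b j) v = 0) (Y Z : N) :
    defect A b Y Z v = 0 := by
  have key : ∀ Y : N, (∀ j, defect A b Y (b j) v = 0) → ∀ Z, defect A b Y Z v = 0 := by
    intro Y hY Z
    rw [← b.sum_repr Z]
    refine Finset.sum_induction _ (fun Z => defect A b Y Z v = 0)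
      (fun Z W hZ hW => by rw [defect_add_right, hZ, hW, add_zero]) ?_
      (fun j _ => by rw [defect_smul_right, hY, smul_zero])
    rw [← zero_smul S (0 : N), defect_smul_right, zero_smul]
  refine key Y (fun j => ?_) Z
  rw [defect_swap, key (b j) (fun i => h j i) Y, neg_zero]

lemma defect_of_le {i j : Fin m} {a : Fin m →₀ ℕ} (hji : j < i) (h : ∀ k ∈ a.support, j ≤ k) :
    defect A b (b i) (b j) (Finsupp.single a 1) = 0 := by
  have hdeg : (a + Finsupp.single j 1).degree = a.degree + 1 := by simp
  have h₁ : op A b j (Finsupp.single (a + Finsupp.single i 1) 1)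
      = Finsupp.single (a + Finsupp.single i 1 + Finsupp.single j 1) 1 := by
    refine op_single_of_le A b fun k hk => ?_
    by_cases hki : k = i
    · exact hki ▸ hji.le
    · exact h k (by simpa [Finsupp.single_apply, Ne.symm hki] using hk)
  rw [defect, opSec_basis, opSec_basis, opSec_basis, opSec_basis, op_single_of_le A b h, opSec_apply]
  conv_lhs => enter [1, 1]; rw [op, opOf_single]
  conv_lhs => enter [1, 2]; rw [show op A b i = opOf A b _ i from rfl, opOf_single]
  rw [hdeg, corr_succ_add_single A b _ hji h, map_add, h₁,
    ← op_eq A b j (corr_mem A b a.degree i a), add_right_comm a]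
  simp only [← op_eq A b _ (single_mem_degLE (S := S) (le_refl a.degree) 1)]
  abel

/-- The operators of sections form a representation of the Lie-Rinehart algebra. -/
theorem defect_eq_zero (Y Z : N) (v : Poly S m) : defect A b Y Z v = 0 := by
  suffices h : ∀ n, ∀ v ∈ degLE S m n, ∀ Y Z, defect A b Y Z v = 0 by
    refine h (v.support.sup Finsupp.degree) v ?_ Y Z
    rw [degLE, Finsupp.mem_supported]
    exact fun a ha => Finset.le_sup (f := Finsupp.degree) ha
  intro n
  induction n using Nat.strong_induction_on with
  | _ n ih =>
  intro v hv Y Z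
  refine degLE_induction (p := fun v => defect A b Y Z v = 0) (by simp [defect])
    (fun u v hu hv => by rw [defect_add, hu, hv, add_zero])
    (fun f u hu => by rw [defect_smul, hu, smul_zero]) (fun a ha => ?_) hv
  refine defect_eq_zero_of_basis A b (fun i j => ?_) Y Z
  -- by antisymmetry the index `j` may be taken to be the smaller one
  suffices h : ∀ i j : Fin m, j < i → defect A b (b i) (b j) (Finsupp.single a 1) = 0 by
    rcases lt_trichotomy i j with hij | rfl | hij
    · rw [defect_swap, h j i hij, neg_zero]
    · exact defect_self A b _ _
    · exact h i j hij
  intro i j hji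
  by_cases hle : ∀ k ∈ a.support, j ≤ k
  · exact defect_of_le A b hji hle
  push Not at hle
  obtain ⟨l, hl, hlj⟩ := hle
  obtain ⟨k, a', rfl, hk, hk', hdeg⟩ := exists_eq_add_single (a := a) (by
    rintro rfl; simp at hl)
  have hkj : k < j := (hk' l hl).trans_lt hlj
  have hki := hkj.trans hji
  have hlow : ∀ u ∈ degLE S m a'.degree, ∀ Y Z, defect A b Y Z u = 0 :=
    ih a'.degree (by omega)
  -- the curvature of `bₖ` with another basis section vanishes one degree higher
  have hstep : ∀ i j : Fin m, k < i → k < j →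
      defect A b (b i) (b k) (opSec A b (b j) (Finsupp.single a' 1)) = 0 := by
    intro i j hki hkj
    obtain ⟨w, hw, hw'⟩ := exists_op_single A b j a'
    rw [opSec_basis, hw', defect_add, hlow w hw, add_zero]
    refine defect_of_le A b hki fun l hl => ?_
    by_cases hlj : l = j
    · exact hlj ▸ hkj.le
    · exact hk l (by simpa [Finsupp.single_apply, Ne.symm hlj] using hl)
  set u : Poly S m := Finsupp.single a' 1 with hu_def
  have hu : u ∈ degLE S m a'.degree := single_mem_degLE le_rfl 1
  have hx : Finsupp.single (a' + Finsupp.single k 1) 1 = opSec A b (b k) u := by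
    rw [opSec_basis, op_single_of_le A b hk]
  rw [hx]
  have e₁ := hlow u hu (b j) (b k)
  have e₂ := hlow u hu (b i) (b k)
  have e₃ := hlow u hu (b i) (b j)
  have e₄ := hlow u hu (b i) (A.bracket (b j) (b k))
  have e₅ := hlow u hu (b j) (A.bracket (b i) (b k))
  have e₆ := hlow u hu (b k) (A.bracket (b i) (b j))
  have e₇ := hstep i j hki hkj
  have e₈ := hstep j i hkj hki
  have f₁ := congrArg (opSec A b (b i)) e₁
  have f₂ := congrArg (opSec A b (b j)) e₂
  have f₃ := congrArg (opSec A b (b k)) e₃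
  have hJ : opSec A b (A.bracket (b i) (A.bracket (b j) (b k))) u
      = opSec A b (A.bracket (b j) (A.bracket (b i) (b k))) u
        - opSec A b (A.bracket (b k) (A.bracket (b i) (b j))) u := by
    rw [A.jacobi (b i) (b j) (b k), bracket_swap A (b k) (A.bracket (b i) (b j)), map_add, map_neg,
      LinearMap.add_apply, LinearMap.neg_apply]
    abel
  simp only [defect, map_sub, map_zero] at e₄ e₅ e₆ e₇ e₈ f₁ f₂ f₃ ⊢
  rw [hJ] at e₄
  have := congrArg₂ (· + ·) (congrArg₂ (· - ·) (congrArg₂ (· - ·) f₁ f₂) (congrArg₂ (· - ·) e₈ e₇))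
    (congrArg₂ (· + ·) f₃ (congrArg₂ (· + ·) (congrArg₂ (· - ·) e₄ e₅) e₆))
  simp only [sub_zero, add_zero] at this
  rw [← this]
  abel

/-- The action of the enveloping algebra on polynomials. -/
def act : Envelope A →ₐ[ℝ] Module.End ℝ (Poly S m) :=
  Envelope.lift A (Algebra.lsmul ℝ ℝ (Poly S m)) (opSec A b)
    (fun f Y => LinearMap.ext fun v => opSec_smul_left A b f Y v)
    (fun Y f => LinearMap.ext fun v => opSec_smul A b Y f v)
    (fun Y Z => LinearMap.ext fun v => by
      have := defect_eq_zero A b Y Z v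
      rw [defect, sub_sub, sub_eq_zero] at this
      exact this)

/-- The linear part of a polynomial. -/
def linearPart : Poly S m →ₗ[S] N :=
  ∑ k, (Finsupp.lapply (Finsupp.single k 1)).smulRight (b k)

/-- The linear part of `u · 1` retracts the enveloping algebra to the sections. -/
def retraction : Envelope.Retraction A where
  proj :=
    { toFun := fun u => linearPart b (act A b u (Finsupp.single 0 1))
      map_add' := fun u v => by simp
      map_smul' := fun f u => by
        rw [Envelope.fun_smul_def, map_mul, Module.End.mul_apply, act, Envelope.lift_ofFun]
        exact map_smul _ _ _ }
  proj_one := by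
    change linearPart b (act A b 1 (Finsupp.single 0 1)) = 0
    rw [map_one, Module.End.one_apply]
    simp [linearPart]
  proj_ofSec Y := by
    change linearPart b (act A b (Envelope.ofSec A Y) (Finsupp.single 0 1)) = Y
    rw [act, Envelope.lift_ofSec, opSec_apply]
    conv_rhs => rw [← b.sum_repr Y]
    rw [map_sum]
    refine Finset.sum_congr rfl fun k _ => ?_
    rw [op_single_of_le A b (by simp), map_smul, zero_add]
    congr 1
    simp only [linearPart, LinearMap.sum_apply]
    rw [Finset.sum_eq_single k]
    · simp
    · intro j _ hj
      have : Finsupp.single j 1 ≠ (Finsupp.single k 1 : Fin m →₀ ℕ) := by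
        simpa [Finsupp.single_left_inj] using hj
      simp [this.symm]
    · simp

end FreePBW

end QuantumGroupoids

namespace QuantumGroupoids

/-! ### The Poincaré-Birkhoff-Witt theorem for locally free modules -/

section Push

variable {R L S N : Type*} [CommRing R] [Algebra ℝ R] [AddCommGroup L] [Module R L]
  [CommRing S] [Algebra ℝ S] [AddCommGroup N] [Module S N]

/-- Surjections `R → S` and `L → N` along which a Lie-Rinehart structure descends. -/
structure LieRinehart.Descent (A : LieRinehart R L) (S N : Type*) [CommRing S] [Algebra ℝ S]
    [AddCommGroup N] [Module S N] where
  onFun : R →ₐ[ℝ] S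
  onSec : L →+ N
  onSec_smul : ∀ f X, onSec (f • X) = onFun f • onSec X
  onFun_surjective : Function.Surjective onFun
  onSec_surjective : Function.Surjective onSec
  bracket_eq_zero : ∀ X Y, onSec Y = 0 → onSec (A.bracket X Y) = 0
  anchor_eq_zero : ∀ X f, onFun f = 0 → onFun (A.anchor X f) = 0
  anchor_eq_zero' : ∀ X f, onSec X = 0 → onFun (A.anchor X f) = 0

namespace LieRinehart.Descent

variable {A : LieRinehart R L} (D : A.Descent S N)

lemma onSec_bracket_congr {X X' Y Y' : L} (hX : D.onSec X = D.onSec X')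
    (hY : D.onSec Y = D.onSec Y') : D.onSec (A.bracket X Y) = D.onSec (A.bracket X' Y') := by
  have sub_right : ∀ X Y Z, A.bracket X (Y - Z) = A.bracket X Y - A.bracket X Z := by
    intro X Y Z
    rw [eq_sub_iff_add_eq, ← A.bracket_add, sub_add_cancel]
  have key : ∀ {X Y Y'}, D.onSec Y = D.onSec Y' →
      D.onSec (A.bracket X Y) = D.onSec (A.bracket X Y') := by
    intro X Y Y' h
    rw [← sub_eq_zero, ← map_sub, ← sub_right]
    exact D.bracket_eq_zero _ _ (by rw [map_sub, h, sub_self])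
  rw [key hY, FreePBW.bracket_swap A Y' X, FreePBW.bracket_swap A Y' X', map_neg, map_neg, key hX]

lemma onFun_anchor_congr {X X' : L} {f f' : R} (hX : D.onSec X = D.onSec X')
    (hf : D.onFun f = D.onFun f') : D.onFun (A.anchor X f) = D.onFun (A.anchor X' f') := by
  trans D.onFun (A.anchor X f')
  · rw [← sub_eq_zero, ← map_sub, ← map_sub]
    exact D.anchor_eq_zero _ _ (by rw [map_sub, hf, sub_self])
  · rw [← sub_eq_zero, ← map_sub, ← Derivation.sub_apply, ← map_sub]
    exact D.anchor_eq_zero' _ _ (by rw [map_sub, hX, sub_self])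

/-- A lift of an element of `S`. -/
def liftFun (g : S) : R := Function.surjInv D.onFun_surjective g

/-- A lift of an element of `N`. -/
def liftSec (Y : N) : L := Function.surjInv D.onSec_surjective Y

@[simp] lemma onFun_liftFun (g : S) : D.onFun (D.liftFun g) = g :=
  Function.surjInv_eq D.onFun_surjective g

@[simp] lemma onSec_liftSec (Y : N) : D.onSec (D.liftSec Y) = Y :=
  Function.surjInv_eq D.onSec_surjective Y

/-- The descended bracket. -/
def bracket (Y Z : N) : N := D.onSec (A.bracket (D.liftSec Y) (D.liftSec Z))

lemma bracket_onSec (X Y : L) : D.bracket (D.onSec X) (D.onSec Y) = D.onSec (A.bracket X Y) :=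
  D.onSec_bracket_congr (by simp) (by simp)

/-- The descended action on functions. -/
def deriv (Y : N) (g : S) : S := D.onFun (A.anchor (D.liftSec Y) (D.liftFun g))

lemma deriv_onSec (X : L) (f : R) : D.deriv (D.onSec X) (D.onFun f) = D.onFun (A.anchor X f) :=
  D.onFun_anchor_congr (by simp) (by simp)

/-- The descended anchor. -/
def anchor : N →ₗ[S] Derivation ℝ S S where
  toFun Y := Derivation.mk'
    { toFun := D.deriv Y
      map_add' := fun g h => by
        obtain ⟨X, rfl⟩ := D.onSec_surjective Y
        obtain ⟨g, rfl⟩ := D.onFun_surjective g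
        obtain ⟨h, rfl⟩ := D.onFun_surjective h
        rw [← map_add, deriv_onSec, deriv_onSec, deriv_onSec, map_add, map_add]
      map_smul' := fun c g => by
        obtain ⟨X, rfl⟩ := D.onSec_surjective Y
        obtain ⟨g, rfl⟩ := D.onFun_surjective g
        rw [← map_smul, deriv_onSec, deriv_onSec, Derivation.map_smul, map_smul, RingHom.id_apply] }
    (fun g h => by
      obtain ⟨X, rfl⟩ := D.onSec_surjective Y
      obtain ⟨g, rfl⟩ := D.onFun_surjective g
      obtain ⟨h, rfl⟩ := D.onFun_surjective h
      change D.deriv _ _ = _ • D.deriv _ _ + _ • D.deriv _ _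
      rw [← map_mul, deriv_onSec, deriv_onSec, deriv_onSec]
      simp)
  map_add' Y Z := by
    obtain ⟨X, rfl⟩ := D.onSec_surjective Y
    obtain ⟨X', rfl⟩ := D.onSec_surjective Z
    ext g
    obtain ⟨g, rfl⟩ := D.onFun_surjective g
    change D.deriv _ _ = D.deriv _ _ + D.deriv _ _
    rw [← map_add, deriv_onSec, deriv_onSec, deriv_onSec]
    simp
  map_smul' h Y := by
    obtain ⟨X, rfl⟩ := D.onSec_surjective Y
    obtain ⟨h, rfl⟩ := D.onFun_surjective h
    ext g
    obtain ⟨g, rfl⟩ := D.onFun_surjective g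
    change D.deriv (D.onFun h • D.onSec X) (D.onFun g)
      = D.onFun h • D.deriv (D.onSec X) (D.onFun g)
    rw [← D.onSec_smul, deriv_onSec, deriv_onSec]
    simp

lemma anchor_onSec (X : L) (f : R) : D.anchor (D.onSec X) (D.onFun f) = D.onFun (A.anchor X f) :=
  D.deriv_onSec X f

/-- The descended Lie-Rinehart structure. -/
def push : LieRinehart S N where
  bracket := D.bracket
  anchor := D.anchor
  add_bracket X Y Z := by
    obtain ⟨X, rfl⟩ := D.onSec_surjective X
    obtain ⟨Y, rfl⟩ := D.onSec_surjective Y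
    obtain ⟨Z, rfl⟩ := D.onSec_surjective Z
    simp only [← map_add, bracket_onSec, A.add_bracket]
  bracket_add X Y Z := by
    obtain ⟨X, rfl⟩ := D.onSec_surjective X
    obtain ⟨Y, rfl⟩ := D.onSec_surjective Y
    obtain ⟨Z, rfl⟩ := D.onSec_surjective Z
    simp only [← map_add, bracket_onSec, A.bracket_add]
  bracket_self X := by
    obtain ⟨X, rfl⟩ := D.onSec_surjective X
    rw [bracket_onSec, A.bracket_self, map_zero]
  jacobi X Y Z := by
    obtain ⟨X, rfl⟩ := D.onSec_surjective X
    obtain ⟨Y, rfl⟩ := D.onSec_surjective Y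
    obtain ⟨Z, rfl⟩ := D.onSec_surjective Z
    simp only [bracket_onSec, ← map_add, ← A.jacobi]
  leibniz X f Y := by
    obtain ⟨X, rfl⟩ := D.onSec_surjective X
    obtain ⟨Y, rfl⟩ := D.onSec_surjective Y
    obtain ⟨f, rfl⟩ := D.onFun_surjective f
    simp only [bracket_onSec, anchor_onSec, ← D.onSec_smul, A.leibniz, ← map_add]
  anchor_bracket X Y f := by
    obtain ⟨X, rfl⟩ := D.onSec_surjective X
    obtain ⟨Y, rfl⟩ := D.onSec_surjective Y
    obtain ⟨f, rfl⟩ := D.onFun_surjective f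
    simp only [bracket_onSec, anchor_onSec, A.anchor_bracket, ← map_sub]

/-- The induced map of enveloping algebras. -/
def envelopeMap : Envelope A →ₐ[ℝ] Envelope D.push :=
  Envelope.lift A ((Envelope.ofFun D.push).comp D.onFun)
    ((Envelope.ofSec D.push).toAddMonoidHom.comp D.onSec)
    (fun f X => by
      change Envelope.ofSec D.push (D.onSec (f • X)) = _
      rw [D.onSec_smul, map_smul]; rfl)
    (fun X f => by
      change Envelope.ofSec D.push (D.onSec X) * Envelope.ofFun D.push (D.onFun f) = _
      rw [Envelope.ofSec_mul_ofFun]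
      change _ + Envelope.ofFun D.push (D.anchor _ _) = _
      rw [anchor_onSec]; rfl)
    (fun X Y => by
      change Envelope.ofSec D.push (D.onSec X) * Envelope.ofSec D.push (D.onSec Y) = _
      rw [Envelope.ofSec_mul_ofSec]
      change _ + Envelope.ofSec D.push (D.bracket _ _) = _
      rw [bracket_onSec]; rfl)

lemma envelopeMap_smul (f : R) (u : Envelope A) :
    D.envelopeMap (f • u) = D.onFun f • D.envelopeMap u := by
  rw [Envelope.fun_smul_def, map_mul, envelopeMap, Envelope.lift_ofFun]; rfl

lemma envelopeMap_ofSec (X : L) :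
    D.envelopeMap (Envelope.ofSec A X) = Envelope.ofSec D.push (D.onSec X) := by
  rw [envelopeMap, Envelope.lift_ofSec]; rfl

end LieRinehart.Descent

end Push

/-- Sections and linear forms that become dual bases where the function `scale` is nonzero. -/
structure LocalFrame (R L : Type*) [CommRing R] [AddCommGroup L] [Module R L] where
  card : ℕ
  scale : R
  sec : Fin card → L
  form : Fin card → L →ₗ[R] R
  sum_eq : ∀ X, scale • ∑ i, form i X • sec i = scale • X
  dual : ∀ i j, scale * form i (sec j) = if i = j then scale else 0

namespace LocalFrame

variable {R L : Type*} [CommRing R] [Algebra ℝ R] [AddCommGroup L] [Module R L]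
  (φ : LocalFrame R L)

section Quotient

omit [Algebra ℝ R]

/-- The functions annihilated by the scale, that is those vanishing where it does not. -/
def ideal : Ideal R := LinearMap.ker (LinearMap.toSpanSingleton R R φ.scale)

lemma mk_eq_zero {f : R} : Ideal.Quotient.mk φ.ideal f = 0 ↔ φ.scale * f = 0 := by
  rw [Ideal.Quotient.eq_zero_iff_mem, ideal, LinearMap.mem_ker, LinearMap.toSpanSingleton_apply,
    smul_eq_mul, mul_comm]

/-- Sections up to those annihilated by the scale. -/
def coord : L →+ (Fin φ.card → R ⧸ φ.ideal) where
  toFun X i := Ideal.Quotient.mk φ.ideal (φ.form i X)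
  map_zero' := by ext i; simp
  map_add' X Y := by ext i; simp

lemma coord_apply (X : L) (i : Fin φ.card) :
    φ.coord X i = Ideal.Quotient.mk φ.ideal (φ.form i X) := rfl

lemma coord_eq_zero {X : L} : φ.coord X = 0 ↔ φ.scale • X = 0 := by
  constructor
  · intro h
    rw [← φ.sum_eq, Finset.smul_sum]
    refine Finset.sum_eq_zero fun i _ => ?_
    rw [smul_smul, φ.mk_eq_zero.1 (congrFun h i), zero_smul]
  · intro h
    funext i
    rw [coord_apply, Pi.zero_apply, mk_eq_zero, ← smul_eq_mul, ← map_smul, h, map_zero]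

lemma coord_surjective : Function.Surjective φ.coord := by
  intro v
  choose f hf using fun i => Ideal.Quotient.mk_surjective (v i)
  refine ⟨∑ j, f j • φ.sec j, funext fun i => ?_⟩
  rw [coord_apply, ← hf, ← sub_eq_zero, ← map_sub, mk_eq_zero, mul_sub, map_sum, Finset.mul_sum,
    sub_eq_zero]
  rw [Finset.sum_eq_single i]
  · rw [map_smul, smul_eq_mul, mul_left_comm, φ.dual, if_pos rfl, mul_comm]
  · intro j _ hj
    rw [map_smul, smul_eq_mul, mul_left_comm, φ.dual, if_neg hj.symm, mul_zero]
  · simp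

/-- Multiplication by the scale, on the quotient. -/
def scaleMul : R ⧸ φ.ideal →ₗ[R] R :=
  Submodule.liftQ φ.ideal (LinearMap.toSpanSingleton R R φ.scale) le_rfl

lemma scaleMul_mk (f : R) : φ.scaleMul (Ideal.Quotient.mk φ.ideal f) = f * φ.scale := rfl

/-- The map `v ↦ ∑ χ vᵢ eᵢ`. -/
def ofCoord : (Fin φ.card → R ⧸ φ.ideal) →ₗ[R] L :=
  ∑ i, (φ.scaleMul ∘ₗ LinearMap.proj i).smulRight (φ.sec i)

lemma ofCoord_coord (X : L) : φ.ofCoord (φ.coord X) = φ.scale • X := by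
  rw [← φ.sum_eq, Finset.smul_sum, ofCoord, LinearMap.sum_apply]
  refine Finset.sum_congr rfl fun i _ => ?_
  rw [LinearMap.smulRight_apply, LinearMap.comp_apply, LinearMap.proj_apply, coord_apply,
    scaleMul_mk, smul_smul, mul_comm]

end Quotient

variable [IsReduced R] (A : LieRinehart R L)

omit [Algebra ℝ R] in
lemma mul_eq_zero_of_sq_mul {f : R} (h : φ.scale * (φ.scale * f) = 0) : φ.scale * f = 0 := by
  refine pow_eq_zero_iff two_ne_zero |>.1 ?_
  linear_combination f * h

/-- The Lie-Rinehart structure descends to the open set where the scale is nonzero. -/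
def descent : A.Descent (R ⧸ φ.ideal) (Fin φ.card → R ⧸ φ.ideal) where
  onFun := Ideal.Quotient.mkₐ ℝ φ.ideal
  onSec := φ.coord
  onSec_smul f X := by ext i; simp [coord_apply]
  onFun_surjective := Ideal.Quotient.mk_surjective
  onSec_surjective := φ.coord_surjective
  bracket_eq_zero X Y hY := by
    rw [coord_eq_zero] at hY
    have h := A.leibniz X φ.scale Y
    have h0 : A.bracket X (0 : L) = 0 := by
      have := A.bracket_add X 0 0
      simpa using this
    rw [hY, h0] at h
    have h' := congrArg (φ.scale • ·) h
    simp only [smul_zero, smul_add] at h'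
    rw [smul_comm _ _ Y, hY, smul_zero, add_zero] at h'
    funext i
    rw [coord_apply, Pi.zero_apply, mk_eq_zero]
    refine φ.mul_eq_zero_of_sq_mul ?_
    rw [← smul_eq_mul, ← smul_eq_mul, ← map_smul, ← map_smul, ← h', map_zero]
  anchor_eq_zero X f hf := by
    have hf' := φ.mk_eq_zero.1 hf
    refine φ.mk_eq_zero.2 (φ.mul_eq_zero_of_sq_mul ?_)
    have h := congrArg (A.anchor X) hf'
    rw [Derivation.leibniz, map_zero, smul_eq_mul, smul_eq_mul] at h
    linear_combination φ.scale * h - A.anchor X φ.scale * hf'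
  anchor_eq_zero' X f hX := by
    rw [coord_eq_zero] at hX
    refine φ.mk_eq_zero.2 ?_
    rw [← smul_eq_mul, ← Derivation.smul_apply, ← map_smul, hX]
    simp

/-- The retraction over the open set where the scale is nonzero, multiplied by the scale. -/
def localProj : Envelope A →ₗ[R] L where
  toFun u := φ.ofCoord ((FreePBW.retraction (φ.descent A).push
    (Pi.basisFun (R ⧸ φ.ideal) (Fin φ.card))).proj ((φ.descent A).envelopeMap u))
  map_add' u v := by simp
  map_smul' f u := by
    rw [LieRinehart.Descent.envelopeMap_smul, (FreePBW.retraction (φ.descent A).push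
      (Pi.basisFun (R ⧸ φ.ideal) (Fin φ.card))).proj.map_smul, RingHom.id_apply,
      ← φ.ofCoord.map_smul]
    rfl

lemma localProj_one : φ.localProj A 1 = 0 := by
  change φ.ofCoord _ = 0
  rw [map_one, Envelope.Retraction.proj_one, map_zero]

lemma localProj_ofSec (X : L) : φ.localProj A (Envelope.ofSec A X) = φ.scale • X := by
  change φ.ofCoord _ = _
  rw [LieRinehart.Descent.envelopeMap_ofSec, Envelope.Retraction.proj_ofSec]
  exact φ.ofCoord_coord X

/-- Local frames whose scales generate the unit ideal give a retraction. -/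
def retraction {ι : Type*} (s : Finset ι) (φ : ι → LocalFrame R L) (g : ι → R)
    (h : ∑ k ∈ s, g k * (φ k).scale = 1) : Envelope.Retraction A where
  proj := ∑ k ∈ s, g k • (φ k).localProj A
  proj_one := by simp [localProj_one]
  proj_ofSec X := by
    simp only [LinearMap.sum_apply, LinearMap.smul_apply, localProj_ofSec, smul_smul]
    rw [← Finset.sum_smul, h, one_smul]

end LocalFrame

end QuantumGroupoids

namespace QuantumGroupoids

/-! ### The differential of a quantum groupoid -/

section Classical

variable {R L M : Type*} [CommRing R] [Algebra ℝ R] [AddCommGroup L] [Module R L]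
  [AddCommGroup M] [Module R M]

lemma PreDifferential.toDerivation_d_d (P : PreDifferential R L)
    (h₀ : ∀ f, P.onSec (P.onFun f) = 0) (h₁ : ∀ X, P.d (P.onSec X : ExteriorAlgebra R L) = 0)
    (a : ExteriorAlgebra R L) : P.toDerivation.d (P.toDerivation.d a) = 0 := by
  refine P.toDerivation.d_d_eq_zero (fun f => ?_) (fun X => ?_) a
  · rw [P.toDerivation_onFun, P.toDerivation_onSec, h₀]
  · rw [P.toDerivation_onSec]; exact h₁ X

namespace QuantumGroupoid

variable {A : LieRinehart R L} {Rh Hh : Type*} [Ring Rh] [Algebra ℝ⟦X⟧ Rh]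
    [Ring Hh] [Algebra ℝ⟦X⟧ Hh] (Q : QuantumGroupoid A Rh Hh)

/-- The operator `δ` on functions and sections. -/
def preDifferential (r : Envelope.Retraction A) (B : DualSystem R L) : PreDifferential R L where
  onFun := AddMonoidHom.mk' (Q.deltaFun r) (deltaFun_add (Envelope.locallyFiniteRank r B) r B)
  onSec := AddMonoidHom.mk' (Q.deltaSec r) (deltaSec_add r (Envelope.locallyFiniteRank r B))
  onFun_mul := deltaFun_mul (Envelope.locallyFiniteRank r B) r B
  onFun_const := deltaFun_const (Envelope.locallyFiniteRank r B) r B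
  onSec_smul := deltaSec_smul r (Envelope.locallyFiniteRank r B) B

variable (r : Envelope.Retraction A) (B : DualSystem R L)

lemma preDifferential_onSec_onFun (f : R) :
    (Q.preDifferential r B).onSec ((Q.preDifferential r B).onFun f) = 0 :=
  deltaSec_deltaFun r (Envelope.locallyFiniteRank r B) B f

lemma preDifferential_d_onSec (X : L) :
    (Q.preDifferential r B).d ((Q.preDifferential r B).onSec X : ExteriorAlgebra R L) = 0 := by
  obtain ⟨S, h₁, h₂⟩ := exists_deltaSec_eq_sum (Q := Q) r (Envelope.locallyFiniteRank r B) B X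
  have h : (Q.preDifferential r B).onSec X = ∑ p ∈ S, toWedge (p.1 ⊗ₜ[R] p.2) := h₁
  rw [h, AddSubmonoidClass.coe_finsetSum, map_sum, ← h₂]
  exact Finset.sum_congr rfl fun p _ => (Q.preDifferential r B).d_toWedge_tmul p.1 p.2

lemma isDelta_toDerivation : Q.IsDelta (Q.preDifferential r B).toDerivation where
  onFun f := by
    rw [PreDifferential.toDerivation_onFun]
    exact isDeltaFun_deltaFun (Envelope.locallyFiniteRank r B) r B f
  onSec X := by
    rw [PreDifferential.toDerivation_onSec]
    exact exists_isDeltaOne r (Envelope.locallyFiniteRank r B) B X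

variable {Q} in
include r in
/-- The operator `δ` is determined by its values on functions and sections, which are limits. -/
lemma IsDelta.eq {D D' : DegreeOneDerivation R L} (h : Q.IsDelta D) (h' : Q.IsDelta D') :
    D = D' := by
  refine DegreeOneDerivation.ext_of D D' (fun f => ?_) (fun X => ?_)
  · exact Envelope.ofSec_injective r ((h.onFun f).unique (h'.onFun f))
  · obtain ⟨t, ht, e⟩ := h.onSec X
    obtain ⟨t', ht', e'⟩ := h'.onSec X
    obtain rfl : t = t' := ht.unique ht'
    have key := congrArg (TensorProduct.map r.proj r.proj) (e.trans e'.symm)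
    rw [map_proj_map_ofSec r, map_proj_map_ofSec r] at key
    exact wedgeToTensor_injective key

/-- The dual Lie algebroid, on sections. -/
def dualSections (p : M ≃ₗ[R] L →ₗ[R] R) : LieRinehart R M :=
  (Q.preDifferential r B).dual p (Q.preDifferential_onSec_onFun r B)
    (Q.preDifferential_d_onSec r B)

lemma isInducedDifferential (p : M ≃ₗ[R] L →ₗ[R] R) :
    IsInducedDifferential (Q.dualSections r B p) p.toLinearMap
      (Q.preDifferential r B).toDerivation :=
  (Q.preDifferential r B).isInducedDifferential p _ _

lemma isLieBialgebroid (p : M ≃ₗ[R] L →ₗ[R] R) :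
    IsLieBialgebroid A (Q.dualSections r B p) p.toLinearMap := by
  refine ⟨_, Q.isInducedDifferential r B p, fun X Y => ?_⟩
  simp only [PreDifferential.toDerivation_onSec]
  exact wedgeToTensor_deltaSec_bracket r (Envelope.locallyFiniteRank r B) B X Y

lemma isBaseBracket (p : M ≃ₗ[R] L →ₗ[R] R) :
    IsBaseBracket A (Q.dualSections r B p) p.toLinearMap
      fun f g => A.anchor (Q.deltaFun r f) g :=
  fun f => ⟨Q.deltaFun r f, fun _ => rfl, fun _ => rfl⟩

end QuantumGroupoid
end Classical
end QuantumGroupoids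

namespace QuantumGroupoids

/-! ### Finite generation of the module of sections -/

section Spanning

open Set Filter Topology Module

variable {n : ℕ} {P : Type*} [TopologicalSpace P] [ChartedSpace (EuclideanSpace ℝ (Fin n)) P]
  {F : Type*} [NormedAddCommGroup F] [NormedSpace ℝ F]
  {E : P → Type*} [TopologicalSpace (TotalSpace F E)] [∀ x, AddCommGroup (E x)]
  [∀ x, Module ℝ (E x)] [∀ x, TopologicalSpace (E x)] [FiberBundle F E] [VectorBundle ℝ F E]

section Extension

variable [IsManifold (𝓡 n) ∞ P] [T2Space P] [SigmaCompactSpace P]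

/-- A smooth section over an open set agrees on any smaller closed set with a global section. -/
lemma exists_section_eqOn (s₀ : ∀ x, E x) {U C : Set P} (hC : IsClosed C) (hU : IsOpen U)
    (hCU : C ⊆ U) (hs : ContMDiffOn (𝓡 n) ((𝓡 n).prod 𝓘(ℝ, F)) ∞
      (fun x => TotalSpace.mk' F x (s₀ x)) U) :
    ∃ s : SmoothSec n F E, ∀ x ∈ C, s x = s₀ x := by
  refine exists_contMDiffSection_forall_mem_convex_of_local (n := ⊤) (𝓡 n) E
    (fun x => {v | x ∈ C → v = s₀ x}) (fun x v hv w hw a b _ _ hab hx => ?_) fun x => ?_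
  · rw [hv hx, hw hx, ← add_smul, hab, one_smul]
  · by_cases hx : x ∈ U
    · exact ⟨U, hU.mem_nhds hx, s₀, hs, fun _ _ _ => rfl⟩
    · exact ⟨Cᶜ, hC.isOpen_compl.mem_nhds fun h => hx (hCU h), fun _ => 0,
        (contMDiff_zeroSection ℝ E).contMDiffOn, fun y hy hy' => absurd hy' hy⟩

/-- A function that is smooth on an open set agrees on any smaller closed set with a global smooth
function. -/
lemma exists_smoothFun_eqOn (f₀ : P → ℝ) {U C : Set P} (hC : IsClosed C) (hU : IsOpen U)
    (hCU : C ⊆ U) (hf : ContMDiffOn (𝓡 n) 𝓘(ℝ, ℝ) ∞ f₀ U) :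
    ∃ f : SmoothFun n P, ∀ x ∈ C, f x = f₀ x := by
  refine exists_contMDiffMap_forall_mem_convex_of_local (n := ⊤) (𝓡 n)
    (t := fun x => {v | x ∈ C → v = f₀ x}) (fun x v hv w hw a b _ _ hab hx => ?_) fun x => ?_
  · rw [hv hx, hw hx, ← add_smul, hab, one_smul]
  · by_cases hx : x ∈ U
    · exact ⟨U, hU.mem_nhds hx, f₀, hf, fun _ _ _ => rfl⟩
    · exact ⟨Cᶜ, hC.isOpen_compl.mem_nhds fun h => hx (hCU h), fun _ => 0,
        contMDiffOn_const, fun y hy hy' => absurd hy' hy⟩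

variable [FiniteDimensional ℝ F] [ContMDiffVectorBundle ∞ F E (𝓡 n)]

lemma exists_finite_span_nhds (x₀ : P) : ∃ S : Set (SmoothSec n F E), S.Finite ∧
    ∀ᶠ x in 𝓝 x₀, Submodule.span ℝ ((fun s : SmoothSec n F E => s x) '' S) = ⊤ := by
  have : LocallyCompactSpace P := ChartedSpace.locallyCompactSpace (EuclideanSpace ℝ (Fin n)) P
  let e := trivializationAt F E x₀
  have hx₀ : x₀ ∈ e.baseSet := mem_baseSet_trivializationAt F E x₀
  obtain ⟨C, hC, hCc, hCU⟩ := exists_mem_nhds_isClosed_subset (e.open_baseSet.mem_nhds hx₀)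
  let b := finBasis ℝ F
  choose s hs using fun i => exists_section_eqOn (n := n) (e.localFrame b i) hCc e.open_baseSet hCU
    (e.contMDiffOn_localFrame_baseSet ∞ b i)
  refine ⟨range s, finite_range s, mem_of_superset hC fun x hx => ?_⟩
  rw [mem_ofPred_eq, ← range_comp]
  have : ((fun t : SmoothSec n F E => t x) ∘ s) = e.basisAt b (hCU hx) := by
    funext i
    rw [Function.comp_apply, hs i x hx, e.localFrame_apply_of_mem_baseSet b (hCU hx)]
  rw [this, (e.basisAt b (hCU hx)).span_eq]

lemma exists_finite_span_of_isCompact {K : Set P} (hK : IsCompact K) :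
    ∃ S : Set (SmoothSec n F E), S.Finite ∧
      ∀ x ∈ K, Submodule.span ℝ ((fun s : SmoothSec n F E => s x) '' S) = ⊤ := by
  refine hK.induction_on ⟨∅, finite_empty, fun x hx => absurd hx (notMem_empty x)⟩
    (fun s t hst ⟨S, hS, h⟩ => ⟨S, hS, fun x hx => h x (hst hx)⟩)
    (fun s t ⟨S, hS, h⟩ ⟨T, hT, h'⟩ => ⟨S ∪ T, hS.union hT, fun x hx => ?_⟩) fun x _ => ?_
  · rw [image_union, Submodule.span_union]
    rcases hx with hx | hx
    · rw [h x hx, top_sup_eq]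
    · rw [h' x hx, sup_top_eq]
  · obtain ⟨S, hS, h⟩ := exists_finite_span_nhds (n := n) (F := F) (E := E) x
    exact ⟨_, mem_nhdsWithin_of_mem_nhds h, S, hS, fun y hy => hy⟩

end Extension

section Dimension

variable [IsManifold (𝓡 n) ∞ P] [FiniteDimensional ℝ F] [ContMDiffVectorBundle ∞ F E (𝓡 n)]

/-- The covectors of `E`, evaluated on `m` sections, form a subset of `ℝ^m` of dimension at most
the dimension of the total space of `E^*`. -/
lemma dimH_range_covector_le [SecondCountableTopology P] {m : ℕ} (s : Fin m → SmoothSec n F E) :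
    dimH {v : Fin m → ℝ | ∃ x, ∃ l : E x →ₗ[ℝ] ℝ, v = fun i => l (s i x)}
      ≤ (n + finrank ℝ F : ℕ) := by
  have hloc : ∀ x₀ : P, ∃ V ∈ 𝓝 x₀,
      dimH {v : Fin m → ℝ | ∃ x ∈ V, ∃ l : E x →ₗ[ℝ] ℝ, v = fun i => l (s i x)}
        ≤ (n + finrank ℝ F : ℕ) := by
    intro x₀
    let e := trivializationAt F E x₀
    let φ := extChartAt (𝓡 n) x₀
    have hO : IsOpen (φ.target ∩ φ.symm ⁻¹' e.baseSet) :=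
      (continuousOn_extChartAt_symm x₀).isOpen_inter_preimage (isOpen_extChartAt_target x₀)
        e.open_baseSet
    have hx₀ : φ x₀ ∈ φ.target ∩ φ.symm ⁻¹' e.baseSet :=
      ⟨mem_extChartAt_target x₀, by
        rw [mem_preimage, extChartAt_to_inv]; exact mem_baseSet_trivializationAt F E x₀⟩
    obtain ⟨ε, hε, hball⟩ := Metric.isOpen_iff.1 hO _ hx₀
    let Φ : EuclideanSpace ℝ (Fin n) × (F →L[ℝ] ℝ) → Fin m → ℝ :=
      fun p i => p.2 (e ⟨φ.symm p.1, s i (φ.symm p.1)⟩).2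
    have hΦ : ContDiffOn ℝ ∞ Φ (Metric.ball (φ x₀) ε ×ˢ univ) := by
      refine contDiffOn_pi.2 fun i => ?_
      have h₁ : ContMDiffOn 𝓘(ℝ, EuclideanSpace ℝ (Fin n)) 𝓘(ℝ, F) ∞
          (fun z => (e ⟨φ.symm z, s i (φ.symm z)⟩).2) (Metric.ball (φ x₀) ε) :=
        (e.contMDiffOn_section_baseSet_iff.1 (s i).contMDiff.contMDiffOn).comp
          ((contMDiffOn_extChartAt_symm x₀).mono fun z hz => (hball hz).1)
          fun z hz => (hball hz).2
      exact contDiffOn_snd.clm_apply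
        ((contMDiffOn_iff_contDiffOn.1 h₁).comp contDiffOn_fst fun p hp => hp.1)
    refine ⟨φ.source ∩ φ ⁻¹' Metric.ball (φ x₀) ε, ?_, ?_⟩
    · exact (continuousOn_extChartAt x₀).isOpen_inter_preimage (isOpen_extChartAt_source x₀)
        Metric.isOpen_ball |>.mem_nhds ⟨mem_extChartAt_source x₀, Metric.mem_ball_self hε⟩
    · refine (dimH_mono (t := Φ '' (Metric.ball (φ x₀) ε ×ˢ univ)) ?_).trans
        (((hΦ.of_le (by simp)).dimH_image_le ((convex_ball _ _).prod convex_univ)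
          subset_rfl).trans ((dimH_mono (subset_univ _)).trans ?_))
      · rintro v ⟨x, ⟨hxs, hx⟩, l, rfl⟩
        have hxe : x ∈ e.baseSet := by
          have := (hball hx).2
          rwa [mem_preimage, φ.left_inv hxs] at this
        refine ⟨⟨φ x, LinearMap.toContinuousLinearMap
          (l ∘ₗ (e.linearEquivAt ℝ x hxe).symm.toLinearMap)⟩, ⟨hx, trivial⟩, ?_⟩
        funext i
        change l ((e.linearEquivAt ℝ x hxe).symm (e ⟨φ.symm (φ x), s i (φ.symm (φ x))⟩).2) = _
        rw [φ.left_inv hxs]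
        exact congrArg l ((e.linearEquivAt ℝ x hxe).symm_apply_apply (s i x))
      · rw [Real.dimH_univ_eq_finrank, finrank_prod]
        simp [← (LinearMap.toContinuousLinearMap (𝕜 := ℝ) (E := F) (F' := ℝ)).finrank_eq]
  choose V hV hdim using hloc
  obtain ⟨T, hT, hcov⟩ := TopologicalSpace.countable_cover_nhds hV
  have := hT.to_subtype
  refine (dimH_mono (t := ⋃ x₀ : T,
    {v : Fin m → ℝ | ∃ x ∈ V x₀, ∃ l : E x →ₗ[ℝ] ℝ, v = fun i => l (s i x)}) ?_).trans ?_
  · rintro v ⟨x, l, rfl⟩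
    obtain ⟨x₀, hx₀, hx⟩ := mem_iUnion₂.1 (hcov ▸ mem_univ x : x ∈ ⋃ y ∈ T, V y)
    exact mem_iUnion.2 ⟨⟨x₀, hx₀⟩, x, hx, l, rfl⟩
  · rw [dimH_iUnion]
    exact iSup_le fun x₀ => hdim x₀

/-- Given more than `n + rank E` sections, one of them can be dropped after a generic projection,
without changing the span at any point where the sections span the fibre. -/
lemma exists_span_of_succ [SecondCountableTopology P] {m : ℕ} (hm : n + finrank ℝ F < m + 1)
    (s : Fin (m + 1) → SmoothSec n F E) : ∃ t : Fin m → SmoothSec n F E, ∀ x,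
      Submodule.span ℝ (range fun i => s i x) = ⊤ →
        Submodule.span ℝ (range fun i => t i x) = ⊤ := by
  have hd := dense_compl_of_dimH_lt_finrank ((dimH_range_covector_le s).trans_lt
    (by rw [finrank_fin_fun]; exact_mod_cast hm))
  have ho : IsOpen {v : Fin (m + 1) → ℝ | v (Fin.last m) ≠ 0} :=
    isOpen_ne_fun (continuous_apply _) continuous_const
  obtain ⟨v, hv, hv'⟩ := hd.inter_open_nonempty _ ho ⟨fun _ => 1, one_ne_zero⟩
  have hv0 : v (Fin.last m) ≠ 0 := hv
  refine ⟨fun i => v (Fin.last m) • s i.castSucc - v i.castSucc • s (Fin.last m),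
    fun x hx => ?_⟩
  by_contra hne
  obtain ⟨l, hl, hker⟩ := Submodule.exists_le_ker_of_lt_top _ (lt_top_iff_ne_top.2 hne)
  have h (i : Fin m) : v (Fin.last m) * l (s i.castSucc x) = v i.castSucc * l (s (Fin.last m) x) := by
    have := hker (Submodule.subset_span ⟨i, rfl⟩)
    rw [LinearMap.mem_ker] at this
    simpa [sub_eq_zero] using this
  have hc : l (s (Fin.last m) x) ≠ 0 := fun h0 => hl <| by
    refine LinearMap.ext_on_range (v := fun i => s i x) hx fun i => ?_
    refine Fin.lastCases (by simpa using h0) (fun i => ?_) i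
    have := h i
    rw [h0, mul_zero] at this
    simpa using (mul_eq_zero.1 this).resolve_left hv0
  refine hv' ⟨x, (v (Fin.last m) / l (s (Fin.last m) x)) • l, funext fun i => ?_⟩
  rw [LinearMap.smul_apply, smul_eq_mul]
  refine Fin.lastCases (by field_simp) (fun i => ?_) i
  have := h i
  field_simp
  linarith

end Dimension

section Global

variable [IsManifold (𝓡 n) ∞ P] [T2Space P] [SecondCountableTopology P] [SigmaCompactSpace P]
  [FiniteDimensional ℝ F] [ContMDiffVectorBundle ∞ F E (𝓡 n)]

lemma exists_span_of_isCompact {K : Set P} (hK : IsCompact K) :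
    ∃ s : Fin (n + finrank ℝ F) → SmoothSec n F E,
      ∀ x ∈ K, Submodule.span ℝ (range fun i => s i x) = ⊤ := by
  have key : ∀ m, ∀ s : Fin m → SmoothSec n F E, ∃ t : Fin (n + finrank ℝ F) → SmoothSec n F E,
      ∀ x, Submodule.span ℝ (range fun i => s i x) = ⊤ →
        Submodule.span ℝ (range fun i => t i x) = ⊤ := by
    intro m
    induction m with
    | zero =>
      refine fun s => ⟨0, fun x hx => ?_⟩
      rw [range_eq_empty, Submodule.span_empty] at hx
      exact top_le_iff.1 (hx ▸ bot_le)
    | succ m ih =>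
      intro s
      rcases lt_or_ge (n + finrank ℝ F) (m + 1) with h | h
      · obtain ⟨t, ht⟩ := exists_span_of_succ h s
        obtain ⟨u, hu⟩ := ih t
        exact ⟨u, fun x hx => hu x (ht x hx)⟩
      · refine ⟨fun i => if h : i.1 < m + 1 then s ⟨i, h⟩ else 0, fun x hx => ?_⟩
        refine top_le_iff.1 (hx ▸ Submodule.span_mono ?_)
        rintro _ ⟨i, rfl⟩
        exact ⟨i.castLE h, by simp [Nat.lt_succ_iff.1 i.2]⟩
  obtain ⟨S, hS, h⟩ := exists_finite_span_of_isCompact (n := n) (F := F) (E := E) hK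
  obtain ⟨m, s, rfl⟩ : ∃ m, ∃ s : Fin m → SmoothSec n F E, range s = S := by
    have := hS.fintype
    exact ⟨_, fun i => ((Fintype.equivFin S).symm i).1, by
      rw [← Function.comp_def, range_comp, Equiv.range_eq_univ, image_univ, Subtype.range_coe]⟩
  obtain ⟨t, ht⟩ := key m s
  refine ⟨t, fun x hx => ht x ?_⟩
  rw [← h x hx, ← range_comp]
  rfl

omit [SecondCountableTopology P] [FiniteDimensional ℝ F] [ContMDiffVectorBundle ∞ F E (𝓡 n)] in
/-- Sections prescribed on the members of a locally finite disjoint family of closed sets extend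
to a single section. -/
lemma exists_section_eqOn_iUnion (C : ℕ → Set P) (hC : ∀ k, IsClosed (C k))
    (hfin : LocallyFinite C) (hdisj : ∀ k l x, x ∈ C k → x ∈ C l → k = l)
    (s : ℕ → SmoothSec n F E) : ∃ t : SmoothSec n F E, ∀ k, ∀ x ∈ C k, t x = s k x := by
  refine (exists_contMDiffSection_forall_mem_convex_of_local (n := ⊤) (𝓡 n) E
    (fun x => {v | ∀ k, x ∈ C k → v = s k x}) (fun x v hv w hw a b _ _ hab k hx => ?_)
    fun x => ?_).imp fun t ht k x hx => ht x k hx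
  · rw [hv k hx, hw k hx, ← add_smul, hab, one_smul]
  · have hnhds := hfin.iInter_compl_mem_nhds hC x
    by_cases hx : ∃ k, x ∈ C k
    · obtain ⟨k, hk⟩ := hx
      refine ⟨_, hnhds, s k, (s k).contMDiff.contMDiffOn, fun y hy l hl => ?_⟩
      by_cases hxl : x ∈ C l
      · rw [hdisj k l x hk hxl]
      · exact absurd hl (mem_iInter₂.1 hy l hxl)
    · exact ⟨_, hnhds, fun _ => 0, (contMDiff_zeroSection ℝ E).contMDiffOn,
        fun y hy l hl => absurd hl (mem_iInter₂.1 hy l fun h => hx ⟨l, h⟩)⟩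

/-- Finitely many global sections span every fibre. -/
lemma exists_span : ∃ m, ∃ s : Fin m → SmoothSec n F E,
    ∀ x, Submodule.span ℝ (range fun i => s i x) = ⊤ := by
  have : LocallyCompactSpace P := ChartedSpace.locallyCompactSpace (EuclideanSpace ℝ (Fin n)) P
  have : WeaklyLocallyCompactSpace P := inferInstance
  let K₀ : CompactExhaustion P := default
  let K := K₀.shiftr
  choose s hs using fun k => exists_span_of_isCompact (n := n) (F := F) (E := E)
    (K.isCompact (k + 1))
  let C (k : ℕ) : Set P := K (k + 1) \ interior (K k)
  have hCc (k : ℕ) : IsClosed (C k) := ((K.isCompact _).isClosed).sdiff isOpen_interior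
  have hlt {k l : ℕ} {x : P} (hk : x ∈ C k) (hl : x ∈ C l) : l < k + 2 := by
    by_contra h
    exact hl.2 (interior_mono (K.subset (not_lt.1 h)) (K.subset_interior_succ (k + 1) hk.1))
  have hfin : LocallyFinite C := fun x => by
    obtain ⟨k, hk⟩ := K.exists_mem x
    refine ⟨interior (K (k + 1)), isOpen_interior.mem_nhds (K.subset_interior_succ k hk),
      (finite_lt_nat (k + 1)).subset fun l ⟨y, hy, hy'⟩ => ?_⟩
    by_contra h
    exact hy.2 (interior_mono (K.subset (not_lt.1 h)) hy')
  -- the annuli of one parity are pairwise disjoint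
  have hpar (j : Fin 2) : ∃ t : Fin (n + finrank ℝ F) → SmoothSec n F E,
      ∀ k, ∀ i, ∀ x ∈ C (2 * k + j), t i x = s (2 * k + j) i x := by
    have := fun i => exists_section_eqOn_iUnion (fun k => C (2 * k + j)) (fun k => hCc _)
      (hfin.comp_injective fun a b h => by simpa using h)
      (fun k l x hk hl => by have := hlt hk hl; have := hlt hl hk; omega)
      (fun k => s (2 * k + j) i)
    choose t ht using this
    exact ⟨t, fun k i => ht i k⟩
  choose t ht using hpar
  let σ := (finProdFinEquiv (m := 2) (n := n + finrank ℝ F)).symm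
  refine ⟨_, fun i => t (σ i).1 (σ i).2, fun x => ?_⟩
  obtain ⟨k, hk⟩ : ∃ k, x ∈ C k :=
    ⟨_, (K₀.mem_sdiff_shiftr_find x).1, fun h =>
      (K₀.mem_sdiff_shiftr_find x).2 (interior_subset h)⟩
  rw [← top_le_iff, ← hs k x hk.1]
  refine Submodule.span_mono ?_
  rintro _ ⟨i, rfl⟩
  refine ⟨σ.symm (⟨k % 2, Nat.mod_lt _ two_pos⟩, i), ?_⟩
  have h := ht ⟨k % 2, Nat.mod_lt _ two_pos⟩ (k / 2) i x
  simp only [Nat.div_add_mod] at h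
  simpa using h hk

end Global
end Spanning
end QuantumGroupoids

namespace QuantumGroupoids

/-! ### Dual systems of sections -/

section DualSections

open Set Filter Topology Module

variable {n : ℕ} {P : Type*} [TopologicalSpace P] [ChartedSpace (EuclideanSpace ℝ (Fin n)) P]
  {F : Type*} [NormedAddCommGroup F] [NormedSpace ℝ F]
  {E : P → Type*} [TopologicalSpace (TotalSpace F E)] [∀ x, AddCommGroup (E x)]
  [∀ x, Module ℝ (E x)] [∀ x, TopologicalSpace (E x)] [FiberBundle F E] [VectorBundle ℝ F E]
  [IsManifold (𝓡 n) ∞ P] [ContMDiffVectorBundle ∞ F E (𝓡 n)]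

omit [IsManifold (𝓡 n) ∞ P] in
/-- Smoothness of a bundle map to a trivial bundle, in a trivialization. -/
lemma contMDiffOn_hom_trivial_iff {G : Type*} [NormedAddCommGroup G] [NormedSpace ℝ G]
    (T : ∀ x, E x →L[ℝ] Bundle.Trivial P G x) (x₀ : P) {U : Set P} (hU : IsOpen U)
    (hUe : U ⊆ (trivializationAt F E x₀).baseSet) :
    ContMDiffOn (𝓡 n) ((𝓡 n).prod 𝓘(ℝ, F →L[ℝ] G)) ∞
        (fun x => TotalSpace.mk' (F →L[ℝ] G) (E := fun x => E x →L[ℝ] Bundle.Trivial P G x)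
          x (T x)) U ↔
      ContMDiffOn (𝓡 n) 𝓘(ℝ, F →L[ℝ] G) ∞
        (fun x => (show E x →L[ℝ] G from T x).comp
          ((trivializationAt F E x₀).symmL ℝ x)) U := by
  rw [(trivializationAt (F →L[ℝ] G) (fun x => E x →L[ℝ] Bundle.Trivial P G x)
    x₀).contMDiffOn_section_iff hU fun x hx => by simpa using hUe hx]
  refine contMDiffOn_congr fun x hx => ?_
  rw [hom_trivializationAt_apply]
  ext v
  simp [ContinuousLinearMap.inCoordinates]

variable [T2Space P] [SigmaCompactSpace P] [FiniteDimensional ℝ F]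

/-- Sections that span every fibre have a smooth family of coefficients. -/
lemma exists_dual_sections {m : ℕ} (s : Fin m → SmoothSec n F E)
    (hs : ∀ x, Submodule.span ℝ (range fun i => s i x) = ⊤) :
    ∃ ξ : Fin m → SmoothSec n (F →L[ℝ] ℝ) (DualBundle E), ∀ x (v : E x),
      ∑ i, ξ i x v • s i x = v := by
  obtain ⟨T, hT⟩ := exists_contMDiffSection_forall_mem_convex_of_local (n := ⊤) (𝓡 n)
    (F_fiber := F →L[ℝ] (Fin m → ℝ)) (fun x => E x →L[ℝ] Bundle.Trivial P (Fin m → ℝ) x)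
    (fun x => {T | ∀ v, ∑ i, (T v : Fin m → ℝ) i • s i x = v})
    (fun x T hT T' hT' a b _ _ hab v => by
      have : ∀ i, ((a • T + b • T') v : Fin m → ℝ) i
        = a * (T v : Fin m → ℝ) i + b * (T' v : Fin m → ℝ) i := fun i => rfl
      simp only [this, add_smul, mul_smul, Finset.sum_add_distrib, ← Finset.smul_sum]
      rw [hT v, hT' v, ← add_smul, hab, one_smul])
    (fun x₀ => by
      let e := trivializationAt F E x₀
      have hx₀ : x₀ ∈ e.baseSet := mem_baseSet_trivializationAt F E x₀
      let S (x : P) : (Fin m → ℝ) →L[ℝ] F :=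
        ∑ i, (ContinuousLinearMap.proj (R := ℝ) (φ := fun _ : Fin m => ℝ) i).smulRight
          (e ⟨x, s i x⟩).2
      have hS (x : P) (hx : x ∈ e.baseSet) (c : Fin m → ℝ) :
          S x c = e.linearEquivAt ℝ x hx (∑ i, c i • s i x) := by
        simp [S]
      have hsurj : Function.Surjective (S x₀) := fun w => by
        have : (e.linearEquivAt ℝ x₀ hx₀).symm w ∈ Submodule.span ℝ (range fun i => s i x₀) :=
          hs x₀ ▸ trivial
        obtain ⟨c, hc⟩ := (Submodule.mem_span_range_iff_exists_fun ℝ).1 this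
        exact ⟨c, by rw [hS x₀ hx₀, hc, LinearEquiv.apply_symm_apply]⟩
      obtain ⟨B₀, hB₀⟩ := (S x₀ : (Fin m → ℝ) →ₗ[ℝ] F).exists_rightInverse_of_surjective
        (LinearMap.range_eq_top.2 hsurj)
      let B : F →L[ℝ] (Fin m → ℝ) := LinearMap.toContinuousLinearMap B₀
      let N (x : P) : F →L[ℝ] F := (S x).comp B
      have hN : ContMDiffOn (𝓡 n) 𝓘(ℝ, F →L[ℝ] F) ∞ N e.baseSet := by
        have hS' : ContMDiffOn (𝓡 n) 𝓘(ℝ, (Fin m → ℝ) →L[ℝ] F) ∞ S e.baseSet := by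
          refine contMDiffOn_finsetSum fun i _ => ?_
          have h := e.contMDiffOn_section_baseSet_iff.1 ((s i).contMDiff.contMDiffOn)
          exact ((ContinuousLinearMap.smulRightL ℝ (Fin m → ℝ) F
            (ContinuousLinearMap.proj i)).contMDiff (n := ∞)).comp_contMDiffOn h
        exact ((((ContinuousLinearMap.compL ℝ F (Fin m → ℝ) F).flip B).contMDiff
          (n := ∞))).comp_contMDiffOn hS'
      have hN₀ : N x₀ = 1 := ContinuousLinearMap.ext fun v => LinearMap.congr_fun hB₀ v
      let U := e.baseSet ∩ N ⁻¹' {u | IsUnit u}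
      have hU : IsOpen U := hN.continuousOn.isOpen_inter_preimage e.open_baseSet Units.isOpen
      refine ⟨U, hU.mem_nhds ⟨hx₀, by rw [mem_preimage, hN₀]; exact isUnit_one⟩,
        fun x => (B.comp (Ring.inverse (N x))).comp (e.continuousLinearMapAt ℝ x), ?_, ?_⟩
      · refine (contMDiffOn_hom_trivial_iff _ x₀ hU inter_subset_left).2 ?_
        have h : ContMDiffOn (𝓡 n) 𝓘(ℝ, F →L[ℝ] F) ∞ (fun x => Ring.inverse (N x)) U := by
          rintro x ⟨hxe, ⟨u, hu⟩⟩
          have := (contDiffAt_ringInverse ℝ (n := ∞) u).contMDiffAt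
          rw [hu] at this
          exact this.comp_contMDiffWithinAt x ((hN x hxe).mono inter_subset_left)
        refine (((ContinuousLinearMap.compL ℝ F F (Fin m → ℝ) B).contMDiff
          (n := ∞)).comp_contMDiffOn h).congr fun x hx => ?_
        refine ContinuousLinearMap.ext fun v => ?_
        change B (Ring.inverse (N x) (e.continuousLinearMapAt ℝ x (e.symmL ℝ x v))) = _
        rw [e.continuousLinearMapAt_symmL hx.1]
        rfl
      · rintro x ⟨hxe, hxu⟩ v
        refine (e.linearEquivAt ℝ x hxe).injective ?_
        rw [← hS x hxe]
        change (N x * Ring.inverse (N x)) (e.continuousLinearMapAt ℝ x v) = _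
        rw [Ring.mul_inverse_cancel _ hxu]
        simp [e.linearMapAt_apply, hxe])
  have hsm (i : Fin m) : ContMDiff (𝓡 n) ((𝓡 n).prod 𝓘(ℝ, F →L[ℝ] ℝ)) ∞
      (fun x => TotalSpace.mk' (F →L[ℝ] ℝ) (E := DualBundle E) x
        ((ContinuousLinearMap.proj (R := ℝ) (φ := fun _ : Fin m => ℝ) i).comp (T x))) := by
    intro x₀
    have ho := (trivializationAt F E x₀).open_baseSet
    refine ContMDiffOn.contMDiffAt ?_ (ho.mem_nhds (mem_baseSet_trivializationAt F E x₀))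
    refine (contMDiffOn_hom_trivial_iff _ x₀ ho subset_rfl).2 ?_
    have := (contMDiffOn_hom_trivial_iff _ x₀ ho subset_rfl).1 T.contMDiff.contMDiffOn
    exact ((ContinuousLinearMap.compL ℝ F (Fin m → ℝ) ℝ (ContinuousLinearMap.proj i)).contMDiff
      (n := ∞)).comp_contMDiffOn this
  exact ⟨fun i => ⟨_, hsm i⟩, fun x v => hT x v⟩

@[simp] lemma sectionPairing_apply {n : ℕ} {P : Type*} [TopologicalSpace P]
    [ChartedSpace (EuclideanSpace ℝ (Fin n)) P] {F : Type*} [NormedAddCommGroup F]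
    [NormedSpace ℝ F] {E : P → Type*} [TopologicalSpace (TotalSpace F E)]
    [∀ x, AddCommGroup (E x)] [∀ x, Module ℝ (E x)] [∀ x, TopologicalSpace (E x)]
    [FiberBundle F E] [VectorBundle ℝ F E] (ξ : SmoothSec n (F →L[ℝ] ℝ) (DualBundle E))
    (X : SmoothSec n F E) (x : P) : sectionPairing ξ X x = ξ x (X x) := rfl

/-- Finite families of sections of `E` and of `E^*` with `X = Σ ⟨ξ_i, X⟩ s_i`. -/
structure SectionDualSystem (n : ℕ) {P : Type*} [TopologicalSpace P]
    [ChartedSpace (EuclideanSpace ℝ (Fin n)) P] (F : Type*) [NormedAddCommGroup F]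
    [NormedSpace ℝ F] (E : P → Type*) [TopologicalSpace (TotalSpace F E)]
    [∀ x, AddCommGroup (E x)] [∀ x, Module ℝ (E x)]
    [∀ x, TopologicalSpace (E x)] [FiberBundle F E] [VectorBundle ℝ F E] where
  card : ℕ
  sec : Fin card → SmoothSec n F E
  form : Fin card → SmoothSec n (F →L[ℝ] ℝ) (DualBundle E)
  sum_apply : ∀ x (v : E x), ∑ i, form i x v • sec i x = v

lemma nonempty_sectionDualSystem [SecondCountableTopology P] :
    Nonempty (SectionDualSystem n F E) := by
  obtain ⟨m, s, hs⟩ := exists_span (n := n) (F := F) (E := E)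
  obtain ⟨ξ, hξ⟩ := exists_dual_sections s hs
  exact ⟨⟨m, s, ξ, hξ⟩⟩

end DualSections

section Pairing

variable {n : ℕ} {P : Type*} [TopologicalSpace P] [ChartedSpace (EuclideanSpace ℝ (Fin n)) P]
  {F : Type*} [NormedAddCommGroup F] [NormedSpace ℝ F]
  {E : P → Type*} [TopologicalSpace (TotalSpace F E)] [∀ x, AddCommGroup (E x)]
  [∀ x, Module ℝ (E x)] [∀ x, TopologicalSpace (E x)] [FiberBundle F E] [VectorBundle ℝ F E]

namespace SectionDualSystem

variable (D : SectionDualSystem n F E)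

lemma sum_eq (X : SmoothSec n F E) : ∑ i, sectionPairing (D.form i) X • D.sec i = X := by
  refine ContMDiffSection.ext fun x => ?_
  have := D.sum_apply x (X x)
  rw [← ContMDiffSection.coeAddHom_apply, map_sum, Finset.sum_apply]
  exact this

/-- The dual system of the module of sections. -/
def dualSystem : DualSystem (SmoothFun n P) (SmoothSec n F E) where
  card := D.card
  sec := D.sec
  form i := sectionPairing (D.form i)
  sum_eq := D.sum_eq

include D in
lemma sectionPairing_bijective : Function.Bijective
    (sectionPairing : SmoothSec n (F →L[ℝ] ℝ) (DualBundle E) →ₗ[SmoothFun n P] _) := by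
  refine ⟨(injective_iff_map_eq_zero _).2 fun ξ hξ => ContMDiffSection.ext fun x => ?_,
    fun l => ⟨∑ i, l (D.sec i) • D.form i, LinearMap.ext fun X => ?_⟩⟩
  · refine ContinuousLinearMap.ext fun v => ?_
    rw [← D.sum_apply x v, map_sum]
    simp only [map_smul]
    refine (Finset.sum_eq_zero fun i _ => ?_).trans rfl
    have : ξ x (D.sec i x) = (0 : ℝ) :=
      congrArg (fun f : SmoothFun n P => f x) (LinearMap.congr_fun hξ (D.sec i))
    rw [this, smul_zero]
  · conv_rhs => rw [← D.sum_eq X]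
    simp only [map_sum, map_smul, LinearMap.sum_apply, LinearMap.smul_apply, smul_eq_mul]
    exact Finset.sum_congr rfl fun i _ => mul_comm _ _

end SectionDualSystem
end Pairing
end QuantumGroupoids

namespace QuantumGroupoids

/-! ### Local frames cut out by minors of a dual system -/

section Linear

open Module

lemma exists_fin_linearIndependent {V ι : Type*} [AddCommGroup V] [Module ℝ V]
    [FiniteDimensional ℝ V] {r : ℕ} (hr : finrank ℝ V = r) (u : ι → V)
    (hu : Submodule.span ℝ (Set.range u) = ⊤) :
    ∃ b : Fin r → ι, LinearIndependent ℝ fun j => u (b j) := by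
  obtain ⟨f, hf, -, hf'⟩ := Submodule.exists_fun_fin_finrank_span_eq ℝ (Set.range u)
  have h : finrank ℝ (Submodule.span ℝ (Set.range u)) = r := by rw [hu, finrank_top, hr]
  choose b hb using hf
  refine ⟨fun j => b (Fin.cast h.symm j), ?_⟩
  simp only [hb]
  exact hf'.comp _ (Fin.cast_injective h.symm)

/-- The pairing of a basis with a basis of the dual space has a nonzero determinant. -/
lemma exists_det_ne_zero {V : Type*} [AddCommGroup V] [Module ℝ V] [FiniteDimensional ℝ V]
    {r N : ℕ} (hr : finrank ℝ V = r) (s : Fin N → V) (ξ : Fin N → V →ₗ[ℝ] ℝ)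
    (h : ∀ v, ∑ i, ξ i v • s i = v) : ∃ a b : Fin r → Fin N,
      (Matrix.of fun i j => ξ (a i) (s (b j))).det ≠ 0 := by
  have hs : Submodule.span ℝ (Set.range s) = ⊤ := Submodule.eq_top_iff'.2 fun v =>
    (Submodule.mem_span_range_iff_exists_fun ℝ).2 ⟨_, h v⟩
  have hξ : Submodule.span ℝ (Set.range ξ) = ⊤ := Submodule.eq_top_iff'.2 fun l =>
    (Submodule.mem_span_range_iff_exists_fun ℝ).2 ⟨fun i => l (s i), LinearMap.ext fun v => by
      conv_rhs => rw [← h v]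
      simp [mul_comm]⟩
  obtain ⟨b, hb⟩ := exists_fin_linearIndependent hr s hs
  have hr' : finrank ℝ (V →ₗ[ℝ] ℝ) = r := (Subspace.dual_finrank_eq).trans hr
  obtain ⟨a, ha⟩ := exists_fin_linearIndependent hr' ξ hξ
  have ha' := ha.span_eq_top_of_card_eq_finrank' (by rw [Fintype.card_fin, hr'])
  refine ⟨a, b, fun h0 => ?_⟩
  obtain ⟨c, hc, hc'⟩ := Matrix.exists_mulVec_eq_zero_iff.2 h0
  have hv : ∑ j, c j • s (b j) = 0 := by
    refine (forall_dual_apply_eq_zero_iff ℝ _).1 fun l => ?_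
    have hl : l ∈ Submodule.span ℝ (Set.range fun i => ξ (a i)) := ha' ▸ trivial
    induction hl using Submodule.span_induction with
    | mem l hl =>
      obtain ⟨i, rfl⟩ := hl
      have := congrFun hc' i
      simpa [Matrix.mulVec, dotProduct, mul_comm] using this
    | zero => rfl
    | add l l' _ _ hl hl' => rw [LinearMap.add_apply, hl, hl', add_zero]
    | smul t l _ hl => rw [LinearMap.smul_apply, hl, smul_zero]
  exact hc (funext (Fintype.linearIndependent_iff.1 hb c hv))

end Linear

section Minors

open Module

variable {n : ℕ} {P : Type*} [TopologicalSpace P] [ChartedSpace (EuclideanSpace ℝ (Fin n)) P]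
  {F : Type*} [NormedAddCommGroup F] [NormedSpace ℝ F]
  {E : P → Type*} [TopologicalSpace (TotalSpace F E)] [∀ x, AddCommGroup (E x)]
  [∀ x, Module ℝ (E x)] [∀ x, TopologicalSpace (E x)] [FiberBundle F E] [VectorBundle ℝ F E]

instance : IsReduced (SmoothFun n P) where
  eq_zero f := fun ⟨k, hk⟩ => by
    ext x
    have := congrArg (fun g : SmoothFun n P => g x) hk
    exact IsNilpotent.eq_zero (x := f x) ⟨k, this⟩

/-- Sections of `E` and `E^*` which are dual bases wherever `scale` does not vanish. -/
def localFrameOfSections [FiniteDimensional ℝ F] (scale : SmoothFun n P)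
    (sec : Fin (finrank ℝ F) → SmoothSec n F E)
    (form : Fin (finrank ℝ F) → SmoothSec n (F →L[ℝ] ℝ) (DualBundle E))
    (h : ∀ x, scale x ≠ 0 → ∀ i j, form i x (sec j x) = if i = j then (1 : ℝ) else 0) :
    LocalFrame (SmoothFun n P) (SmoothSec n F E) where
  card := finrank ℝ F
  scale := scale
  sec := sec
  form i := sectionPairing (form i)
  sum_eq X := by
    refine ContMDiffSection.ext fun x => ?_
    rw [smul_sec_apply, smul_sec_apply]
    by_cases hx : scale x = 0
    · rw [hx, zero_smul, zero_smul]
    congr 1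
    rw [← ContMDiffSection.coeAddHom_apply, map_sum, Finset.sum_apply]
    change ∑ i, (form i x (X x) : ℝ) • sec i x = X x
    let e := trivializationAt F E x
    let eq := e.linearEquivAt ℝ x (mem_baseSet_trivializationAt F E x)
    have : FiniteDimensional ℝ (E x) := eq.symm.finiteDimensional
    have hli : LinearIndependent ℝ fun j => sec j x := by
      refine Fintype.linearIndependent_iff.2 fun c hc i => ?_
      have := congrArg (form i x) hc
      rw [map_sum, map_zero] at this
      simp only [map_smul, h x hx] at this
      simpa using this
    have hsp := hli.span_eq_top_of_card_eq_finrank' (by rw [Fintype.card_fin, eq.finrank_eq])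
    obtain ⟨c, hc⟩ := (Submodule.mem_span_range_iff_exists_fun ℝ).1
      (hsp ▸ trivial : X x ∈ Submodule.span ℝ (Set.range fun j => sec j x))
    conv_rhs => rw [← hc]
    refine Finset.sum_congr rfl fun i _ => ?_
    congr 1
    rw [← hc, map_sum]
    simp only [map_smul, h x hx]
    simp
  dual i j := by
    ext x
    by_cases hx : scale x = 0
    · simp [hx]; split_ifs <;> simp [hx]
    · have := h x hx i j
      simp [this]; split_ifs <;> simp

/-- The reciprocal of a positive smooth function. -/
def smoothInv (f : SmoothFun n P) (hf : ∀ x, 0 < f x) : SmoothFun n P :=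
  ⟨fun x => (f x)⁻¹, f.contMDiff.inv₀ fun x => (hf x).ne'⟩

/-- The composition of a smooth function with `Real.smoothTransition`. -/
def smoothStep (f : SmoothFun n P) : SmoothFun n P :=
  ⟨fun x => Real.smoothTransition (f x), Real.smoothTransition.contDiff.contMDiff.comp f.contMDiff⟩

lemma smoothFun_sum_apply {ι : Type*} (s : Finset ι) (f : ι → SmoothFun n P) (x : P) :
    (∑ i ∈ s, f i) x = ∑ i ∈ s, f i x :=
  map_sum (ContMDiffMap.evalRingHom x : SmoothFun n P →+* ℝ) f s

/-- Finitely many functions without common zero admit smooth functions `h` and `θ` with `h D = 1`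
where `θ ≠ 0`, such that the `θ` have no common zero either. -/
lemma exists_partial_inverse {ι : Type*} [Fintype ι] (D : ι → SmoothFun n P)
    (hD : ∀ x, ∃ k, D k x ≠ 0) : ∃ h θ : ι → SmoothFun n P,
      (∀ k x, θ k x ≠ 0 → h k x * D k x = 1) ∧ ∃ g : ι → SmoothFun n P, ∑ k, g k * θ k = 1 := by
  have hW : ∀ x, 0 < (∑ k, D k ^ 2) x := fun x => by
    obtain ⟨k, hk⟩ := hD x
    rw [smoothFun_sum_apply]
    exact Finset.sum_pos' (fun i _ => sq_nonneg (D i x)) ⟨k, Finset.mem_univ k, by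
      change 0 < (D k x) ^ 2; positivity⟩
  let q (k : ι) : SmoothFun n P := D k ^ 2 * smoothInv _ hW
  have hq0 (k x) : 0 ≤ q k x := mul_nonneg (sq_nonneg (D k x)) (inv_nonneg.2 (hW x).le)
  have hq1 (x) : ∑ k, q k x = 1 := by
    rw [← smoothFun_sum_apply, ← Finset.sum_mul]
    exact mul_inv_cancel₀ (hW x).ne'
  -- at every point some `q k` exceeds `c`
  let c : ℝ := ((Fintype.card ι : ℝ) + 1)⁻¹
  have hc : 0 < c := by positivity
  have hqc (x) : ∃ k, c < q k x := by
    by_contra! h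
    have h₁ := Finset.sum_le_sum fun k (_ : k ∈ Finset.univ) => h k
    rw [hq1, Finset.sum_const, Finset.card_univ, nsmul_eq_mul] at h₁
    have h₂ : ((Fintype.card ι : ℝ) + 1) * c = 1 := mul_inv_cancel₀ (by positivity)
    linarith
  -- `t ↦ 1 / (t + 1 - smoothTransition (t / c))` is smooth on `t ≥ 0` and is `1 / t` for `t ≥ c`
  let den (k : ι) : SmoothFun n P := q k + 1 - smoothStep ((c⁻¹ : ℝ) • q k)
  have hden (k x) : 0 < den k x := by
    change 0 < q k x + 1 - Real.smoothTransition (c⁻¹ * q k x)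
    rcases (hq0 k x).eq_or_lt with h | h
    · rw [← h, mul_zero, Real.smoothTransition.zero]; norm_num
    · have := Real.smoothTransition.le_one (c⁻¹ * q k x)
      linarith
  let θ (k : ι) : SmoothFun n P := smoothStep (q k - algebraMap ℝ _ c)
  have hθ (k x) : θ k x = Real.smoothTransition (q k x - c) := rfl
  have hΘ : ∀ x, 0 < (∑ k, θ k) x := fun x => by
    obtain ⟨k, hk⟩ := hqc x
    rw [smoothFun_sum_apply]
    exact Finset.sum_pos' (fun i _ => Real.smoothTransition.nonneg _) ⟨k, Finset.mem_univ k, by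
      rw [hθ]; exact Real.smoothTransition.pos_of_pos (sub_pos.2 hk)⟩
  refine ⟨fun k => D k * smoothInv _ hW * smoothInv (den k) (hden k), θ, fun k x hx => ?_,
    fun _ => smoothInv _ hΘ, ?_⟩
  · have hlt : c < q k x := by
      by_contra! h
      exact hx (by rw [hθ]; exact Real.smoothTransition.zero_of_nonpos (by linarith))
    have h₁ : den k x = q k x := by
      change q k x + 1 - Real.smoothTransition (c⁻¹ * q k x) = q k x
      rw [Real.smoothTransition.one_of_one_le (by
        rw [inv_mul_eq_div, one_le_div hc]; exact hlt.le)]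
      ring
    change D k x * (smoothInv _ hW) x * (den k x)⁻¹ * D k x = 1
    have h₂ : q k x = D k x ^ 2 * (smoothInv _ hW) x := rfl
    have h₃ : q k x ≠ 0 := (hc.trans hlt).ne'
    rw [h₁]
    field_simp
    rw [h₂]
  · rw [← Finset.mul_sum]
    ext x
    exact inv_mul_cancel₀ (hΘ x).ne'

/-- A finite family of local frames whose scales generate the unit ideal. -/
lemma SectionDualSystem.exists_localFrames [FiniteDimensional ℝ F]
    (D : SectionDualSystem n F E) :
    ∃ (ι : Type) (_ : Fintype ι) (φ : ι → LocalFrame (SmoothFun n P) (SmoothSec n F E))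
      (g : ι → SmoothFun n P), ∑ k, g k * (φ k).scale = 1 := by
  let r := finrank ℝ F
  let ι := (Fin r → Fin D.card) × (Fin r → Fin D.card)
  let M (k : ι) : Matrix (Fin r) (Fin r) (SmoothFun n P) :=
    Matrix.of fun i j => sectionPairing (D.form (k.1 i)) (D.sec (k.2 j))
  obtain ⟨h, θ, hθ, g, hg⟩ := exists_partial_inverse (fun k => (M k).det) fun x => by
    let eq := (trivializationAt F E x).linearEquivAt ℝ x (mem_baseSet_trivializationAt F E x)
    have : FiniteDimensional ℝ (E x) := eq.symm.finiteDimensional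
    obtain ⟨a, b, hab⟩ := exists_det_ne_zero eq.finrank_eq (fun i => D.sec i x)
      (fun i => (D.form i x).toLinearMap) (D.sum_apply x)
    refine ⟨(a, b), fun h0 => hab ?_⟩
    rw [← h0]
    exact (RingHom.map_det (ContMDiffMap.evalRingHom x : SmoothFun n P →+* ℝ) (M (a, b))).symm
  refine ⟨ι, inferInstance, fun k => localFrameOfSections (θ k) (fun j => D.sec (k.2 j))
    (fun i => ∑ l, (h k * (M k).adjugate i l) • D.form (k.1 l)) fun x hx i j => ?_, g, hg⟩
  have h₁ : sectionPairing (∑ l, (h k * (M k).adjugate i l) • D.form (k.1 l)) (D.sec (k.2 j))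
      = h k * (M k).det * (1 : Matrix _ _ (SmoothFun n P)) i j := by
    have := congrFun (congrFun (M k).adjugate_mul i) j
    rw [Matrix.mul_apply, Matrix.smul_apply] at this
    rw [mul_assoc, ← smul_eq_mul ((M k).det), ← this, Finset.mul_sum, map_sum,
      LinearMap.sum_apply]
    refine Finset.sum_congr rfl fun l _ => ?_
    rw [map_smul, LinearMap.smul_apply, smul_eq_mul, mul_assoc]
    rfl
  refine (congrArg (fun f : SmoothFun n P => f x) h₁).trans ?_
  have h₂ := hθ k x hx
  rw [Matrix.one_apply]
  split_ifs
  · rw [mul_one]; exact h₂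
  · rw [mul_zero]; rfl

end Minors
end QuantumGroupoids

namespace QuantumGroupoids

/-! ### Point derivations and tangent vectors -/

section Hadamard

open MeasureTheory Set

/-- An integral over the unit interval depends smoothly on parameters; it is the value at `0` of
the convolution with the indicator function of the interval. -/
lemma contDiff_integral_unitInterval {V W : Type*} [NormedAddCommGroup V] [NormedSpace ℝ V]
    [NormedAddCommGroup W] [NormedSpace ℝ W] [CompleteSpace W] (H : V → ℝ → W)
    (hH : ContDiff ℝ ∞ (Function.uncurry H)) :
    ContDiff ℝ ∞ fun z => ∫ t in (0 : ℝ)..1, H z t := by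
  let χ : ContDiffBump (0 : ℝ) := ⟨1, 2, one_pos, one_lt_two⟩
  let g (z : V) (t : ℝ) : W := χ t • H z (-t)
  let u : ℝ → ℝ := indicator (Ioc 0 1) fun _ => 1
  have hu : LocallyIntegrable u := ((integrable_indicator_iff measurableSet_Ioc).2
    (integrableOn_const (by simp))).locallyIntegrable
  have hg : ContDiff ℝ ∞ (Function.uncurry g) := by
    have h₁ : ContDiff ℝ ∞ fun p : V × ℝ => χ p.2 := χ.contDiff.comp contDiff_snd
    have h₂ : ContDiff ℝ ∞ fun p : V × ℝ => (p.1, -p.2) := by fun_prop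
    exact h₁.smul (hH.comp h₂)
  have hz : ∀ z t, z ∈ (univ : Set V) → t ∉ Metric.closedBall (0 : ℝ) 2 → g z t = 0 := by
    intro z t _ ht
    have : χ t = 0 := χ.zero_of_le_dist (by
      rw [Metric.mem_closedBall, not_le] at ht; exact ht.le)
    rw [show g z t = χ t • H z (-t) from rfl, this, zero_smul]
  have key := contDiffOn_convolution_right_with_param (n := ⊤) (μ := volume)
    (ContinuousLinearMap.lsmul ℝ ℝ (E := W)) (g := g) (s := univ)
    isOpen_univ (isCompact_closedBall (0 : ℝ) 2) hz hu hg.contDiffOn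
  rw [univ_prod_univ, contDiffOn_univ] at key
  have h₀ : ContDiff ℝ ∞ fun z : V => (z, (0 : ℝ)) := by fun_prop
  convert key.comp h₀ using 1
  funext z
  rw [intervalIntegral.integral_of_le zero_le_one, ← integral_indicator measurableSet_Ioc,
    Function.comp_apply, convolution]
  refine integral_congr_ae (Filter.Eventually.of_forall fun t => ?_)
  by_cases ht : t ∈ Ioc (0 : ℝ) 1
  · have : χ (-t) = 1 := χ.one_of_mem_closedBall (by
      simp [χ, abs_le]; constructor <;> linarith [ht.1, ht.2])
    simp [u, g, ht, this]
  · simp [u, ht]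

/-- Hadamard's lemma: a smooth function is its value at `z₀` plus a linear form, depending smoothly
on `z`, in `z - z₀`. -/
lemma exists_hadamard {V : Type*} [NormedAddCommGroup V] [NormedSpace ℝ V]
    (f : V → ℝ) (hf : ContDiff ℝ ∞ f) (z₀ : V) : ∃ G : V → V →L[ℝ] ℝ,
      ContDiff ℝ ∞ G ∧ G z₀ = fderiv ℝ f z₀ ∧ ∀ z, f z - f z₀ = G z (z - z₀) := by
  have hf' : ContDiff ℝ ∞ (fderiv ℝ f) := hf.fderiv_right (by simp)
  refine ⟨fun z => ∫ t in (0 : ℝ)..1, fderiv ℝ f (z₀ + t • (z - z₀)),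
    contDiff_integral_unitInterval (fun z t => fderiv ℝ f (z₀ + t • (z - z₀)))
      (hf'.comp (by fun_prop)), by simp, fun z => ?_⟩
  have hline : Continuous fun t : ℝ => fderiv ℝ f (z₀ + t • (z - z₀)) :=
    hf'.continuous.comp (by fun_prop)
  rw [ContinuousLinearMap.intervalIntegral_apply (hline.intervalIntegrable _ _)]
  have hd (t : ℝ) : HasDerivAt (fun t : ℝ => f (z₀ + t • (z - z₀)))
      (fderiv ℝ f (z₀ + t • (z - z₀)) (z - z₀)) t := by
    have h₁ : HasDerivAt (fun t : ℝ => z₀ + t • (z - z₀)) (z - z₀) t := by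
      simpa using ((hasDerivAt_id t).smul_const (z - z₀)).const_add z₀
    exact ((hf.differentiable (by simp)) _).hasFDerivAt.comp_hasDerivAt t h₁
  rw [intervalIntegral.integral_eq_sub_of_hasDerivAt (fun t _ => hd t)
    ((hline.clm_apply continuous_const).intervalIntegrable _ _)]
  simp

end Hadamard

section PointDerivation

open Set Filter Topology

variable {n : ℕ} {P : Type*} [TopologicalSpace P] [ChartedSpace (EuclideanSpace ℝ (Fin n)) P]
  [IsManifold (𝓡 n) ∞ P] [T2Space P] [SigmaCompactSpace P]

/-- A smooth function on a neighbourhood of a point is the germ of a global one. -/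
lemma exists_smoothFun_eventuallyEq (f₀ : P → ℝ) {U : Set P} (hU : IsOpen U) {x₀ : P} (hx₀ : x₀ ∈ U)
    (hf : ContMDiffOn (𝓡 n) 𝓘(ℝ, ℝ) ∞ f₀ U) : ∃ f : SmoothFun n P, f =ᶠ[𝓝 x₀] f₀ := by
  have : LocallyCompactSpace P := ChartedSpace.locallyCompactSpace (EuclideanSpace ℝ (Fin n)) P
  obtain ⟨C, hC, hCc, hCU⟩ := exists_mem_nhds_isClosed_subset (hU.mem_nhds hx₀)
  obtain ⟨f, hf⟩ := exists_smoothFun_eqOn f₀ hCc hU hCU hf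
  exact ⟨f, mem_of_superset hC hf⟩

/-- Global functions that are the coordinates near `x₀`. -/
lemma exists_coordinates (x₀ : P) : ∃ w : Fin n → SmoothFun n P,
    ∀ᶠ x in 𝓝 x₀, ∀ i, w i x = extChartAt (𝓡 n) x₀ x i := by
  choose w hw using fun i => exists_smoothFun_eventuallyEq (n := n)
    (fun x => extChartAt (𝓡 n) x₀ x i) (chartAt (EuclideanSpace ℝ (Fin n)) x₀).open_source
    (mem_chart_source _ x₀) (((EuclideanSpace.proj (𝕜 := ℝ) i).contMDiff (n := ∞)).comp_contMDiffOn
      (contMDiffOn_extChartAt (I := 𝓡 n) (x := x₀)))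
  exact ⟨w, eventually_all.2 hw⟩

/-- A derivation at a point is determined by its values on coordinates. -/
lemma pointDerivation_eq (x₀ : P) (D : SmoothFun n P →+ ℝ)
    (hmul : ∀ f g, D (f * g) = f x₀ * D g + g x₀ * D f)
    (hconst : ∀ c : ℝ, D (algebraMap ℝ _ c) = 0) (w : Fin n → SmoothFun n P)
    (hw : ∀ᶠ x in 𝓝 x₀, ∀ i, w i x = extChartAt (𝓡 n) x₀ x i) (f : SmoothFun n P) :
    D f = fderiv ℝ (f ∘ (extChartAt (𝓡 n) x₀).symm) (extChartAt (𝓡 n) x₀ x₀)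
      (WithLp.toLp 2 fun i => D (w i)) := by
  let φ := extChartAt (𝓡 n) x₀
  obtain ⟨F, hF⟩ := exists_smoothFun_eventuallyEq (n := n) (f ∘ φ.symm)
    (isOpen_extChartAt_target x₀) (mem_extChartAt_target x₀)
    (f.contMDiff.comp_contMDiffOn (contMDiffOn_extChartAt_symm x₀))
  obtain ⟨G, hG, hG₀, hFG⟩ := exists_hadamard F (contMDiff_iff_contDiff.1 F.contMDiff) (φ x₀)
  choose g hg using fun i : Fin n => exists_smoothFun_eventuallyEq (n := n)
    (fun x => G (φ x) (EuclideanSpace.single i 1)) (chartAt (EuclideanSpace ℝ (Fin n)) x₀).open_source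
    (mem_chart_source _ x₀) (((hG.clm_apply contDiff_const).contMDiff).comp_contMDiffOn
      (contMDiffOn_extChartAt (I := 𝓡 n) (x := x₀)))
  let S : SmoothFun n P := ∑ i, (w i - algebraMap ℝ _ (w i x₀)) * g i
  have hS (x) : S x = ∑ i, (w i x - w i x₀) * g i x := smoothFun_sum_apply _ _ _
  have hloc : ∀ᶠ x in 𝓝 x₀, f x - f x₀ = S x := by
    have hF' := (continuousAt_extChartAt (I := 𝓡 n) x₀).eventually hF
    filter_upwards [hw, hF', eventually_all.2 hg, extChartAt_source_mem_nhds (I := 𝓡 n) x₀]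
      with x h₁ h₂ h₃ h₄
    have hv (v : EuclideanSpace ℝ (Fin n)) :
        G (φ x) v = ∑ i, v i * G (φ x) (EuclideanSpace.single i 1) := by
      conv_lhs => rw [← (EuclideanSpace.basisFun (Fin n) ℝ).sum_repr v]
      simp
    have h₅ : F (φ x) = f x := by
      rw [h₂, Function.comp_apply]; exact congrArg f (φ.left_inv h₄)
    have h₆ : F (φ x₀) = f x₀ := by
      rw [hF.self_of_nhds, Function.comp_apply]
      exact congrArg f (φ.left_inv (mem_extChartAt_source x₀))
    rw [← h₅, ← h₆, hFG, hv, hS]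
    refine Finset.sum_congr rfl fun i _ => ?_
    rw [h₁, h₃, hw.self_of_nhds]
    rfl
  obtain ⟨χ, -, hχ⟩ := (SmoothBumpFunction.nhds_basis_support (I := 𝓡 n) hloc).mem_iff.1 hloc
  let X : SmoothFun n P := ⟨χ, χ.contMDiff⟩
  have hX : X x₀ = 1 := χ.eq_one
  have heq : X * (f - algebraMap ℝ _ (f x₀)) = X * S := by
    ext x
    change χ x * (f x - f x₀) = χ x * S x
    by_cases hx : χ x = 0
    · rw [hx, zero_mul, zero_mul]
    · rw [show f x - f x₀ = S x from hχ hx]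
  have hS₀ : S x₀ = 0 := by rw [hS]; simp
  have h := congrArg D heq
  rw [hmul, hmul, hX, hS₀, one_mul, one_mul, zero_mul, add_zero, map_sub, hconst, sub_zero] at h
  have h₀ : (f - algebraMap ℝ _ (f x₀)) x₀ = 0 := sub_self (f x₀)
  rw [h₀, zero_mul, add_zero] at h
  rw [h, map_sum]
  have hfd : fderiv ℝ (f ∘ φ.symm) (φ x₀) = G (φ x₀) := by rw [hG₀]; exact hF.fderiv_eq.symm
  change _ = fderiv ℝ (f ∘ φ.symm) (φ x₀) _
  rw [hfd]
  have hv (v : EuclideanSpace ℝ (Fin n)) :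
      G (φ x₀) v = ∑ i, v i * G (φ x₀) (EuclideanSpace.single i 1) := by
    conv_lhs => rw [← (EuclideanSpace.basisFun (Fin n) ℝ).sum_repr v]
    simp
  rw [hv]
  refine Finset.sum_congr rfl fun i _ => ?_
  have h₁ : (w i - algebraMap ℝ _ (w i x₀)) x₀ = 0 := sub_self (w i x₀)
  rw [hmul, h₁, zero_mul, zero_add, map_sub, hconst, sub_zero, (hg i).self_of_nhds, mul_comm]

omit [T2Space P] [SigmaCompactSpace P] in
/-- The coordinates of a tangent vector are the derivatives of the coordinate functions. -/
lemma mfderiv_extChartAt_apply {x₀ : P} {w : Fin n → SmoothFun n P} {x : P}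
    (hx : x ∈ (extChartAt (𝓡 n) x₀).source)
    (hw : ∀ᶠ y in 𝓝 x, ∀ i, w i y = extChartAt (𝓡 n) x₀ y i) (v : TangentSpace (𝓡 n) x)
    (i : Fin n) :
    (show EuclideanSpace ℝ (Fin n) from mfderiv (𝓡 n) 𝓘(ℝ, EuclideanSpace ℝ (Fin n)) (extChartAt (𝓡 n) x₀) x v) i
      = mfderiv (𝓡 n) 𝓘(ℝ, ℝ) (w i) x v := by
  have h₁ : (w i : P → ℝ) =ᶠ[𝓝 x] EuclideanSpace.proj (𝕜 := ℝ) i ∘ extChartAt (𝓡 n) x₀ :=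
    hw.mono fun y hy => hy i
  rw [h₁.mfderiv_eq, mfderiv_comp x
    (EuclideanSpace.proj (𝕜 := ℝ) i).mdifferentiableAt
    (mdifferentiableAt_extChartAt (by simpa using hx)), ContinuousLinearMap.mfderiv_eq]
  rfl

/-- A derivation at a point is the derivative along a tangent vector. -/
lemma exists_tangent (x₀ : P) (D : SmoothFun n P →+ ℝ)
    (hmul : ∀ f g, D (f * g) = f x₀ * D g + g x₀ * D f)
    (hconst : ∀ c : ℝ, D (algebraMap ℝ _ c) = 0) : ∃ v : TangentSpace (𝓡 n) x₀,
      ∀ f : SmoothFun n P, mfderiv (𝓡 n) 𝓘(ℝ, ℝ) f x₀ v = D f := by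
  obtain ⟨w, hw⟩ := exists_coordinates (n := n) x₀
  refine ⟨(WithLp.toLp 2 fun i => D (w i) : EuclideanSpace ℝ (Fin n)), fun f => ?_⟩
  rw [pointDerivation_eq x₀ D hmul hconst w hw f]
  rw [(f.contMDiff.mdifferentiableAt (by simp)).mfderiv]
  simp [writtenInExtChartAt]
  rfl

/-- Tangent vectors are separated by global functions. -/
lemma tangent_ext {x₀ : P} {v v' : TangentSpace (𝓡 n) x₀}
    (h : ∀ f : SmoothFun n P, mfderiv (𝓡 n) 𝓘(ℝ, ℝ) f x₀ v = mfderiv (𝓡 n) 𝓘(ℝ, ℝ) f x₀ v') :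
    v = v' := by
  obtain ⟨w, hw⟩ := exists_coordinates (n := n) x₀
  have hinv := isInvertible_mfderiv_extChartAt (I := 𝓡 n) (mem_extChartAt_source (I := 𝓡 n) x₀)
  refine hinv.injective ?_
  refine PiLp.ext fun i => ?_
  exact (mfderiv_extChartAt_apply (mem_extChartAt_source x₀) hw v i).trans
    ((h (w i)).trans (mfderiv_extChartAt_apply (mem_extChartAt_source x₀) hw v' i).symm)

end PointDerivation
end QuantumGroupoids

namespace QuantumGroupoids

/-! ### Lie algebroid structures from their sections -/

section Anchor

open Filter Topology

variable {n : ℕ} {P : Type*} [TopologicalSpace P] [ChartedSpace (EuclideanSpace ℝ (Fin n)) P]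
  {F : Type*} [NormedAddCommGroup F] [NormedSpace ℝ F]
  {E : P → Type*} [TopologicalSpace (TotalSpace F E)] [∀ x, AddCommGroup (E x)]
  [∀ x, Module ℝ (E x)] [∀ x, TopologicalSpace (E x)] [FiberBundle F E] [VectorBundle ℝ F E]
  [IsManifold (𝓡 n) ∞ P]

/-- A Lie-Rinehart structure on `Γ(E)` whose anchor comes from a bundle map is a Lie algebroid. -/
def LieAlgebroid.ofSections (S : LieRinehart (SmoothFun n P) (SmoothSec n F E))
    (ρ : BundleMapToTangent n F E) (h : ∀ X f, ρ.deriv X f = S.anchor X f) :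
    LieAlgebroid n F E where
  anchor := ρ
  bracket := S.bracket
  add_bracket := S.add_bracket
  bracket_add := S.bracket_add
  bracket_self := S.bracket_self
  jacobi := S.jacobi
  leibniz X f Y := by rw [S.leibniz, h]
  anchor_bracket X Y f := by simp only [h, S.anchor_bracket]

lemma LieAlgebroid.sections_ofSections (S : LieRinehart (SmoothFun n P) (SmoothSec n F E))
    (ρ : BundleMapToTangent n F E) (h : ∀ X f, ρ.deriv X f = S.anchor X f) :
    (LieAlgebroid.ofSections S ρ h).sections = S :=
  LieRinehart.ext rfl (LinearMap.ext fun X => Derivation.ext fun f => h X f)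

variable [T2Space P] [SigmaCompactSpace P]

/-- A derivation `δ : C^∞(P) → Γ(E)` is the transpose of a smooth bundle map `E^* → TP`. -/
lemma exists_bundleMapToTangent (δ : SmoothFun n P →+ SmoothSec n F E)
    (hmul : ∀ f g, δ (f * g) = f • δ g + g • δ f) (hconst : ∀ c : ℝ, δ (algebraMap ℝ _ c) = 0) :
    ∃ ρ : BundleMapToTangent n (F →L[ℝ] ℝ) (DualBundle E), ∀ x (η : DualBundle E x)
      (f : SmoothFun n P), mfderiv (𝓡 n) 𝓘(ℝ, ℝ) f x (ρ.toFun x η) = η (δ f x) := by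
  choose v hv using fun x (η : DualBundle E x) => exists_tangent (n := n) x
    (AddMonoidHom.mk' (fun f => (η (δ f x) : ℝ)) fun f g => by
      rw [map_add]; exact map_add η (δ f x) (δ g x))
    (fun f g => by
      rw [AddMonoidHom.mk'_apply, hmul]
      refine (map_add η (f x • δ g x) (g x • δ f x)).trans ?_
      rw [map_smul, map_smul]; rfl)
    (fun c => by rw [AddMonoidHom.mk'_apply, hconst]; exact map_zero η)
  simp only [AddMonoidHom.mk'_apply] at hv
  refine ⟨⟨fun x =>
    { toFun := v x
      map_add' := fun η η' => tangent_ext fun f => by rw [hv, map_add, hv, hv]; rfl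
      map_smul' := fun c η => tangent_ext fun f => by rw [hv, RingHom.id_apply, map_smul, hv]; rfl },
    fun p₀ => ?_⟩, fun x η f => hv x η f⟩
  obtain ⟨w, hw⟩ := exists_coordinates (n := n) p₀.1
  refine contMDiffAt_totalSpace.2 ⟨(contMDiff_proj (DualBundle E)).contMDiffAt, ?_⟩
  have hsm (i : Fin n) : ContMDiff ((𝓡 n).prod 𝓘(ℝ, F →L[ℝ] ℝ)) 𝓘(ℝ, ℝ) ∞
      fun p : TotalSpace (F →L[ℝ] ℝ) (DualBundle E) => (p.2 (δ (w i) p.1) : ℝ) := by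
    have h := ContMDiff.clm_bundle_apply (n := ∞) (F₁ := F) (F₂ := ℝ) (E₁ := E)
      (E₂ := Bundle.Trivial P ℝ) (b := fun p : TotalSpace (F →L[ℝ] ℝ) (DualBundle E) => p.1)
      (ϕ := fun p => p.2) (v := fun p => δ (w i) p.1) contMDiff_id
      ((δ (w i)).contMDiff.comp (contMDiff_proj (DualBundle E)))
    exact fun p => (contMDiffAt_totalSpace.1 (h p)).2
  have hsm' : ContMDiff ((𝓡 n).prod 𝓘(ℝ, F →L[ℝ] ℝ)) 𝓘(ℝ, EuclideanSpace ℝ (Fin n)) ∞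
      fun p : TotalSpace (F →L[ℝ] ℝ) (DualBundle E) =>
        (WithLp.toLp 2 fun i => (p.2 (δ (w i) p.1) : ℝ) : EuclideanSpace ℝ (Fin n)) :=
    ((PiLp.continuousLinearEquiv 2 ℝ fun _ : Fin n => ℝ).symm.contDiff (n := ∞)).contMDiff.comp
      (contMDiff_pi_space.2 hsm)
  refine hsm'.contMDiffAt.congr_of_eventuallyEq ?_
  have hcont : ContinuousAt (fun p : TotalSpace (F →L[ℝ] ℝ) (DualBundle E) => p.1) p₀ :=
    (FiberBundle.continuous_proj _ _).continuousAt
  filter_upwards [hcont.eventually hw.eventually_nhds,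
    hcont.eventually (extChartAt_source_mem_nhds (I := 𝓡 n) p₀.1)] with p hp hp'
  refine PiLp.ext fun i => ?_
  refine Eq.trans ?_ (((mfderiv_extChartAt_apply hp' hp (v p.1 p.2) i)).trans (hv p.1 p.2 (w i)))
  have hx : p.1 ∈ (chartAt (EuclideanSpace ℝ (Fin n)) p₀.1).source := by
    rw [← extChartAt_source (𝓡 n)]; exact hp'
  rw [← TangentBundle.continuousLinearMapAt_trivializationAt hx]
  refine congrFun (congrArg WithLp.ofLp ?_) i
  exact (Trivialization.continuousLinearMapAt_apply_of_mem (R := ℝ) (trivializationAt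
    (EuclideanSpace ℝ (Fin n)) (TangentSpace (𝓡 n)) p₀.1) (by simpa using hx) (v p.1 p.2)).symm

end Anchor
end QuantumGroupoids

namespace QuantumGroupoids

/-! ### Uniqueness of the dual Lie algebroid, and the theorem -/

section Uniqueness

variable {n : ℕ} {P : Type*} [TopologicalSpace P] [ChartedSpace (EuclideanSpace ℝ (Fin n)) P]
  {F : Type*} [NormedAddCommGroup F] [NormedSpace ℝ F]
  {E : P → Type*} [TopologicalSpace (TotalSpace F E)] [∀ x, AddCommGroup (E x)]
  [∀ x, Module ℝ (E x)] [∀ x, TopologicalSpace (E x)] [FiberBundle F E] [VectorBundle ℝ F E]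
  [IsManifold (𝓡 n) ∞ P] [T2Space P] [SigmaCompactSpace P]

/-- The Lie algebroid structure on `E^*` is determined by its differential. -/
lemma SectionDualSystem.lieAlgebroid_eq (D : SectionDualSystem n F E)
    {B B' : LieAlgebroid n (F →L[ℝ] ℝ) (DualBundle E)}
    {δ : DegreeOneDerivation (SmoothFun n P) (SmoothSec n F E)}
    (h : IsInducedDifferential B.sections sectionPairing δ)
    (h' : IsInducedDifferential B'.sections sectionPairing δ) : B' = B := by
  have hanchor (ξ f) : B'.anchor.deriv ξ f = B.anchor.deriv ξ f :=
    (h'.onFun f ξ).symm.trans (h.onFun f ξ)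
  refine LieAlgebroid.ext (BundleMapToTangent.ext (funext fun x => LinearMap.ext fun η => ?_))
    (funext fun ξ => funext fun ζ => D.sectionPairing_bijective.1 (LinearMap.ext fun X => ?_))
  · have hη : η = ∑ i, (η (D.sec i x) : ℝ) • D.form i x := ContinuousLinearMap.ext fun v => by
      conv_lhs => rw [← D.sum_apply x v]
      rw [map_sum]
      simp only [map_smul]
      refine Eq.trans ?_ (_root_.sum_apply _ _ _).symm
      exact Finset.sum_congr rfl fun i _ => mul_comm _ _
    rw [hη, map_sum, map_sum]
    refine Finset.sum_congr rfl fun i _ => ?_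
    rw [map_smul, map_smul]
    congr 1
    exact tangent_ext fun f => congrArg (fun g : SmoothFun n P => g x) (hanchor (D.form i) f)
  · have e := (h'.onSec X ξ ζ).symm.trans (h.onSec X ξ ζ)
    have ha (ξ) : B'.sections.anchor ξ = B.sections.anchor ξ := Derivation.ext (hanchor ξ)
    rw [ha, ha] at e
    exact sub_right_injective e

end Uniqueness

end QuantumGroupoids

end

/-- A quantum groupoid deforming `UA` induces a Lie bialgebroid `(A, A^*)`, its classical limit. -/
theorem theoremB {n : ℕ} {P : Type*} [TopologicalSpace P] [T2Space P]
    [SecondCountableTopology P] [ChartedSpace (EuclideanSpace ℝ (Fin n)) P]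
    [IsManifold (𝓡 n) ∞ P]
    {F : Type*} [NormedAddCommGroup F] [NormedSpace ℝ F] [FiniteDimensional ℝ F]
    {E : P → Type*} [TopologicalSpace (TotalSpace F E)] [∀ x, AddCommGroup (E x)]
    [∀ x, Module ℝ (E x)] [∀ x, TopologicalSpace (E x)] [∀ x, IsTopologicalAddGroup (E x)]
    [∀ x, ContinuousSMul ℝ (E x)]
    [FiberBundle F E] [VectorBundle ℝ F E] [ContMDiffVectorBundle ∞ F E (𝓡 n)]
    (A : QuantumGroupoids.LieAlgebroid n F E)
    {Rh Hh : Type*} [Ring Rh] [Algebra ℝ⟦X⟧ Rh] [Ring Hh] [Algebra ℝ⟦X⟧ Hh]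
    (Q : QuantumGroupoids.QuantumGroupoid A.sections Rh Hh) :
    ∃ (B : QuantumGroupoids.LieAlgebroid n (F →L[ℝ] ℝ) (QuantumGroupoids.DualBundle E))
      (δ : QuantumGroupoids.DegreeOneDerivation (QuantumGroupoids.SmoothFun n P)
        (QuantumGroupoids.SmoothSec n F E)),
      Q.IsDelta δ ∧
      (∀ a, δ.d (δ.d a) = 0) ∧
      QuantumGroupoids.IsInducedDifferential B.sections QuantumGroupoids.sectionPairing δ ∧
      QuantumGroupoids.IsLieBialgebroid A.sections B.sections QuantumGroupoids.sectionPairing ∧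
      (∃ br : QuantumGroupoids.SmoothFun n P → QuantumGroupoids.SmoothFun n P →
          QuantumGroupoids.SmoothFun n P,
        QuantumGroupoids.IsPoissonBracket br ∧ Q.IsStarBracket br ∧
        QuantumGroupoids.IsBaseBracket A.sections B.sections QuantumGroupoids.sectionPairing br) ∧
      (∀ (B' : QuantumGroupoids.LieAlgebroid n (F →L[ℝ] ℝ) (QuantumGroupoids.DualBundle E))
        (δ' : QuantumGroupoids.DegreeOneDerivation (QuantumGroupoids.SmoothFun n P)
          (QuantumGroupoids.SmoothSec n F E)),
        Q.IsDelta δ' →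
        QuantumGroupoids.IsInducedDifferential B'.sections QuantumGroupoids.sectionPairing δ' →
        B' = B ∧ δ' = δ) := by
  have : LocallyCompactSpace P := ChartedSpace.locallyCompactSpace (EuclideanSpace ℝ (Fin n)) P
  have : SigmaCompactSpace P := inferInstance
  obtain ⟨D⟩ := QuantumGroupoids.nonempty_sectionDualSystem (n := n) (F := F) (E := E)
  obtain ⟨ι, _, φ, g, hg⟩ := D.exists_localFrames
  let r := QuantumGroupoids.LocalFrame.retraction A.sections Finset.univ φ g hg
  let p := LinearEquiv.ofBijective _ D.sectionPairing_bijective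
  let Φ := Q.preDifferential r D.dualSystem
  obtain ⟨ρ, hρ⟩ := QuantumGroupoids.exists_bundleMapToTangent Φ.onFun Φ.onFun_mul Φ.onFun_const
  let B := QuantumGroupoids.LieAlgebroid.ofSections (Q.dualSections r D.dualSystem p) ρ fun ξ f => by
    ext x
    exact hρ x (ξ x) f
  have hB : B.sections = Q.dualSections r D.dualSystem p :=
    QuantumGroupoids.LieAlgebroid.sections_ofSections _ _ _
  have hind : QuantumGroupoids.IsInducedDifferential B.sections
      QuantumGroupoids.sectionPairing Φ.toDerivation := by
    rw [hB]; exact Q.isInducedDifferential r D.dualSystem p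
  have hU := QuantumGroupoids.Envelope.locallyFiniteRank r D.dualSystem
  refine ⟨B, Φ.toDerivation, Q.isDelta_toDerivation r D.dualSystem,
    Φ.toDerivation_d_d (Q.preDifferential_onSec_onFun r D.dualSystem)
      (Q.preDifferential_d_onSec r D.dualSystem), hind, ?_,
    ⟨_, QuantumGroupoids.QuantumGroupoid.isPoissonBracket hU r D.dualSystem,
      QuantumGroupoids.QuantumGroupoid.isStarBracket hU r D.dualSystem, ?_⟩,
    fun B' δ' hδ' hB' => ?_⟩
  · rw [hB]; exact Q.isLieBialgebroid r D.dualSystem p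
  · rw [hB]; exact Q.isBaseBracket r D.dualSystem p
  · obtain rfl := hδ'.eq r (Q.isDelta_toDerivation r D.dualSystem)
    exact ⟨D.lieAlgebroid_eq hind hB', rfl⟩
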